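/- Terminology. A (ternary) $\mathbb Z$-lattice $L=\mathbb Zx_1+\mathbb Zx_2+\mathbb Zx_3$ is a lattice on a positive definite ternary quadratic space over $\mathbb Q$ (with quadratic map $Q$ and bilinear map $B$, $Q(x)=B(x,x)$) such that $Q(x)\in\mathbb Z$ for all $x\in L$. Its discriminant is $dL=\det(B(x_i,x_j))$, $[L]$ is its isometry class, $\operatorname{gen}(L)$ and $\operatorname{spn}(L)$ are its genus and spinor genus, and $g(L)$ is the number of spinor genera in $\operatorname{gen}(L)$. $L^n$ denotes $L$ with $B$ scaled by $n$. We write $\langle a,b,c,s,t,u\rangle$ for the lattice with Gram matrix $\begin{pmatrix}a&u&t\\u&b&s\\t&s&c\end{pmatrix}$. For a positive integer $n$, $([N],[M])$ is a representable pair by scaling $n$ if $M^n$ is represented by $N$ and $dN=n\cdot dM$. Given such a pair $([N],[M])$, a set $\mathfrak C$ of representable pairs $([N'],[M'])$ by scaling $n$ with $N'\in\operatorname{gen}(N)$, $M'\in\operatorname{gen}(M)$ is a genus-correspondence if for every $N'\in\operatorname{gen}(N)$ there is an $M'\in\operatorname{gen}(M)$ with $([N'],[M'])\in\mathfrak C$,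 and for every $M'\in\operatorname{gen}(M)$ there is an $N'\in\operatorname{gen}(N)$ with $([N'],[M'])\in\mathfrak C$. It respects spinor genus if for all $([N'],[M']),([N''],[M''])\in\mathfrak C$ one has $N'\in\operatorname{spn}(N'')$ if and only if $M'\in\operatorname{spn}(M'')$. Jagy's conjecture says: if $n$ is square-free, $([N],[M])$ is a representable pair by scaling $n$ and $g(N)=g(M)$, then every genus-correspondence in $\operatorname{gen}(N)/{\sim}\times\operatorname{gen}(M)/{\sim}$ respects spinor genus. Statement. Put $N_1=\langle 12,15,135,5,0,0\rangle$, $N_2=\langle 3,7,1200,0,0,1\rangle$, $N_3=\langle 3,60,140,20,0,0\rangle$, $N_4=\langle 3,27,300,0,0,1\rangle$, $N_5=\langle 27,27,40,10,10,3\rangle$, $N_6=\langle 12,28,83,12,4,-4\rangle$, $N_7=\langle 12,28,75,0,0,4\rangle$, $N_8=\langle 15,35,48,0,0,5\rangle$, $N_9=\langle 7,12,300,0,0,2\rangle$, $N_{10}=\langle 12,43,60,20,0,6\rangle$, $N_{11}=\langle 8,12,303,4,-2,4\rangle$, $N_{12}=\langle 12,35,60,10,0,0\rangle$, and $M_1=\langle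 1,20,80,0,0,0\rangle$, $M_2=\langle 5,16,20,0,0,0\rangle$, $M_3=\langle 4,20,25,10,0,0\rangle$, $M_4=\langle 4,5,80,0,0,0\rangle$, $M_5=\langle 9,9,20,0,0,1\rangle$, $M_6=\langle 4,20,21,0,2,0\rangle$. Then $15$ is square-free and: 1. $g(N_1)=g(M_1)=2$, $dN_1=15\cdot dM_1$, and $M_1^{15}$ is represented by $N_1$. 2. $\operatorname{gen}(N_1)$ consists of exactly $12$ isometry classes, namely $[N_1],\dots,[N_{12}]$; up to isometry $\operatorname{spn}(N_1)=\{N_i:1\le i\le 6\}$ and $\operatorname{spn}(N_7)=\{N_i:7\le i\le 12\}$. 3. $\operatorname{gen}(M_1)$ consists of exactly $6$ isometry classes, namely $[M_1],\dots,[M_6]$; up to isometry $\operatorname{spn}(M_1)=\{M_1,M_2,M_3\}$ and $\operatorname{spn}(M_4)=\{M_4,M_5,M_6\}$. 4. The set $$\begin{aligned}\mathfrak S=\{&([N_1],[M_1]),([N_9],[M_1]),([N_3],[M_2]),([N_7],[M_2]),([N_5],[M_3]),([N_{11}],[M_3]),\\&([N_2],[M_4]),([N_8],[M_4]),([N_6],[M_5]),([N_{10}],[M_5]),([N_4],[M_6]),([N_{12}],[M_6])\}\end{aligned}$$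 is a genus-correspondence (with $n=15$) which does not respect spinor genus. Consequently, Jagy's conjecture is false. -/

import Mathlib

open Matrix

/-- A ternary `ℤ`-lattice `L = ℤ x₁ + ℤ x₂ + ℤ x₃` on a positive definite ternary quadratic space
over `ℚ`, given by its matrix presentation `(B(xᵢ, xⱼ))` in a `ℤ`-basis, so that
`Q(a₁ x₁ + a₂ x₂ + a₃ x₃) = aᵀ (B(xᵢ, xⱼ)) a`.  The lattice is non-classic integral:
`Q(x) ∈ ℤ` for all `x ∈ L` (the off-diagonal Gram entries may be half-integers). -/
@[ext]
structure TernaryLattice where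
  gram : Matrix (Fin 3) (Fin 3) ℚ
  symm : gram.IsSymm
  pos : ∀ x : Fin 3 → ℚ, x ≠ 0 → 0 < x ⬝ᵥ gram *ᵥ x
  norm_int : ∀ a : Fin 3 → ℤ, ∃ k : ℤ,
    (fun i => (a i : ℚ)) ⬝ᵥ gram *ᵥ (fun i => (a i : ℚ)) = (k : ℚ)

namespace TernaryLattice

/-! ### Discriminant, isometry classes, genus -/

/-- The discriminant `dL = det (B(xᵢ, xⱼ))`. -/
def disc (L : TernaryLattice) : ℚ := L.gram.det

/-- `L` and `K` are isometric: their Gram matrices are conjugate under a change of `ℤ`-basis. -/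
def Isometric (L K : TernaryLattice) : Prop :=
  ∃ U : GL (Fin 3) ℤ,
    ((U : Matrix (Fin 3) (Fin 3) ℤ).map (fun a : ℤ => (a : ℚ)))ᵀ * L.gram *
      ((U : Matrix (Fin 3) (Fin 3) ℤ).map (fun a : ℤ => (a : ℚ))) = K.gram

/-- The isometry class `[L]`. -/
def cls (L : TernaryLattice) : Set TernaryLattice := {K | Isometric L K}

/-- The Gram matrix of `L` over `ℚ_p`. -/
noncomputable def localGram (p : ℕ) [Fact p.Prime] (L : TernaryLattice) :
    Matrix (Fin 3) (Fin 3) ℚ_[p] :=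
  L.gram.map (fun a : ℚ => (a : ℚ_[p]))

/-- An element of `GL₃(ℤ_p)` as a matrix over `ℚ_p`. -/
noncomputable def localUnit (p : ℕ) [Fact p.Prime] (U : GL (Fin 3) ℤ_[p]) :
    Matrix (Fin 3) (Fin 3) ℚ_[p] :=
  (U : Matrix (Fin 3) (Fin 3) ℤ_[p]).map (fun a : ℤ_[p] => (a : ℚ_[p]))

/-- The genus of `L`: all lattices `K` with `K_p ≃ L_p` for every prime `p`. (At the infinite place
all lattices here are isometric, being positive definite.) -/
def gen (L : TernaryLattice) : Set TernaryLattice :=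
  {K | ∀ (p : ℕ) [Fact p.Prime], ∃ U : GL (Fin 3) ℤ_[p],
    (localUnit p U)ᵀ * localGram p L * localUnit p U = localGram p K}

/-! ### Spinor norm and spinor genus -/

/-- For a symmetric matrix `A`, the matrix of the symmetry
`τ_v : x ↦ x - (2 B(x, v) / Q(v)) v` of the quadratic space with Gram matrix `A`. -/
def reflection {F : Type*} [Field F] (A : Matrix (Fin 3) (Fin 3) F) (v : Fin 3 → F) :
    Matrix (Fin 3) (Fin 3) F :=
  1 - (2 / (v ⬝ᵥ A *ᵥ v)) • vecMulVec v (A *ᵥ v)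

/-- The spinor kernel `O'(V)` of the quadratic space `V` with Gram matrix `A`: the rotations
`τ_{v₁} ⋯ τ_{v_r}` (with `r` even and all `vᵢ` anisotropic) whose spinor norm
`Q(v₁) ⋯ Q(v_r) (F^×)²` is trivial. -/
def spinorKernel {F : Type*} [Field F] (A : Matrix (Fin 3) (Fin 3) F) :
    Set (Matrix (Fin 3) (Fin 3) F) :=
  {σ | ∃ l : List (Fin 3 → F), Even l.length ∧ (∀ v ∈ l, v ⬝ᵥ A *ᵥ v ≠ 0) ∧
    σ = (l.map (reflection A)).prod ∧ IsSquare (l.map (fun v => v ⬝ᵥ A *ᵥ v)).prod}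

/-- The spinor genus of `L`.  With `V = ℚ³` carrying the Gram matrix of `L` and `L = ℤ³ ⊆ V`, the
lattice `K` belongs to it if and only if some isometric copy `T ℤ³ ⊆ V` of `K` satisfies
`(T ℤ³)_p = σ_p L_p` with some `σ_p ∈ O'(V_p)`, for every prime `p`; the last equation says that
`T = σ_p U_p` with `U_p ∈ GL₃(ℤ_p)`.  (In odd rank, `-1` is an isometry of determinant `-1`, so
spinor genera and proper spinor genera coincide.) -/
def spn (L : TernaryLattice) : Set TernaryLattice :=
  {K | ∃ T : GL (Fin 3) ℚ,
    (T : Matrix (Fin 3) (Fin 3) ℚ)ᵀ * L.gram * (T : Matrix (Fin 3) (Fin 3) ℚ) = K.gram ∧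
    ∀ (p : ℕ) [Fact p.Prime],
      ∃ σ ∈ spinorKernel (localGram p L), ∃ U : GL (Fin 3) ℤ_[p],
        (T : Matrix (Fin 3) (Fin 3) ℚ).map (fun a : ℚ => (a : ℚ_[p])) = σ * localUnit p U}

/-- `g(L)`, the number of spinor genera in `gen L`. -/
noncomputable def g (L : TernaryLattice) : ℕ := (spn '' gen L).ncard

/-! ### Genus-correspondences -/

/-- `M^n → N`: the lattice `M` with its bilinear map scaled by `n` is represented by `N`. -/
def ScaledRepresented (n : ℕ) (M N : TernaryLattice) : Prop :=
  ∃ X : Matrix (Fin 3) (Fin 3) ℤ,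
    (X.map (fun a : ℤ => (a : ℚ)))ᵀ * N.gram * X.map (fun a : ℤ => (a : ℚ)) = (n : ℚ) • M.gram

/-- `([N], [M])` is a representable pair by scaling `n`: `M^n → N` and `dN = n · dM`
(equivalently, `M^n` is isometric to a sublattice of index `n` of `N`). -/
def RepresentablePair (n : ℕ) (N M : TernaryLattice) : Prop :=
  ScaledRepresented n M N ∧ N.disc = n * M.disc

/-- `C ⊆ gen(N)/∼ × gen(M)/∼` is a genus-correspondence (by scaling `n`). -/
def IsGenusCorrespondence (n : ℕ) (N M : TernaryLattice)
    (C : Set (Set TernaryLattice × Set TernaryLattice)) : Prop :=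
  (∀ c ∈ C, ∃ N' ∈ gen N, ∃ M' ∈ gen M, c = (cls N', cls M') ∧ RepresentablePair n N' M') ∧
  (∀ N' ∈ gen N, ∃ M' ∈ gen M, (cls N', cls M') ∈ C) ∧
  (∀ M' ∈ gen M, ∃ N' ∈ gen N, (cls N', cls M') ∈ C)

/-- The genus-correspondence `C` respects spinor genus. -/
def RespectsSpinorGenus (C : Set (Set TernaryLattice × Set TernaryLattice)) : Prop :=
  ∀ N₁ M₁ N₂ M₂ : TernaryLattice, (cls N₁, cls M₁) ∈ C → (cls N₂, cls M₂) ∈ C →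
    (N₁ ∈ spn N₂ ↔ M₁ ∈ spn M₂)

/-- Jagy's conjecture: if `n` is square-free, `([N], [M])` is a representable pair by scaling `n`
and `g(N) = g(M)`, then every genus-correspondence respects spinor genus. -/
def JagyConjecture : Prop :=
  ∀ (n : ℕ) (N M : TernaryLattice), Squarefree n → RepresentablePair n N M → g N = g M →
    ∀ C, IsGenusCorrespondence n N M C → RespectsSpinorGenus C

/-! ### The lattices of the example -/

theorem pos_of_minors (a b c s t u : ℚ) (h1 : 0 < a) (h2 : 0 < a * b - u ^ 2)
    (h3 : 0 < a * b * c + 2 * s * t * u - a * s ^ 2 - b * t ^ 2 - c * u ^ 2)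
    (x : Fin 3 → ℚ) (hx : x ≠ 0) : 0 < x ⬝ᵥ !![a, u, t; u, b, s; t, s, c] *ᵥ x := by
  have e : x ⬝ᵥ !![a, u, t; u, b, s; t, s, c] *ᵥ x =
      a * x 0 ^ 2 + b * x 1 ^ 2 + c * x 2 ^ 2 + 2 * s * x 1 * x 2 + 2 * t * x 0 * x 2
        + 2 * u * x 0 * x 1 := by
    simp [dotProduct, mulVec, Fin.sum_univ_three]
    ring
  rw [e]
  set X := x 0 with hX
  set Y := x 1 with hY
  set Z := x 2 with hZ
  set q := a * X ^ 2 + b * Y ^ 2 + c * Z ^ 2 + 2 * s * Y * Z + 2 * t * X * Z + 2 * u * X * Y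
    with hq
  set m := a * b - u ^ 2 with hm
  set d := a * b * c + 2 * s * t * u - a * s ^ 2 - b * t ^ 2 - c * u ^ 2 with hd
  have key : a * m * q = m * (a * X + u * Y + t * Z) ^ 2
      + (m * Y + (a * s - u * t) * Z) ^ 2 + a * d * Z ^ 2 := by
    rw [hq, hd, hm]
    ring
  have ham : 0 < a * m := mul_pos h1 h2
  by_contra hcon
  have hle : a * m * q ≤ 0 := mul_nonpos_of_nonneg_of_nonpos ham.le (not_lt.mp hcon)
  have had : 0 < a * d := mul_pos h1 h3
  have n1 : 0 ≤ m * (a * X + u * Y + t * Z) ^ 2 := by positivity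
  have n2 : 0 ≤ (m * Y + (a * s - u * t) * Z) ^ 2 := sq_nonneg _
  have n3 : 0 ≤ a * d * Z ^ 2 := by positivity
  have z3 : a * d * Z ^ 2 = 0 := by linarith
  have z2 : (m * Y + (a * s - u * t) * Z) ^ 2 = 0 := by linarith
  have z1 : m * (a * X + u * Y + t * Z) ^ 2 = 0 := by linarith
  have hZ0 : Z = 0 := by simpa [had.ne'] using z3
  have hY0 : Y = 0 := by simpa [hZ0, h2.ne'] using z2
  have hX0 : X = 0 := by simpa [hZ0, hY0, h2.ne', h1.ne'] using z1
  apply hx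
  funext i
  fin_cases i
  · exact hX0
  · exact hY0
  · exact hZ0

/-- The lattice `⟨a, b, c, s, t, u⟩` with matrix presentation
`(a, u, t; u, b, s; t, s, c)`, for integers `a, b, c, s, t, u` (positive definite by the
assumption on the leading minors). -/
def sextuple (a b c s t u : ℤ) (h : 0 < a ∧ 0 < a * b - u ^ 2 ∧
    0 < a * b * c + 2 * s * t * u - a * s ^ 2 - b * t ^ 2 - c * u ^ 2) : TernaryLattice where
  gram := !![(a : ℚ), (u : ℚ), (t : ℚ); (u : ℚ), (b : ℚ), (s : ℚ); (t : ℚ), (s : ℚ), (c : ℚ)]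
  symm := by
    ext i j
    fin_cases i <;> fin_cases j <;> rfl
  pos := pos_of_minors _ _ _ _ _ _ (by exact_mod_cast h.1) (by exact_mod_cast h.2.1)
    (by exact_mod_cast h.2.2)
  norm_int := fun x => by
    refine ⟨a * x 0 ^ 2 + b * x 1 ^ 2 + c * x 2 ^ 2 + 2 * s * x 1 * x 2 + 2 * t * x 0 * x 2
      + 2 * u * x 0 * x 1, ?_⟩
    simp [dotProduct, mulVec, Fin.sum_univ_three]
    ring

def N₁ : TernaryLattice := sextuple 12 15 135 5 0 0 (by norm_num)
def N₂ : TernaryLattice := sextuple 3 7 1200 0 0 1 (by norm_num)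
def N₃ : TernaryLattice := sextuple 3 60 140 20 0 0 (by norm_num)
def N₄ : TernaryLattice := sextuple 3 27 300 0 0 1 (by norm_num)
def N₅ : TernaryLattice := sextuple 27 27 40 10 10 3 (by norm_num)
def N₆ : TernaryLattice := sextuple 12 28 83 12 4 (-4) (by norm_num)
def N₇ : TernaryLattice := sextuple 12 28 75 0 0 4 (by norm_num)
def N₈ : TernaryLattice := sextuple 15 35 48 0 0 5 (by norm_num)
def N₉ : TernaryLattice := sextuple 7 12 300 0 0 2 (by norm_num)
def N₁₀ : TernaryLattice := sextuple 12 43 60 20 0 6 (by norm_num)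
def N₁₁ : TernaryLattice := sextuple 8 12 303 4 (-2) 4 (by norm_num)
def N₁₂ : TernaryLattice := sextuple 12 35 60 10 0 0 (by norm_num)

def M₁ : TernaryLattice := sextuple 1 20 80 0 0 0 (by norm_num)
def M₂ : TernaryLattice := sextuple 5 16 20 0 0 0 (by norm_num)
def M₃ : TernaryLattice := sextuple 4 20 25 10 0 0 (by norm_num)
def M₄ : TernaryLattice := sextuple 4 5 80 0 0 0 (by norm_num)
def M₅ : TernaryLattice := sextuple 9 9 20 0 0 1 (by norm_num)
def M₆ : TernaryLattice := sextuple 4 20 21 0 2 0 (by norm_num)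

/-- The set `𝔖` of pairs of isometry classes. -/
def corrS : Set (Set TernaryLattice × Set TernaryLattice) :=
  {(cls N₁, cls M₁), (cls N₉, cls M₁), (cls N₃, cls M₂), (cls N₇, cls M₂),
    (cls N₅, cls M₃), (cls N₁₁, cls M₃), (cls N₂, cls M₄), (cls N₈, cls M₄),
    (cls N₆, cls M₅), (cls N₁₀, cls M₅), (cls N₄, cls M₆), (cls N₁₂, cls M₆)}

end TernaryLattice

open TernaryLattice

/-!
# A counterexample to Jagy's conjecture

*The genera.* Every class of ternary lattices contains a reduced form (`exists_reduced`), whose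
entries are bounded in terms of the determinant. A lattice in `gen N₁` or `gen M₁` is integral, has
the determinant of `N₁` or `M₁`, and its values, and those of its adjoint, satisfy congruences
modulo powers of `2` and `5` (`genusCond_N`, `genusCond_M`). A finite search (`search_N`,
`search_M`) then leaves the listed lattices only. Conversely, these are in the genus: pairs of
rational isometries with coprime denominators give `N₇ ∈ gen N₁` and `M₄ ∈ gen M₁`
(`mem_gen_of_isometries`), and the remaining ones are reached from `N₁`, `N₇`, `M₁`, `M₄` inside the
spinor genera by explicit rational isometries that are integral outside one prime `q` and are,
at `q`, a product of two reflections of trivial spinor norm times an element of `GL₃(ℤ_q)`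
(`mem_spn_of_certificate`). The classes are distinct since they represent different integers.

*The spinor genera.* It remains to see that `N₇ ∉ spn N₁` and `M₄ ∉ spn M₁`. All the quadratic
spaces involved are scaled copies of `⟨1, 1, 5⟩`, whose rotations are `rot w x y z / qnorm w x y z`
with the norm form `qnorm w x y z = w² + 5x² + 5y² + z²` of a quaternion algebra, and the spinor
norm of such a rotation is the class of `qnorm w x y z`. A spinor equivalence therefore yields one
integer `c > 0` such that, for every prime `p`, `c` is up to squares in `ℚ_p` the norm of a
primitive quaternion over `ℤ_p` whose rotation carries one lattice to the other at `p`
(`exists_norm_of_mem_spn`). This determines enough of `c` modulo squares: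

* for `M₁` and `M₄`, `c` is a norm from `ℚ_p(i)` for all `p ≠ 2`, but `c ∈ 2 (3 + 4 ℤ_2)` up to
  squares of `ℚ_2` is not a norm from `ℚ_2(i)`;
* for `N₃` and `N₇`, `c` is a norm from `ℚ_p(√-5)` for all `p ≠ 2`, but `c ∈ 3 + 4 ℤ_2` up to
  squares of `ℚ_2` is not a norm from `ℚ_2(√-5)`.

Both contradict the product formula; here the contradiction is read off from the residue modulo `4`,
respectively `20`, of the part of `c` prime to `2`, respectively to `10`.

*The correspondence.* Explicit integral matrices represent the scaled lattices, and `𝔖` pairs the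
class of `M₁` with those of `N₁` and `N₉`, which lie in different spinor genera.
-/

namespace TernaryLattice

/-! ### Casting matrices -/

lemma isometric_refl (L : TernaryLattice) : Isometric L L :=
  ⟨1, by simp⟩

lemma map_mul_cast (A B : Matrix (Fin 3) (Fin 3) ℤ) :
    (A * B).map (fun a : ℤ => (a : ℚ)) =
      A.map (fun a : ℤ => (a : ℚ)) * B.map (fun a : ℤ => (a : ℚ)) :=
  map_mul (Int.castRingHom ℚ).mapMatrix A B

lemma Isometric.trans {L K J : TernaryLattice} (h₁ : Isometric L K) (h₂ : Isometric K J) :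
    Isometric L J := by
  obtain ⟨U, hU⟩ := h₁
  obtain ⟨V, hV⟩ := h₂
  refine ⟨U * V, ?_⟩
  rw [← hV, ← hU, Units.val_mul, map_mul_cast, transpose_mul]
  simp only [Matrix.mul_assoc]

lemma Isometric.symm {L K : TernaryLattice} (h : Isometric L K) : Isometric K L := by
  obtain ⟨U, hU⟩ := h
  refine ⟨U⁻¹, ?_⟩
  have h1 : (U : Matrix (Fin 3) (Fin 3) ℤ).map (fun a : ℤ => (a : ℚ)) *
      ((U⁻¹ : GL (Fin 3) ℤ) : Matrix (Fin 3) (Fin 3) ℤ).map (fun a : ℤ => (a : ℚ)) = 1 := by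
    rw [← map_mul_cast, ← Units.val_mul]
    simp
  rw [← hU]
  calc _ = ((U : Matrix (Fin 3) (Fin 3) ℤ).map (fun a : ℤ => (a : ℚ)) *
      ((U⁻¹ : GL (Fin 3) ℤ) : Matrix (Fin 3) (Fin 3) ℤ).map (fun a : ℤ => (a : ℚ)))ᵀ * L.gram *
      ((U : Matrix (Fin 3) (Fin 3) ℤ).map (fun a : ℤ => (a : ℚ)) *
      ((U⁻¹ : GL (Fin 3) ℤ) : Matrix (Fin 3) (Fin 3) ℤ).map (fun a : ℤ => (a : ℚ))) := by
        rw [transpose_mul]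
        simp only [Matrix.mul_assoc]
    _ = L.gram := by rw [h1]; simp

lemma cls_eq_iff {L K : TernaryLattice} : cls L = cls K ↔ Isometric L K := by
  constructor
  · intro h
    have : K ∈ cls K := isometric_refl K
    rw [← h] at this
    exact this
  · intro h
    ext J
    exact ⟨fun hJ => h.symm.trans hJ, fun hJ => h.trans hJ⟩

/-! ### The genus -/

section Local
variable (p : ℕ) [Fact p.Prime]

lemma localUnit_mul (U V : GL (Fin 3) ℤ_[p]) :
    localUnit p (U * V) = localUnit p U * localUnit p V :=
  map_mul (PadicInt.Coe.ringHom (p := p)).mapMatrix U.1 V.1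

lemma localUnit_one : localUnit p 1 = 1 :=
  map_one (PadicInt.Coe.ringHom (p := p)).mapMatrix

lemma localUnit_mul_inv (U : GL (Fin 3) ℤ_[p]) : localUnit p U * localUnit p U⁻¹ = 1 := by
  rw [← localUnit_mul, mul_inv_cancel, localUnit_one]

/-- The matrix over `ℚ_p` of a rational matrix. -/
noncomputable def ratMat (T : Matrix (Fin 3) (Fin 3) ℚ) : Matrix (Fin 3) (Fin 3) ℚ_[p] :=
  T.map (fun a : ℚ => (a : ℚ_[p]))

lemma ratMat_eq (T : Matrix (Fin 3) (Fin 3) ℚ) :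
    ratMat p T = (Rat.castHom ℚ_[p]).mapMatrix T := rfl

lemma ratMat_mul (S T : Matrix (Fin 3) (Fin 3) ℚ) :
    ratMat p (S * T) = ratMat p S * ratMat p T := by
  simp only [ratMat_eq, map_mul]

lemma ratMat_one : ratMat p 1 = 1 := by
  simp only [ratMat_eq, map_one]

lemma ratMat_transpose (T : Matrix (Fin 3) (Fin 3) ℚ) : ratMat p Tᵀ = (ratMat p T)ᵀ := rfl

lemma ratMat_gram (L : TernaryLattice) : ratMat p L.gram = localGram p L := rfl

/-- A rational matrix `n⁻¹ X` with `X` integral lies in `GL₃(ℤ_p)` if `p` divides neither `n` nor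
`det X`. -/
lemma exists_localUnit (X : Matrix (Fin 3) (Fin 3) ℤ) (n : ℤ) (hn : ¬ (p : ℤ) ∣ n)
    (hX : ¬ (p : ℤ) ∣ X.det) :
    ∃ U : GL (Fin 3) ℤ_[p],
      localUnit p U = ratMat p ((n : ℚ)⁻¹ • X.map (fun a : ℤ => (a : ℚ))) := by
  have hu : ∀ m : ℤ, ¬ (p : ℤ) ∣ m → IsUnit (m : ℤ_[p]) := by
    intro m hm
    rw [PadicInt.isUnit_iff]
    refine le_antisymm (PadicInt.norm_le_one _) (not_lt.mp ?_)
    rwa [PadicInt.norm_int_lt_one_iff_dvd]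
  obtain ⟨ν, hν⟩ := hu n hn
  have hdet : IsUnit (((ν⁻¹ : ℤ_[p]ˣ) : ℤ_[p]) •
      (Int.castRingHom ℤ_[p]).mapMatrix X : Matrix (Fin 3) (Fin 3) ℤ_[p]).det := by
    rw [det_smul, ← RingHom.map_det]
    exact ((Units.isUnit _).pow _).mul (hu _ hX)
  refine ⟨Matrix.nonsingInvUnit _ hdet, ?_⟩
  have hcoe : (((ν⁻¹ : ℤ_[p]ˣ) : ℤ_[p]) : ℚ_[p]) = (n : ℚ_[p])⁻¹ := by
    apply eq_inv_of_mul_eq_one_left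
    have h := congrArg (fun z : ℤ_[p] => (z : ℚ_[p])) ν.inv_mul
    rw [hν] at h
    simpa using h
  ext i j
  change ((((ν⁻¹ : ℤ_[p]ˣ) : ℤ_[p]) * (X i j : ℤ_[p]) : ℤ_[p]) : ℚ_[p]) =
    (((n : ℚ)⁻¹ * (X i j : ℚ) : ℚ) : ℚ_[p])
  push_cast
  rw [hcoe]

end Local

lemma gen_trans {L K J : TernaryLattice} (h₁ : K ∈ gen L) (h₂ : J ∈ gen K) : J ∈ gen L := by
  intro p _
  obtain ⟨U, hU⟩ := h₁ p
  obtain ⟨V, hV⟩ := h₂ p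
  refine ⟨U * V, ?_⟩
  rw [← hV, ← hU, localUnit_mul, transpose_mul]
  simp only [Matrix.mul_assoc]

lemma gen_symm {L K : TernaryLattice} (h : K ∈ gen L) : L ∈ gen K := by
  intro p _
  obtain ⟨U, hU⟩ := h p
  refine ⟨U⁻¹, ?_⟩
  rw [← hU]
  calc _ = (localUnit p U * localUnit p U⁻¹)ᵀ * localGram p L *
        (localUnit p U * localUnit p U⁻¹) := by
        rw [transpose_mul]
        simp only [Matrix.mul_assoc]
    _ = _ := by simp [localUnit_mul_inv]

/-- The image of `GL₃(ℤ)` in `GL₃(ℤ_p)`. -/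
noncomputable def intUnit (p : ℕ) [Fact p.Prime] (U : GL (Fin 3) ℤ) : GL (Fin 3) ℤ_[p] :=
  Units.map (Int.castRingHom ℤ_[p]).mapMatrix.toMonoidHom U

lemma localUnit_intUnit (p : ℕ) [Fact p.Prime] (U : GL (Fin 3) ℤ) :
    localUnit p (intUnit p U) =
      ratMat p ((U : Matrix (Fin 3) (Fin 3) ℤ).map (fun a : ℤ => (a : ℚ))) := by
  ext i j
  simp [localUnit, intUnit, ratMat]

lemma Isometric.mem_gen {L K : TernaryLattice} (h : Isometric L K) : K ∈ gen L := by
  intro p _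
  obtain ⟨U, hU⟩ := h
  refine ⟨intUnit p U, ?_⟩
  rw [localUnit_intUnit, ← ratMat_gram, ← ratMat_gram, ← hU, ratMat_mul, ratMat_mul,
    ratMat_transpose]

/-- Two rational isometries `n⁻¹ X`, `m⁻¹ Y` with coprime denominators put `K` in the genus
of `L`. -/
lemma mem_gen_of_isometries {L K : TernaryLattice} (X Y : Matrix (Fin 3) (Fin 3) ℤ) (n m : ℤ)
    (hnm : IsCoprime n m) (hn : n ≠ 0) (hm : m ≠ 0)
    (hXd : X.det = n ^ 3 ∨ X.det = -n ^ 3) (hYd : Y.det = m ^ 3 ∨ Y.det = -m ^ 3)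
    (hX : (X.map (fun a : ℤ => (a : ℚ)))ᵀ * L.gram * X.map (fun a : ℤ => (a : ℚ)) =
      (n : ℚ) ^ 2 • K.gram)
    (hY : (Y.map (fun a : ℤ => (a : ℚ)))ᵀ * L.gram * Y.map (fun a : ℤ => (a : ℚ)) =
      (m : ℚ) ^ 2 • K.gram) : K ∈ gen L := by
  intro p hp
  have hpp : Prime (p : ℤ) := Nat.prime_iff_prime_int.mp hp.out
  have key : ∀ (Z : Matrix (Fin 3) (Fin 3) ℤ) (k : ℤ), k ≠ 0 → ¬ (p : ℤ) ∣ k →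
      (Z.det = k ^ 3 ∨ Z.det = -k ^ 3) →
      (Z.map (fun a : ℤ => (a : ℚ)))ᵀ * L.gram * Z.map (fun a : ℤ => (a : ℚ)) =
        (k : ℚ) ^ 2 • K.gram → ∃ U : GL (Fin 3) ℤ_[p],
        (localUnit p U)ᵀ * localGram p L * localUnit p U = localGram p K := by
    intro Z k hk hpk hd hZ
    have hpd : ¬ (p : ℤ) ∣ Z.det := by
      rcases hd with hd | hd <;> rw [hd]
      · exact fun h => hpk (hpp.dvd_of_dvd_pow h)
      · exact fun h => hpk (hpp.dvd_of_dvd_pow ((dvd_neg).mp h))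
    obtain ⟨U, hU⟩ := exists_localUnit p Z k hpk hpd
    refine ⟨U, ?_⟩
    have hk' : (k : ℚ) ≠ 0 := by exact_mod_cast hk
    rw [hU, ← ratMat_gram, ← ratMat_gram, ← ratMat_transpose, ← ratMat_mul, ← ratMat_mul]
    congr 1
    rw [transpose_smul, Matrix.smul_mul, Matrix.smul_mul, Matrix.mul_smul, hZ, smul_smul,
      smul_smul]
    have : (k : ℚ)⁻¹ * ((k : ℚ)⁻¹ * (k : ℚ) ^ 2) = 1 := by field_simp
    rw [mul_assoc, this, one_smul]
  by_cases h : (p : ℤ) ∣ n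
  · refine key Y m hm (fun h' => hpp.not_isUnit (hnm.isUnit_of_dvd' h h')) hYd hY
  · exact key X n hn h hXd hX

/-! ### Reduction of integral ternary forms -/

/-- The integral symmetric matrix `(a, u, t; u, b, s; t, s, c)`. -/
def symMat (a b c s t u : ℤ) : Matrix (Fin 3) (Fin 3) ℤ := !![a, u, t; u, b, s; t, s, c]

/-- Equivalence of integral Gram matrices under a change of `ℤ`-basis. -/
def IntEquiv (G H : Matrix (Fin 3) (Fin 3) ℤ) : Prop :=
  ∃ U : Matrix (Fin 3) (Fin 3) ℤ, IsUnit U.det ∧ Uᵀ * G * U = H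

lemma IntEquiv.refl (G : Matrix (Fin 3) (Fin 3) ℤ) : IntEquiv G G := ⟨1, by simp, by simp⟩

lemma IntEquiv.trans {G H J : Matrix (Fin 3) (Fin 3) ℤ} (h₁ : IntEquiv G H) (h₂ : IntEquiv H J) :
    IntEquiv G J := by
  obtain ⟨U, hU, rfl⟩ := h₁
  obtain ⟨V, hV, rfl⟩ := h₂
  refine ⟨U * V, by rw [det_mul]; exact hU.mul hV, ?_⟩
  rw [transpose_mul]
  simp only [Matrix.mul_assoc]

lemma IntEquiv.isometric {L K : TernaryLattice} {G H : Matrix (Fin 3) (Fin 3) ℤ}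
    (hG : L.gram = G.map (fun a : ℤ => (a : ℚ))) (hH : K.gram = H.map (fun a : ℤ => (a : ℚ)))
    (h : IntEquiv G H) : Isometric L K := by
  obtain ⟨U, hU, rfl⟩ := h
  refine ⟨Matrix.nonsingInvUnit U hU, ?_⟩
  rw [hG, hH, map_mul_cast, map_mul_cast]
  rfl

/-- The lattice whose Gram matrix is `Uᵀ G U`, where `G` is the Gram matrix of `L`. -/
lemma exists_lattice_of_intEquiv {L : TernaryLattice} {G H : Matrix (Fin 3) (Fin 3) ℤ}
    (hG : L.gram = G.map (fun a : ℤ => (a : ℚ))) (h : IntEquiv G H) :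
    ∃ K : TernaryLattice, K.gram = H.map (fun a : ℤ => (a : ℚ)) ∧ Isometric L K := by
  obtain ⟨U, hU, rfl⟩ := id h
  set W := U.map (fun a : ℤ => (a : ℚ)) with hW
  have hH : (Uᵀ * G * U).map (fun a : ℤ => (a : ℚ)) = Wᵀ * L.gram * W := by
    rw [map_mul_cast, map_mul_cast, hG]
    rfl
  have hq : ∀ x : Fin 3 → ℚ, x ⬝ᵥ (Wᵀ * L.gram * W) *ᵥ x = (W *ᵥ x) ⬝ᵥ L.gram *ᵥ (W *ᵥ x) := by
    intro x
    rw [← mulVec_mulVec, ← mulVec_mulVec, dotProduct_mulVec x Wᵀ, vecMul_transpose]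
  have hWdet : IsUnit W.det := by
    have : W.det = ((U.det : ℤ) : ℚ) := ((Int.castRingHom ℚ).map_det U).symm
    rw [this]
    exact hU.map (Int.castRingHom ℚ)
  refine ⟨⟨Wᵀ * L.gram * W, ?_, ?_, ?_⟩, hH.symm, IntEquiv.isometric hG hH.symm h⟩
  · rw [IsSymm, transpose_mul, transpose_mul, transpose_transpose, L.symm, Matrix.mul_assoc]
  · intro x hx
    rw [hq]
    refine L.pos _ fun h0 => hx ?_
    exact (mulVec_injective_iff_isUnit.mpr ((isUnit_iff_isUnit_det W).mpr hWdet))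
      (h0.trans (mulVec_zero W).symm)
  · intro a
    obtain ⟨k, hk⟩ := L.norm_int (U *ᵥ a)
    refine ⟨k, ?_⟩
    rw [hq, ← hk]
    have : W *ᵥ (fun i => (a i : ℚ)) = fun i => (((U *ᵥ a) i : ℤ) : ℚ) := by
      ext i
      simp [mulVec, dotProduct, hW]
    rw [this]

section Moves
variable (a b c s t u : ℤ)

lemma intEquiv_shift₃₂ (k : ℤ) : IntEquiv (symMat a b c s t u)
    (symMat a b (c + 2 * k * s + k ^ 2 * b) (s + k * b) (t + k * u) u) := by
  refine ⟨!![1, 0, 0; 0, 1, k; 0, 0, 1], by simp [det_fin_three], ?_⟩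
  ext i j
  fin_cases i <;> fin_cases j <;> simp [symMat, mul_apply, Fin.sum_univ_three] <;> ring

lemma intEquiv_shift₂₁ (k : ℤ) : IntEquiv (symMat a b c s t u)
    (symMat a (b + 2 * k * u + k ^ 2 * a) c (s + k * t) t (u + k * a)) := by
  refine ⟨!![1, k, 0; 0, 1, 0; 0, 0, 1], by simp [det_fin_three], ?_⟩
  ext i j
  fin_cases i <;> fin_cases j <;> simp [symMat, mul_apply, Fin.sum_univ_three] <;> ring

lemma intEquiv_shift₃₁ (k : ℤ) : IntEquiv (symMat a b c s t u)
    (symMat a b (c + 2 * k * t + k ^ 2 * a) (s + k * u) (t + k * a) u) := by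
  refine ⟨!![1, 0, k; 0, 1, 0; 0, 0, 1], by simp [det_fin_three], ?_⟩
  ext i j
  fin_cases i <;> fin_cases j <;> simp [symMat, mul_apply, Fin.sum_univ_three] <;> ring

lemma intEquiv_neg₂ : IntEquiv (symMat a b c s t u) (symMat a b c (-s) t (-u)) := by
  refine ⟨!![1, 0, 0; 0, -1, 0; 0, 0, 1], by simp [det_fin_three], ?_⟩
  ext i j
  fin_cases i <;> fin_cases j <;> simp [symMat, mul_apply, Fin.sum_univ_three]

lemma intEquiv_neg₃ : IntEquiv (symMat a b c s t u) (symMat a b c (-s) (-t) u) := by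
  refine ⟨!![1, 0, 0; 0, 1, 0; 0, 0, -1], by simp [det_fin_three], ?_⟩
  ext i j
  fin_cases i <;> fin_cases j <;> simp [symMat, mul_apply, Fin.sum_univ_three]

lemma intEquiv_swap₁₂ : IntEquiv (symMat a b c s t u) (symMat b a c t s u) := by
  refine ⟨!![0, 1, 0; 1, 0, 0; 0, 0, 1], by simp [det_fin_three], ?_⟩
  ext i j
  fin_cases i <;> fin_cases j <;> simp [symMat, mul_apply, Fin.sum_univ_three]

lemma intEquiv_swap₂₃ : IntEquiv (symMat a b c s t u) (symMat a c b s u t) := by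
  refine ⟨!![1, 0, 0; 0, 0, 1; 0, 1, 0], by simp [det_fin_three], ?_⟩
  ext i j
  fin_cases i <;> fin_cases j <;> simp [symMat, mul_apply, Fin.sum_univ_three]

lemma det_symMat : (symMat a b c s t u).det =
    a * b * c + 2 * s * t * u - a * s ^ 2 - b * t ^ 2 - c * u ^ 2 := by
  simp [symMat, det_fin_three]
  ring

lemma minors_pos_of_gram {K : TernaryLattice}
    (h : K.gram = (symMat a b c s t u).map (fun a : ℤ => (a : ℚ))) :
    0 < a ∧ 0 < a * b - u ^ 2 := by
  have e : ∀ x : Fin 3 → ℚ, x ⬝ᵥ K.gram *ᵥ x =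
      a * x 0 ^ 2 + b * x 1 ^ 2 + c * x 2 ^ 2 + 2 * s * x 1 * x 2 + 2 * t * x 0 * x 2
        + 2 * u * x 0 * x 1 := by
    intro x
    simp [h, symMat, dotProduct, mulVec, Fin.sum_univ_three]
    ring
  have ha : 0 < a := by
    have h1 := K.pos ![1, 0, 0] (fun h0 => by simpa using congrFun h0 0)
    rw [e] at h1
    simpa using h1
  refine ⟨ha, ?_⟩
  have h2 := K.pos ![-u, a, 0] (fun h0 => by
    have := congrFun h0 1
    simp at this
    omega)
  rw [e] at h2
  simp only [Matrix.cons_val_zero, Matrix.cons_val_one, Matrix.cons_val] at h2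
  have h3 : 0 < a * (a * b - u ^ 2) := by
    have : (0 : ℚ) < a * (a * b - u ^ 2) := by linarith
    exact_mod_cast this
  exact pos_of_mul_pos_right h3 ha.le

end Moves

lemma exists_shift_le (a u : ℤ) (ha : 0 < a) : ∃ k : ℤ, 2 * |u + k * a| ≤ a := by
  have h1 := Int.emod_nonneg u ha.ne'
  have h2 := Int.emod_lt_of_pos u ha
  have h3 := Int.emod_add_mul_ediv u a
  by_cases h : 2 * (u % a) ≤ a
  · refine ⟨-(u / a), ?_⟩
    have : u + -(u / a) * a = u % a := by linarith
    rw [this, abs_of_nonneg h1]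
    exact h
  · refine ⟨-(u / a) - 1, ?_⟩
    have : u + (-(u / a) - 1) * a = u % a - a := by linarith
    rw [this, abs_of_neg (by linarith)]
    linarith

/-- Reduction: among all bases, minimise first the norm `a` of the first basis vector and then the
leading minor `a b - u²`; the projection of the lattice along the first basis vector is then a
reduced binary form. -/
theorem exists_reduced {L : TernaryLattice} {G : Matrix (Fin 3) (Fin 3) ℤ}
    (hG : L.gram = G.map (fun a : ℤ => (a : ℚ))) :
    ∃ a b c s t u : ℤ, IntEquiv G (symMat a b c s t u) ∧ 0 < a ∧ a ≤ b ∧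
      0 ≤ u ∧ 2 * u ≤ a ∧ 0 ≤ t ∧ 2 * t ≤ a ∧ 2 * |a * s - t * u| ≤ a * b - u ^ 2 ∧
      a * b - u ^ 2 ≤ a * c - t ^ 2 := by
  have hpos : ∀ a b c s t u : ℤ, IntEquiv G (symMat a b c s t u) →
      0 < a ∧ 0 < a * b - u ^ 2 := by
    intro a b c s t u h
    obtain ⟨K, hK, -⟩ := exists_lattice_of_intEquiv hG h
    exact minors_pos_of_gram a b c s t u hK
  have hsymm : G.IsSymm := by
    have h := L.symm
    rw [hG] at h
    ext i j
    have := congrFun (congrFun h i) j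
    simpa using this
  have hG0 : IntEquiv G (symMat (G 0 0) (G 1 1) (G 2 2) (G 1 2) (G 0 2) (G 0 1)) := by
    have : symMat (G 0 0) (G 1 1) (G 2 2) (G 1 2) (G 0 2) (G 0 1) = G := by
      ext i j
      fin_cases i <;> fin_cases j <;>
        simp [symMat, hsymm.apply 0 1, hsymm.apply 0 2, hsymm.apply 1 2]
    rw [this]
    exact IntEquiv.refl G
  let f : ℤ × ℤ × ℤ × ℤ × ℤ × ℤ → ℕ ×ₗ ℕ := fun q =>
    toLex (q.1.toNat, (q.1 * q.2.1 - q.2.2.2.2.2 ^ 2).toNat)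
  obtain ⟨⟨a, b, c, s, t, u⟩, hq, hmin⟩ := (InvImage.wf f
    (wellFounded_lt : WellFounded ((· < ·) : ℕ ×ₗ ℕ → ℕ ×ₗ ℕ → Prop))).has_min
    {q | IntEquiv G (symMat q.1 q.2.1 q.2.2.1 q.2.2.2.1 q.2.2.2.2.1 q.2.2.2.2.2)} 
    ⟨(G 0 0, G 1 1, G 2 2, G 1 2, G 0 2, G 0 1), hG0⟩
  simp only [Set.mem_ofPred_eq] at hq
  obtain ⟨ha, hm⟩ := hpos _ _ _ _ _ _ hq
  have hmin' : ∀ a' b' c' s' t' u' : ℤ, IntEquiv G (symMat a' b' c' s' t' u') →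
      a ≤ a' ∧ (a' = a → a * b - u ^ 2 ≤ a' * b' - u' ^ 2) := by
    intro a' b' c' s' t' u' h
    have h1 := hmin (a', b', c', s', t', u') h
    obtain ⟨ha', hm'⟩ := hpos _ _ _ _ _ _ h
    simp only [InvImage, f, Prod.Lex.toLex_lt_toLex, not_or, not_and, not_lt] at h1
    refine ⟨by omega, fun he => ?_⟩
    have h2 := h1.2 (by rw [he])
    omega
  clear hmin
  obtain ⟨k, hk⟩ := exists_shift_le (a * b - u ^ 2) (a * s - t * u) hm
  have e1 := hq.trans (intEquiv_shift₃₂ a b c s t u k)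
  obtain ⟨l, hl⟩ := exists_shift_le a u ha
  have e2 := e1.trans (intEquiv_shift₂₁ _ _ _ _ _ _ l)
  obtain ⟨r, hr⟩ := exists_shift_le a (t + k * u) ha
  have e3 := e2.trans (intEquiv_shift₃₁ _ _ _ _ _ _ r)
  have hw : 2 * |a * (s + k * b + l * (t + k * u) + r * (u + l * a)) -
      (t + k * u + r * a) * (u + l * a)| ≤ a * (b + 2 * l * u + l ^ 2 * a) - (u + l * a) ^ 2 := by
    convert hk using 1
    · congr 2
      ring
    · ring
  have hm' : a * b - u ^ 2 = a * (b + 2 * l * u + l ^ 2 * a) - (u + l * a) ^ 2 := by ring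
  rw [hm'] at hmin'
  generalize s + k * b + l * (t + k * u) + r * (u + l * a) = s' at *
  generalize t + k * u + r * a = t' at *
  generalize u + l * a = u' at *
  generalize b + 2 * l * u + l ^ 2 * a = b' at *
  generalize c + 2 * k * s + k ^ 2 * b + 2 * r * (t + k * u) + r ^ 2 * a = c' at *
  clear hq e1 e2 hk hm' hm
  have main : ∀ b c s t u : ℤ, IntEquiv G (symMat a b c s t u) →
      a * b - u ^ 2 = a * b' - u' ^ 2 → a ≤ b ∧ a * b - u ^ 2 ≤ a * c - t ^ 2 := by
    intro b c s t u h e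
    refine ⟨(hmin' _ _ _ _ _ _ (h.trans (intEquiv_swap₁₂ _ _ _ _ _ _))).1, ?_⟩
    rw [e]
    exact (hmin' _ _ _ _ _ _ (h.trans (intEquiv_swap₂₃ _ _ _ _ _ _))).2 rfl
  rw [mul_comm, abs_eq_max_neg] at hl hr
  rcases le_total 0 u' with hu | hu <;> rcases le_total 0 t' with ht | ht
  · obtain ⟨h1, h2⟩ := main _ _ _ _ _ e3 rfl
    exact ⟨a, b', c', s', t', u', e3, ha, h1, hu, by omega, ht, by omega, hw, h2⟩
  · have e4 := e3.trans (intEquiv_neg₃ _ _ _ _ _ _)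
    obtain ⟨h1, h2⟩ := main _ _ _ _ _ e4 rfl
    refine ⟨a, b', c', -s', -t', u', e4, ha, h1, hu, by omega, by omega, by omega, ?_, h2⟩
    rw [← abs_neg]
    convert hw using 3
    ring
  · have e4 := e3.trans (intEquiv_neg₂ _ _ _ _ _ _)
    obtain ⟨h1, h2⟩ := main _ _ _ _ _ e4 (by ring)
    refine ⟨a, b', c', -s', t', -u', e4, ha, h1, by omega, by omega, by omega, by omega, ?_, h2⟩
    rw [← abs_neg]
    convert hw using 1
    · congr 2
      ring
    · ring
  · have e4 := (e3.trans (intEquiv_neg₂ _ _ _ _ _ _)).trans (intEquiv_neg₃ _ _ _ _ _ _)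
    obtain ⟨h1, h2⟩ := main _ _ _ _ _ e4 (by ring)
    refine ⟨a, b', c', - -s', -t', -u', e4, ha, h1, by omega, by omega, by omega, by omega, ?_, h2⟩
    convert hw using 1
    · congr 2
      ring
    · ring

/-! ### Integral invariants of a genus -/

lemma exists_int_of_forall_padic (r : ℚ)
    (h : ∀ (p : ℕ) [Fact p.Prime], ∃ z : ℤ_[p], (z : ℚ_[p]) = (r : ℚ_[p])) :
    ∃ n : ℤ, r = n := by
  have hden : r.den = 1 := by
    rw [Nat.eq_one_iff_not_exists_prime_dvd]
    intro p hp hdvd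
    have := Fact.mk hp
    obtain ⟨z, hz⟩ := h p
    have h1 : z * (r.den : ℤ_[p]) = (r.num : ℤ_[p]) := by
      apply PadicInt.ext
      push_cast
      rw [hz]
      have := Rat.mul_den_eq_num r
      exact_mod_cast congrArg (fun q : ℚ => (q : ℚ_[p])) this
    have h2 : (p : ℤ_[p]) ∣ ((r.num : ℤ) : ℤ_[p]) := by
      rw [← h1]
      exact Dvd.dvd.mul_left (by exact_mod_cast Nat.cast_dvd_cast (α := ℤ_[p]) hdvd) _
    rw [← PadicInt.norm_lt_one_iff_dvd, PadicInt.norm_int_lt_one_iff_dvd] at h2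
    have h3 : p ∣ r.num.natAbs := Int.natCast_dvd.mp h2
    exact Nat.Prime.one_lt hp |>.ne' (Nat.dvd_one.mp (r.reduced ▸ Nat.dvd_gcd h3 hdvd))
  exact ⟨r.num, (Rat.den_eq_one_iff r).mp hden |>.symm⟩

lemma localGram_eq_intCast {L : TernaryLattice} {A : Matrix (Fin 3) (Fin 3) ℤ}
    (hA : L.gram = A.map (fun a : ℤ => (a : ℚ))) (p : ℕ) [Fact p.Prime] :
    localGram p L = (PadicInt.Coe.ringHom (p := p)).mapMatrix
      ((Int.castRingHom ℤ_[p]).mapMatrix A) := by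
  ext i j
  simp [localGram, hA]

lemma exists_int_gram_of_mem_gen {L K : TernaryLattice} {A : Matrix (Fin 3) (Fin 3) ℤ}
    (hA : L.gram = A.map (fun a : ℤ => (a : ℚ))) (h : K ∈ gen L) :
    ∃ G : Matrix (Fin 3) (Fin 3) ℤ, K.gram = G.map (fun a : ℤ => (a : ℚ)) := by
  have : ∀ i j, ∃ n : ℤ, K.gram i j = n := by
    intro i j
    refine exists_int_of_forall_padic _ fun p _ => ?_
    obtain ⟨U, hU⟩ := h p
    rw [localGram_eq_intCast hA p] at hU
    refine ⟨((U.1)ᵀ * (Int.castRingHom ℤ_[p]).mapMatrix A * U.1) i j, ?_⟩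
    have h2 := congrFun (congrFun hU i) j
    change _ = ((K.gram i j : ℚ) : ℚ_[p]) at h2
    rw [← h2]
    change (PadicInt.Coe.ringHom (p := p)).mapMatrix
      ((U.1)ᵀ * (Int.castRingHom ℤ_[p]).mapMatrix A * U.1) i j = _
    rw [map_mul, map_mul]
    rfl
  choose G hG using this
  exact ⟨G, by ext i j; exact hG i j⟩

lemma disc_pos (L : TernaryLattice) : 0 < L.disc := by
  have e1 := L.symm.apply 0 1
  have e2 := L.symm.apply 0 2
  have e3 := L.symm.apply 1 2
  have e : ∀ x : Fin 3 → ℚ, x ⬝ᵥ L.gram *ᵥ x =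
      L.gram 0 0 * x 0 ^ 2 + L.gram 1 1 * x 1 ^ 2 + L.gram 2 2 * x 2 ^ 2 +
        2 * L.gram 1 2 * x 1 * x 2 + 2 * L.gram 0 2 * x 0 * x 2 + 2 * L.gram 0 1 * x 0 * x 1 := by
    intro x
    simp only [dotProduct, mulVec, Fin.sum_univ_three, e1, e2, e3]
    ring
  have h : L.disc = L.gram 0 0 * L.gram 1 1 * L.gram 2 2 +
      2 * L.gram 1 2 * L.gram 0 2 * L.gram 0 1 - L.gram 0 0 * L.gram 1 2 ^ 2 -
      L.gram 1 1 * L.gram 0 2 ^ 2 - L.gram 2 2 * L.gram 0 1 ^ 2 := by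
    rw [disc, det_fin_three, e1, e2, e3]
    ring
  rw [h]
  have key : ∀ x : Fin 3 → ℚ, x ≠ 0 → 0 < L.gram 0 0 * x 0 ^ 2 + L.gram 1 1 * x 1 ^ 2 +
      L.gram 2 2 * x 2 ^ 2 + 2 * L.gram 1 2 * x 1 * x 2 + 2 * L.gram 0 2 * x 0 * x 2 +
      2 * L.gram 0 1 * x 0 * x 1 := fun x hx => e x ▸ L.pos x hx
  generalize L.gram 0 0 = a at *
  generalize L.gram 1 1 = b at *
  generalize L.gram 2 2 = c at *
  generalize L.gram 1 2 = s at *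
  generalize L.gram 0 2 = t at *
  generalize L.gram 0 1 = u at *
  have ha : 0 < a := by
    simpa using key ![1, 0, 0] (fun h0 => by simpa using congrFun h0 0)
  have hm : 0 < a * b - u ^ 2 := by
    have h2 := key ![-u, a, 0] (fun h0 => ha.ne' (by simpa using congrFun h0 1))
    simp only [Matrix.cons_val_zero, Matrix.cons_val_one, Matrix.cons_val] at h2
    exact pos_of_mul_pos_right (a := a) (by linarith) ha.le
  -- the third row of the adjugate, on which the form takes the value `(a b - u²) det`
  have h3 := key ![u * s - b * t, u * t - a * s, a * b - u ^ 2]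
    (fun h0 => hm.ne' (by simpa using congrFun h0 2))
  simp only [Matrix.cons_val_zero, Matrix.cons_val_one, Matrix.cons_val] at h3
  exact pos_of_mul_pos_right (a := a * b - u ^ 2) (by linarith) hm.le

lemma disc_eq_of_mem_gen {L K : TernaryLattice} (h : K ∈ gen L) : K.disc = L.disc := by
  have key : ∀ {L K : TernaryLattice}, K ∈ gen L → ∃ n : ℤ, K.disc / L.disc = n := by
    intro L K h
    refine exists_int_of_forall_padic _ fun p _ => ?_
    obtain ⟨U, hU⟩ := h p
    have hd := congrArg det hU
    have e1 : ∀ J : TernaryLattice, (localGram p J).det = ((J.disc : ℚ) : ℚ_[p]) := fun J =>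
      ((Rat.castHom ℚ_[p]).map_det J.gram).symm
    have e2 : (localUnit p U).det = ((U.1.det : ℤ_[p]) : ℚ_[p]) :=
      ((PadicInt.Coe.ringHom (p := p)).map_det U.1).symm
    rw [det_mul, det_mul, det_transpose, e1, e1, e2] at hd
    refine ⟨U.1.det ^ 2, ?_⟩
    have hL : ((L.disc : ℚ) : ℚ_[p]) ≠ 0 := by exact_mod_cast (disc_pos L).ne'
    push_cast
    rw [eq_div_iff hL, ← hd]
    ring
  obtain ⟨n, hn⟩ := key h
  obtain ⟨m, hm⟩ := key (gen_symm h)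
  have hL := disc_pos L
  have hK := disc_pos K
  have h1 : (n : ℚ) * m = 1 := by
    rw [← hn, ← hm]
    field_simp
  have h2 : n * m = 1 := by exact_mod_cast h1
  have h3 : 0 < n := by
    have : (0 : ℚ) < n := hn ▸ div_pos hK hL
    exact_mod_cast this
  have h4 : n = 1 := by
    rcases Int.mul_eq_one_iff_eq_one_or_neg_one.mp h2 with h | h <;> omega
  rw [h4, div_eq_iff hL.ne'] at hn
  simpa using hn

/-- Lattices in one genus have congruent Gram matrices modulo every prime power, up to a change of
basis that is invertible modulo `p`. -/
lemma exists_congr_of_mem_gen {L K : TernaryLattice} {A G : Matrix (Fin 3) (Fin 3) ℤ}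
    (hA : L.gram = A.map (fun a : ℤ => (a : ℚ))) (hG : K.gram = G.map (fun a : ℤ => (a : ℚ)))
    (h : K ∈ gen L) (p k : ℕ) [hp : Fact p.Prime] (hk : k ≠ 0) :
    ∃ V : Matrix (Fin 3) (Fin 3) ℤ, ¬ (p : ℤ) ∣ V.det ∧
      ∀ i j, (Vᵀ * A * V) i j ≡ G i j [ZMOD ((p ^ k : ℕ) : ℤ)] := by
  obtain ⟨U, hU⟩ := h p
  rw [localGram_eq_intCast hA p, localGram_eq_intCast hG p] at hU
  have hU' : (U.1)ᵀ * (Int.castRingHom ℤ_[p]).mapMatrix A * U.1 =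
      (Int.castRingHom ℤ_[p]).mapMatrix G := by
    have hinj : Function.Injective (PadicInt.Coe.ringHom (p := p)) := Subtype.coe_injective
    apply Matrix.map_injective hinj
    change (PadicInt.Coe.ringHom (p := p)).mapMatrix _ = (PadicInt.Coe.ringHom (p := p)).mapMatrix _
    rw [← hU, map_mul, map_mul]
    rfl
  set φ := PadicInt.toZModPow (p := p) k
  let V : Matrix (Fin 3) (Fin 3) ℤ := fun i j => (φ (U.1 i j)).cast
  have hV : (Int.castRingHom (ZMod (p ^ k))).mapMatrix V = φ.mapMatrix U.1 := by
    ext i j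
    change (((φ (U.1 i j)).cast : ℤ) : ZMod (p ^ k)) = φ (U.1 i j)
    exact ZMod.intCast_zmod_cast _
  have hint : ∀ B : Matrix (Fin 3) (Fin 3) ℤ, φ.mapMatrix ((Int.castRingHom ℤ_[p]).mapMatrix B) =
      (Int.castRingHom (ZMod (p ^ k))).mapMatrix B := by
    intro B
    ext i j
    simp
  refine ⟨V, fun hdvd => ?_, fun i j => ?_⟩
  · have h1 : IsUnit (((V.det : ℤ)) : ZMod (p ^ k)) := by
      have : ((V.det : ℤ) : ZMod (p ^ k)) = φ U.1.det := by
        rw [RingHom.map_det, ← hV]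
        exact (Int.castRingHom (ZMod (p ^ k))).map_det V
      rw [this]
      exact ((isUnit_iff_isUnit_det _).mp U.isUnit).map φ
    have h2 : ((V.det : ℤ) : ZMod (p ^ k)) ^ k = 0 := by
      rw [← Int.cast_pow, ZMod.intCast_zmod_eq_zero_iff_dvd]
      push_cast
      exact pow_dvd_pow_of_dvd hdvd k
    have h3 : (1 : ℕ) < p ^ k := Nat.one_lt_pow hk hp.out.one_lt
    have : Fact (1 < p ^ k) := ⟨h3⟩
    exact (h1.pow k).ne_zero h2
  · rw [← ZMod.intCast_eq_intCast_iff]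
    have h1 := congrArg φ.mapMatrix hU'
    rw [map_mul, map_mul, hint, hint, ← hV] at h1
    have h2 : (φ.mapMatrix (U.1)ᵀ) = ((Int.castRingHom (ZMod (p ^ k))).mapMatrix V)ᵀ := by
      rw [hV]
      rfl
    rw [h2] at h1
    have h3 : (Int.castRingHom (ZMod (p ^ k))).mapMatrix (Vᵀ * A * V) =
        (Int.castRingHom (ZMod (p ^ k))).mapMatrix G := by
      rw [← h1, map_mul, map_mul]
      rfl
    exact congrFun (congrFun h3 i) j

/-! ### The search for reduced forms -/

/-- Congruence conditions on the entries of a Gram matrix `(a, u, t; u, b, s; t, s, c)`, expressed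
by a test `qd` for the values of the form and a test `qm` for the values of the adjoint form. -/
def GenusCond (qd qm : ℤ → Bool) (a b c s t u : ℤ) : Prop :=
  (qd a = true ∧ qd b = true ∧ qd c = true) ∧
  (qm (a * b - u ^ 2) = true ∧ qm (a * c - t ^ 2) = true ∧ qm (b * c - s ^ 2) = true) ∧
  ((a * s - t * u) % 20 = 0 ∧ (u * s - b * t) % 20 = 0 ∧ (s * t - u * c) % 20 = 0) ∧
  ¬ (a % 2 = 0 ∧ b % 2 = 0 ∧ c % 2 = 0) ∧ ¬ (a % 5 = 0 ∧ b % 5 = 0 ∧ c % 5 = 0)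

/-- The innermost step of the search: with `a`, `b`, `u`, `t`, `s` given, the determinant `d`
determines `c`. -/
def searchStep (d : ℤ) (qd qm : ℤ → Bool) (l : List (ℤ × ℤ × ℤ × ℤ × ℤ × ℤ))
    (a u b t s c : ℤ) : Bool :=
  !(a * b * c + 2 * s * t * u - a * s ^ 2 - b * t ^ 2 - c * u ^ 2 == d && qd c &&
    qm (a * c - t ^ 2) && qm (b * c - s ^ 2) && (s * t - u * c) % 20 == 0 &&
    !(a % 2 == 0 && b % 2 == 0 && c % 2 == 0) && !(a % 5 == 0 && b % 5 == 0 && c % 5 == 0) &&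
    decide (a * b - u ^ 2 ≤ a * c - t ^ 2)) || l.contains (a, b, c, s, t, u)

/-- Every reduced form of determinant `d` with `a < 39` and `b < 138` that satisfies the congruence
conditions occurs in the list `l`. -/
def search (d : ℤ) (qd qm : ℤ → Bool) (l : List (ℤ × ℤ × ℤ × ℤ × ℤ × ℤ)) : Bool :=
  (List.range 39).all fun a => a == 0 || !qd a || (List.range (a / 2 + 1)).all fun u =>
    (List.range 138).all fun b =>
      !(Nat.ble a b && qd b && qm (a * b - u ^ 2) &&
        decide (3 * ((a : ℤ) * b - u ^ 2) ^ 2 ≤ 4 * a * d)) ||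
      (List.range (a / 2 + 1)).all fun t => (List.range (2 * b + 1)).all fun s =>
        !(((a : ℤ) * (s - b) - t * u) % 20 == 0 && ((u : ℤ) * (s - b) - b * t) % 20 == 0 &&
          decide (2 * ((a : ℤ) * (s - b) - t * u) ≤ a * b - u ^ 2) &&
          decide (-(2 * ((a : ℤ) * (s - b) - t * u)) ≤ a * b - u ^ 2)) ||
        searchStep d qd qm l a u b t (s - b)
          (((a * d + ((a : ℤ) * (s - b) - t * u) ^ 2) / (a * b - u ^ 2) + t ^ 2) / a)

lemma mem_of_search {d : ℤ} {qd qm : ℤ → Bool} {l : List (ℤ × ℤ × ℤ × ℤ × ℤ × ℤ)}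
    (hs : search d qd qm l = true) {a b c s t u : ℤ} (ha : 0 < a) (ha' : a < 39) (hab : a ≤ b)
    (hb : b < 138) (hu : 0 ≤ u) (hu' : 2 * u ≤ a) (ht : 0 ≤ t) (ht' : 2 * t ≤ a)
    (hw : 2 * |a * s - t * u| ≤ a * b - u ^ 2) (hm : a * b - u ^ 2 ≤ a * c - t ^ 2)
    (hm3 : 3 * (a * b - u ^ 2) ^ 2 ≤ 4 * a * d)
    (hd : a * b * c + 2 * s * t * u - a * s ^ 2 - b * t ^ 2 - c * u ^ 2 = d)
    (hc : GenusCond qd qm a b c s t u) : (a, b, c, s, t, u) ∈ l := by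
  have hmpos : 0 < a * b - u ^ 2 := by nlinarith
  -- the bound on `a s - t u` bounds `s`
  have hsb : -b ≤ s ∧ s ≤ b := by
    obtain ⟨h1, h2⟩ := abs_le.mp (show |a * s - t * u| ≤ a * b - t * u by nlinarith)
    obtain ⟨h3, h4⟩ := abs_le.mp (show |a * s - t * u| ≤ a * b + t * u - 0 by nlinarith)
    exact ⟨by nlinarith, by nlinarith⟩
  have hcval : ((a * d + (a * s - t * u) ^ 2) / (a * b - u ^ 2) + t ^ 2) / a = c := by
    have e1 : a * d + (a * s - t * u) ^ 2 = (a * b - u ^ 2) * (a * c - t ^ 2) := by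
      rw [← hd]
      ring
    rw [e1, Int.mul_ediv_cancel_left _ hmpos.ne', sub_add_cancel, Int.mul_ediv_cancel_left _ ha.ne']
  obtain ⟨s', hs'⟩ : ∃ s' : ℕ, (s' : ℤ) = s + b := ⟨(s + b).toNat, by omega⟩
  obtain rfl : s = s' - b := by omega
  lift a to ℕ using ha.le
  lift b to ℕ using (by omega)
  lift u to ℕ using hu
  lift t to ℕ using ht
  obtain ⟨⟨c1, c2, c3⟩, ⟨c4, c5, c6⟩, ⟨c7, c8, c9⟩, c10, c11⟩ := hc
  simp only [search, List.all_eq_true, List.mem_range, Bool.or_eq_true] at hs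
  have hw' := abs_le.mp (le_refl |(a : ℤ) * ((s' : ℤ) - b) - t * u|)
  have h := ((hs a (by omega)).resolve_left (by simp [c1]; omega)) u (by omega) b (by omega)
  have h := (h.resolve_left (by
    simp only [c2, c4, Bool.not_eq_true', Bool.not_eq_false, Bool.and_eq_true, decide_eq_true_eq]
    exact ⟨⟨⟨Nat.ble_eq.mpr (by omega), trivial⟩, trivial⟩, hm3⟩)) t (by omega) s' (by omega)
  have h := h.resolve_left (by
    simp only [Bool.not_eq_true', Bool.not_eq_false, Bool.and_eq_true, decide_eq_true_eq,
      beq_iff_eq]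
    exact ⟨⟨⟨c7, c8⟩, by linarith⟩, by linarith⟩)
  rw [hcval, searchStep, Bool.or_eq_true] at h
  have h := h.resolve_left (by
    simp only [Bool.not_eq_true', Bool.and_eq_true, decide_eq_true_eq, beq_iff_eq,
      ← Bool.not_eq_true]
    exact fun hn => hn ⟨⟨⟨⟨⟨⟨⟨hd, c3⟩, c5⟩, c6⟩, c9⟩, fun h => c10 ⟨h.1.1, h.1.2, h.2⟩⟩,
      fun h => c11 ⟨h.1.1, h.1.2, h.2⟩⟩, hm⟩)
  simpa using h

/-- The possible values of `N₁` modulo `4` and `5`. -/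
def valN (x : ℤ) : Bool := (x % 4 == 0 || x % 4 == 3) && (x % 5 == 0 || x % 5 == 2 || x % 5 == 3)

/-- The possible values of the adjoint of `N₁` modulo `16` and `25`. -/
def adjN (x : ℤ) : Bool :=
  (x % 16 == 0 || x % 16 == 4) && (x % 25 == 0 || x % 25 == 5 || x % 25 == 20)

/-- The possible values of `M₁` modulo `4` and `5`. -/
def valM (x : ℤ) : Bool := (x % 4 == 0 || x % 4 == 1) && (x % 5 == 0 || x % 5 == 1 || x % 5 == 4)

/-- The possible values of the adjoint of `M₁` modulo `16` and `5`. -/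
def adjM (x : ℤ) : Bool := (x % 16 == 0 || x % 16 == 4) && x % 5 == 0

/-- The reduced forms in the genus of `N₁`. -/
def reducedN : List (ℤ × ℤ × ℤ × ℤ × ℤ × ℤ) :=
  [(3, 60, 140, -20, 0, 0), (3, 60, 140, 20, 0, 0), (3, 7, 1200, 0, 0, 1), (3, 27, 300, 0, 0, 1),
    (7, 12, 300, 0, 0, 2), (8, 12, 303, -4, 2, 4), (8, 12, 303, 6, 2, 4), (12, 15, 135, -5, 0, 0),
    (12, 15, 135, 5, 0, 0), (12, 35, 60, -10, 0, 0), (12, 35, 60, 10, 0, 0), (12, 28, 75, 0, 0, 4),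
    (12, 28, 83, -12, 4, 4), (12, 43, 60, -20, 0, 6), (12, 43, 60, 20, 0, 6),
    (12, 43, 63, -17, 6, 6), (12, 43, 63, 23, 6, 6), (15, 35, 48, 0, 0, 5), (27, 27, 40, 10, 10, 3)]

/-- The reduced forms in the genus of `M₁`. -/
def reducedM : List (ℤ × ℤ × ℤ × ℤ × ℤ × ℤ) :=
  [(1, 20, 80, 0, 0, 0), (4, 5, 80, 0, 0, 0), (4, 20, 25, -10, 0, 0), (4, 20, 25, 10, 0, 0),
    (4, 20, 21, 0, 2, 0), (4, 21, 20, 0, 0, 2), (5, 16, 20, 0, 0, 0), (9, 9, 20, 0, 0, 1)]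

lemma search_N : search 24000 valN adjN reducedN = true := by decide +kernel

lemma search_M : search 1600 valM adjM reducedM = true := by decide +kernel

/-! ### The genera of `N₁` and `M₁` -/

lemma sextuple_gram (a b c s t u : ℤ) (h) :
    (sextuple a b c s t u h).gram = (symMat a b c s t u).map (fun a : ℤ => (a : ℚ)) := by
  ext i j
  fin_cases i <;> fin_cases j <;> rfl

lemma sextuple_disc (a b c s t u : ℤ) (h) : (sextuple a b c s t u h).disc =
    ((a * b * c + 2 * s * t * u - a * s ^ 2 - b * t ^ 2 - c * u ^ 2 : ℤ) : ℚ) := by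
  rw [disc, sextuple_gram, ← det_symMat]
  exact ((Int.castRingHom ℚ).map_det _).symm

lemma disc_eq_of_gram {K : TernaryLattice} {a b c s t u : ℤ}
    (h : K.gram = (symMat a b c s t u).map (fun a : ℤ => (a : ℚ))) :
    K.disc = ((a * b * c + 2 * s * t * u - a * s ^ 2 - b * t ^ 2 - c * u ^ 2 : ℤ) : ℚ) := by
  rw [disc, h, ← det_symMat]
  exact ((Int.castRingHom ℚ).map_det _).symm

/-- A matrix over `ℤ` whose determinant is prime to `p` has no row divisible by `p`, nor two rows
congruent modulo `p`. -/
lemma exists_not_dvd_row {p : ℤ} {V : Matrix (Fin 3) (Fin 3) ℤ} (h : ¬ p ∣ V.det) :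
    (∃ j, ¬ p ∣ V 0 j) ∧ ∃ j, ¬ p ∣ V 1 j - V 2 j := by
  constructor <;> by_contra! hn <;> refine h ?_
  · obtain ⟨k0, h0⟩ := hn 0
    obtain ⟨k1, h1⟩ := hn 1
    obtain ⟨k2, h2⟩ := hn 2
    rw [det_fin_three, h0, h1, h2]
    exact ⟨k0 * V 1 1 * V 2 2 - k0 * V 1 2 * V 2 1 - k1 * V 1 0 * V 2 2 + k1 * V 1 2 * V 2 0 +
      k2 * V 1 0 * V 2 1 - k2 * V 1 1 * V 2 0, by ring⟩
  · obtain ⟨k0, h0⟩ := hn 0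
    obtain ⟨k1, h1⟩ := hn 1
    obtain ⟨k2, h2⟩ := hn 2
    rw [det_fin_three, eq_add_of_sub_eq h0, eq_add_of_sub_eq h1, eq_add_of_sub_eq h2]
    exact ⟨V 0 0 * (k1 * V 2 2 - k2 * V 2 1) - V 0 1 * (k0 * V 2 2 - k2 * V 2 0) +
      V 0 2 * (k0 * V 2 1 - k1 * V 2 0), by ring⟩

/-- The bilinear form with Gram matrix `(a, u, t; u, b, s; t, s, c)`. -/
def bil (a b c s t u : ℤ) (x y : Fin 3 → ℤ) : ℤ :=
  a * x 0 * y 0 + b * x 1 * y 1 + c * x 2 * y 2 + s * (x 1 * y 2 + x 2 * y 1) +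
    t * (x 0 * y 2 + x 2 * y 0) + u * (x 0 * y 1 + x 1 * y 0)

lemma conj_symMat_apply (a b c s t u : ℤ) (V : Matrix (Fin 3) (Fin 3) ℤ) (i j : Fin 3) :
    (Vᵀ * symMat a b c s t u * V) i j = bil a b c s t u (Vᵀ i) (Vᵀ j) := by
  simp [symMat, bil, mul_apply, Fin.sum_univ_three]
  ring

/-- The Binet–Cauchy identity: the `2 × 2` minors of a bilinear form are values of the adjoint form
on cross products. -/
lemma bil_mul_sub (a b c s t u : ℤ) (x y z w : Fin 3 → ℤ) :
    bil a b c s t u x y * bil a b c s t u z w - bil a b c s t u x w * bil a b c s t u z y =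
      bil (b * c - s ^ 2) (a * c - t ^ 2) (a * b - u ^ 2) (u * t - a * s) (u * s - b * t)
        (s * t - u * c) (x ⨯₃ z) (y ⨯₃ w) := by
  simp only [bil, cross_apply, Matrix.cons_val_zero, Matrix.cons_val_one, Matrix.cons_val]
  ring

lemma sq_emod_four (q : ℤ) : q ^ 2 % 4 = 0 ∨ q ^ 2 % 4 = 1 := by
  have h : q % 4 = 0 ∨ q % 4 = 1 ∨ q % 4 = 2 ∨ q % 4 = 3 := by omega
  rcases h with h | h | h | h <;> simp [pow_two, Int.mul_emod, h]

lemma sq_emod_five (q : ℤ) : q ^ 2 % 5 = 0 ∨ q ^ 2 % 5 = 1 ∨ q ^ 2 % 5 = 4 := by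
  have h : q % 5 = 0 ∨ q % 5 = 1 ∨ q % 5 = 2 ∨ q % 5 = 3 ∨ q % 5 = 4 := by omega
  rcases h with h | h | h | h | h <;> simp [pow_two, Int.mul_emod, h]

/-- The bilinear forms obtained from a lattice in the genus of `sextuple a b c s t u`: its Gram
matrix is congruent to `bil (V i) (V j)` modulo a prime power. -/
lemma exists_bil_of_mem_gen {a b c s t u : ℤ} {h₀} {K : TernaryLattice} {a' b' c' s' t' u' : ℤ}
    (hK : K.gram = (symMat a' b' c' s' t' u').map (fun a : ℤ => (a : ℚ)))
    (h : K ∈ gen (sextuple a b c s t u h₀)) (p k : ℕ) [hp : Fact p.Prime] (hk : k ≠ 0) :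
    ∃ V : Fin 3 → Fin 3 → ℤ, (∃ j, ¬ (p : ℤ) ∣ V j 0) ∧ (∃ j, ¬ (p : ℤ) ∣ V j 1 - V j 2) ∧
      ∀ i j, bil a b c s t u (V i) (V j) ≡ symMat a' b' c' s' t' u' i j
        [ZMOD ((p ^ k : ℕ) : ℤ)] := by
  obtain ⟨V, hV, hVK⟩ := exists_congr_of_mem_gen (sextuple_gram a b c s t u h₀) hK h p k hk
  obtain ⟨h1, h2⟩ := exists_not_dvd_row hV
  exact ⟨Vᵀ, h1, h2, fun i j => conj_symMat_apply a b c s t u V i j ▸ hVK i j⟩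

/-- Congruences between bilinear forms and a Gram matrix pass to the `2 × 2` minors. -/
lemma minors_congr {n a b c s t u a' b' c' s' t' u' : ℤ} {V : Fin 3 → Fin 3 → ℤ}
    (h : ∀ i j, bil a b c s t u (V i) (V j) ≡ symMat a' b' c' s' t' u' i j [ZMOD n])
    (i j k l : Fin 3) :
    bil (b * c - s ^ 2) (a * c - t ^ 2) (a * b - u ^ 2) (u * t - a * s) (u * s - b * t)
        (s * t - u * c) (V i ⨯₃ V k) (V j ⨯₃ V l) ≡
      symMat a' b' c' s' t' u' i j * symMat a' b' c' s' t' u' k l -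
        symMat a' b' c' s' t' u' i l * symMat a' b' c' s' t' u' k j [ZMOD n] := by
  rw [← bil_mul_sub]
  exact ((h i j).mul (h k l)).sub ((h i l).mul (h k j))

lemma genusCond_of_forall {qd qm : ℤ → Bool} {a b c s t u : ℤ}
    (hd : ∀ i, qd (symMat a b c s t u i i) = true)
    (hm : ∀ i k, qm (symMat a b c s t u i i * symMat a b c s t u k k -
      symMat a b c s t u i k * symMat a b c s t u k i) = true)
    (ho : ∀ i j k l, (symMat a b c s t u i j * symMat a b c s t u k l -
      symMat a b c s t u i l * symMat a b c s t u k j) % 20 = 0)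
    (h2 : ∃ i, symMat a b c s t u i i % 2 ≠ 0) (h5 : ∃ i, symMat a b c s t u i i % 5 ≠ 0) :
    GenusCond qd qm a b c s t u := by
  have key : ∀ n : ℤ, (∃ i, symMat a b c s t u i i % n ≠ 0) →
      ¬ (a % n = 0 ∧ b % n = 0 ∧ c % n = 0) := by
    rintro n ⟨i, hi⟩ ⟨h1, h2, h3⟩
    fin_cases i
    exacts [hi h1, hi h2, hi h3]
  refine ⟨⟨hd 0, hd 1, hd 2⟩, ⟨?_, ?_, ?_⟩, ⟨ho 0 0 1 2, ?_, ?_⟩, key 2 h2, key 5 h5⟩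
  · rw [pow_two]; exact hm 0 1
  · rw [pow_two]; exact hm 0 2
  · rw [pow_two]; exact hm 1 2
  · rw [mul_comm b t]; exact ho 0 1 1 2
  · rw [mul_comm s t]; exact ho 0 2 2 1

/-- Modulo `4` and `5`, the form of `N₁` is a constant times the square of a linear form, and so
is its adjoint modulo `16` and `25`. -/
theorem genusCond_N {K : TernaryLattice} {a b c s t u : ℤ}
    (hK : K.gram = (symMat a b c s t u).map (fun a : ℤ => (a : ℚ))) (h : K ∈ gen N₁) :
    GenusCond valN adjN a b c s t u := by
  have : Fact (Nat.Prime 2) := ⟨Nat.prime_two⟩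
  have : Fact (Nat.Prime 5) := ⟨Nat.prime_five⟩
  obtain ⟨V, -, ⟨i₂, hi₂⟩, hV⟩ := exists_bil_of_mem_gen hK h 2 4 (by norm_num)
  obtain ⟨W, ⟨i₅, hi₅⟩, -, hW⟩ := exists_bil_of_mem_gen hK h 5 2 (by norm_num)
  have hVm := minors_congr hV
  have hWm := minors_congr hW
  norm_num [Int.ModEq] at hV hW hVm hWm hi₂ hi₅
  -- the form is `-(y - z)²` modulo `4` and `2 x²` modulo `5`
  have d4 : ∀ i, symMat a b c s t u i i % 4 = (-(V i 1 - V i 2) ^ 2) % 4 := by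
    intro i
    have h1 : bil 12 15 135 5 0 0 (V i) (V i) = -(V i 1 - V i 2) ^ 2 +
        4 * (3 * V i 0 ^ 2 + 4 * V i 1 ^ 2 + 34 * V i 2 ^ 2 + 2 * V i 1 * V i 2) := by
      simp only [bil]
      ring
    have h2 := hV i i
    omega
  have d5 : ∀ i, symMat a b c s t u i i % 5 = (2 * W i 0 ^ 2) % 5 := by
    intro i
    have h1 : bil 12 15 135 5 0 0 (W i) (W i) = 2 * W i 0 ^ 2 +
        5 * (2 * W i 0 ^ 2 + 3 * W i 1 ^ 2 + 27 * W i 2 ^ 2 + 2 * W i 1 * W i 2) := by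
      simp only [bil]
      ring
    have h2 := hW i i
    omega
  -- the adjoint form is `20 (y + z)²` modulo `80` and `20 (y - 3 z)²` modulo `25`
  have hadj : ∀ p q : Fin 3 → ℤ, bil 2000 1620 180 (-60) 0 0 p q =
      20 * ((p 1 + p 2) * (q 1 + q 2)) + 80 * (25 * p 0 * q 0 + 20 * p 1 * q 1 + 2 * p 2 * q 2 -
        p 1 * q 2 - p 2 * q 1) := by
    intro p q
    simp only [bil]
    ring
  have hadj' : ∀ p q : Fin 3 → ℤ, bil 2000 1620 180 (-60) 0 0 p q =
      20 * ((p 1 - 3 * p 2) * (q 1 - 3 * q 2)) + 25 * (80 * p 0 * q 0 + 64 * p 1 * q 1) := by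
    intro p q
    simp only [bil]
    ring
  refine genusCond_of_forall (fun i => ?_) (fun i k => ?_) (fun i j k l => ?_) ⟨i₂, ?_⟩ ⟨i₅, ?_⟩
  · have h1 := d4 i
    have h2 := d5 i
    have h3 := sq_emod_four (V i 1 - V i 2)
    have h4 := sq_emod_five (W i 0)
    simp only [valN, Bool.and_eq_true, Bool.or_eq_true, beq_iff_eq]
    omega
  · have h1 := hVm i i k k
    have h2 := hWm i i k k
    rw [hadj, ← pow_two] at h1
    rw [hadj', ← pow_two] at h2
    have h3 := sq_emod_four ((V i ⨯₃ V k) 1 + (V i ⨯₃ V k) 2)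
    have h4 := sq_emod_five ((W i ⨯₃ W k) 1 - 3 * (W i ⨯₃ W k) 2)
    simp only [adjN, Bool.and_eq_true, Bool.or_eq_true, beq_iff_eq]
    omega
  · have h1 := hVm i j k l
    have h2 := hWm i j k l
    rw [hadj] at h1
    rw [hadj'] at h2
    omega
  · have h1 := d4 i₂
    have h3 : (V i₂ 1 - V i₂ 2) ^ 2 % 2 = 1 := by
      rcases Int.emod_two_eq_zero_or_one (V i₂ 1 - V i₂ 2) with h | h
      · omega
      · simp [pow_two, Int.mul_emod, h]
    omega
  · have h1 := d5 i₅
    have h3 : W i₅ 0 ^ 2 % 5 ≠ 0 := fun h => hi₅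
      ((Int.prime_ofNat_iff.mpr Nat.prime_five).dvd_of_dvd_pow (Int.dvd_of_emod_eq_zero h))
    omega

/-- The analogue of `genusCond_N` for `M₁`. -/
theorem genusCond_M {K : TernaryLattice} {a b c s t u : ℤ}
    (hK : K.gram = (symMat a b c s t u).map (fun a : ℤ => (a : ℚ))) (h : K ∈ gen M₁) :
    GenusCond valM adjM a b c s t u := by
  have : Fact (Nat.Prime 2) := ⟨Nat.prime_two⟩
  have : Fact (Nat.Prime 5) := ⟨Nat.prime_five⟩
  obtain ⟨V, ⟨i₂, hi₂⟩, -, hV⟩ := exists_bil_of_mem_gen hK h 2 4 (by norm_num)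
  obtain ⟨W, ⟨i₅, hi₅⟩, -, hW⟩ := exists_bil_of_mem_gen hK h 5 2 (by norm_num)
  have hVm := minors_congr hV
  have hWm := minors_congr hW
  norm_num [Int.ModEq] at hV hW hVm hWm hi₂ hi₅
  -- the form is `x²` modulo `20`, and the adjoint form is `20 z²` modulo `80`
  have hform : ∀ p : Fin 3 → ℤ, bil 1 20 80 0 0 0 p p =
      p 0 ^ 2 + 20 * (p 1 ^ 2 + 4 * p 2 ^ 2) := by
    intro p
    simp only [bil]
    ring
  have hadj : ∀ p q : Fin 3 → ℤ, bil 1600 80 20 0 0 0 p q =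
      20 * (p 2 * q 2) + 80 * (20 * p 0 * q 0 + p 1 * q 1) := by
    intro p q
    simp only [bil]
    ring
  refine genusCond_of_forall (fun i => ?_) (fun i k => ?_) (fun i j k l => ?_) ⟨i₂, ?_⟩ ⟨i₅, ?_⟩
  · have h1 := hV i i
    have h2 := hW i i
    rw [hform] at h1 h2
    have h3 := sq_emod_four (V i 0)
    have h4 := sq_emod_five (W i 0)
    simp only [valM, Bool.and_eq_true, Bool.or_eq_true, beq_iff_eq]
    omega
  · have h1 := hVm i i k k
    have h2 := hWm i i k k
    rw [hadj, ← pow_two] at h1 h2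
    have h3 := sq_emod_four ((V i ⨯₃ V k) 2)
    simp only [adjM, Bool.and_eq_true, Bool.or_eq_true, beq_iff_eq]
    omega
  · have h1 := hVm i j k l
    have h2 := hWm i j k l
    rw [hadj] at h1 h2
    omega
  · have h1 := hV i₂ i₂
    rw [hform] at h1
    have h3 : V i₂ 0 ^ 2 % 2 = 1 := by
      rcases Int.emod_two_eq_zero_or_one (V i₂ 0) with h | h
      · omega
      · simp [pow_two, Int.mul_emod, h]
    omega
  · have h1 := hW i₅ i₅
    rw [hform] at h1
    have h3 : W i₅ 0 ^ 2 % 5 ≠ 0 := fun h => hi₅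
      ((Int.prime_ofNat_iff.mpr Nat.prime_five).dvd_of_dvd_pow (Int.dvd_of_emod_eq_zero h))
    omega

/-- Every lattice in a genus of determinant `d ≤ 24000` whose Gram matrices satisfy congruence
conditions is isometric to one of the lattices found by the search. -/
lemma exists_mem_list_of_search {d : ℤ} (hd : d ≤ 24000) {qd qm : ℤ → Bool}
    {l : List (ℤ × ℤ × ℤ × ℤ × ℤ × ℤ)} (hs : search d qd qm l = true)
    {a₀ b₀ c₀ s₀ t₀ u₀ : ℤ} {h₀}
    (hd₀ : a₀ * b₀ * c₀ + 2 * s₀ * t₀ * u₀ - a₀ * s₀ ^ 2 - b₀ * t₀ ^ 2 - c₀ * u₀ ^ 2 = d)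
    (hcond : ∀ {K : TernaryLattice} {a b c s t u : ℤ},
      K.gram = (symMat a b c s t u).map (fun a : ℤ => (a : ℚ)) →
      K ∈ gen (sextuple a₀ b₀ c₀ s₀ t₀ u₀ h₀) → GenusCond qd qm a b c s t u)
    (hb : ∀ a b u : ℤ, qd a = true → 0 < a → a ≤ b → 0 ≤ u → 2 * u ≤ a →
      3 * (a * b - u ^ 2) ^ 2 ≤ 4 * a * d → b < 138)
    {K : TernaryLattice} (hK : K ∈ gen (sextuple a₀ b₀ c₀ s₀ t₀ u₀ h₀)) :
    ∃ q ∈ l, ∃ K' : TernaryLattice, Isometric K K' ∧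
      K'.gram = (symMat q.1 q.2.1 q.2.2.1 q.2.2.2.1 q.2.2.2.2.1 q.2.2.2.2.2).map
        (fun a : ℤ => (a : ℚ)) := by
  obtain ⟨G, hG⟩ := exists_int_gram_of_mem_gen (sextuple_gram _ _ _ _ _ _ h₀) hK
  obtain ⟨a, b, c, s, t, u, hequiv, ha, hab, hu, hu', ht, ht', hw, hm⟩ := exists_reduced hG
  obtain ⟨K', hK', hiso⟩ := exists_lattice_of_intEquiv hG hequiv
  have hgen := gen_trans hK hiso.mem_gen
  have hc := hcond hK' hgen
  have hdet : a * b * c + 2 * s * t * u - a * s ^ 2 - b * t ^ 2 - c * u ^ 2 = d := by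
    have h1 := disc_eq_of_mem_gen hgen
    rw [disc_eq_of_gram hK', sextuple_disc, hd₀] at h1
    exact_mod_cast h1
  -- the reduced binary form of determinant `a d` has minimum at most `√(4 a d / 3)`
  have hm3 : 3 * (a * b - u ^ 2) ^ 2 ≤ 4 * a * d := by
    have e1 : a * d + (a * s - t * u) ^ 2 = (a * b - u ^ 2) * (a * c - t ^ 2) := by
      rw [← hdet]
      ring
    have e2 : (2 * (a * s - t * u)) ^ 2 ≤ (a * b - u ^ 2) ^ 2 := by
      rw [sq_le_sq, abs_mul]
      exact (by simpa using hw : _ ≤ a * b - u ^ 2).trans (le_abs_self _)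
    have e3 : 0 ≤ a * b - u ^ 2 := le_trans (by positivity) hw
    nlinarith [mul_le_mul_of_nonneg_left hm e3]
  have ha' : a < 39 := by
    by_contra! h
    have h1 : 3 * a ^ 2 ≤ 4 * (a * b - u ^ 2) := by nlinarith
    have h2 : (3 * a ^ 2) ^ 2 ≤ (4 * (a * b - u ^ 2)) ^ 2 := by gcongr
    have h3 : 27 * (a * a ^ 3) ≤ a * (64 * 24000) := by nlinarith
    have h4 : 27 * a ^ 3 ≤ 64 * 24000 := by
      refine le_of_mul_le_mul_left ?_ ha
      linarith
    have h5 : 39 ^ 3 ≤ a ^ 3 := by gcongr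
    linarith
  exact ⟨_, mem_of_search hs ha ha' hab (hb a b u hc.1.1 ha hab hu hu' hm3) hu hu' ht ht' hw hm hm3
    hdet hc, K', hiso, hK'⟩

/-- Bound for `b` in terms of the determinant and a lower bound `k` for `a`. -/
lemma lt_of_minor_bound {a b u d k B : ℤ} (hk : 0 < k) (hB : 0 < B) (hka : k ≤ a) (hab : a ≤ b)
    (hu : 0 ≤ u) (hu' : 2 * u ≤ a) (h : 3 * (a * b - u ^ 2) ^ 2 ≤ 4 * a * d)
    (hd : 64 * d < 27 * k * B ^ 2) : b < B := by
  by_contra! hn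
  have h1 : 3 * (a * B) ≤ 4 * (a * b - u ^ 2) := by nlinarith
  have h2 : (3 * (a * B)) ^ 2 ≤ (4 * (a * b - u ^ 2)) ^ 2 := by
    have : 0 ≤ a * B := mul_nonneg (hk.le.trans hka) hB.le
    gcongr
  have h3 : a * (27 * a * B ^ 2) ≤ a * (64 * d) := by nlinarith
  have h4 : 27 * a * B ^ 2 ≤ 64 * d := le_of_mul_le_mul_left h3 (by linarith)
  have h5 : 27 * k * B ^ 2 ≤ 27 * a * B ^ 2 := by gcongr
  linarith

/-- An integral change of basis between lattices given by their Gram matrices. -/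
lemma isometric_of_mat {a b c s t u a' b' c' s' t' u' : ℤ} {K : TernaryLattice}
    (hK : K.gram = (symMat a' b' c' s' t' u').map (fun a : ℤ => (a : ℚ)))
    (U : Matrix (Fin 3) (Fin 3) ℤ)
    (hU : (U.det = 1 ∨ U.det = -1) ∧ Uᵀ * symMat a b c s t u * U = symMat a' b' c' s' t' u') (h) :
    Isometric K (sextuple a b c s t u h) := by
  have h1 := IntEquiv.isometric (sextuple_gram a b c s t u h) hK
    ⟨U, Int.isUnit_iff.mpr hU.1, hU.2⟩
  exact h1.symm

/-- The members `N₁, …, N₁₂` of the genus of `N₁`. -/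
def listN : Fin 12 → TernaryLattice := ![N₁, N₂, N₃, N₄, N₅, N₆, N₇, N₈, N₉, N₁₀, N₁₁, N₁₂]

theorem exists_isometric_of_mem_gen_N {K : TernaryLattice} (hK : K ∈ gen N₁) :
    ∃ i, Isometric K (listN i) := by
  obtain ⟨q, hq, K', hiso, hgram⟩ := exists_mem_list_of_search (d := 24000) (by norm_num) search_N
    (by norm_num) genusCond_N (fun a b u hv ha hab hu hu' h =>
      lt_of_minor_bound (k := 3) (by norm_num) (by norm_num)
        (by simp [valN] at hv; omega) hab hu hu' h (by norm_num)) hK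
  suffices h : ∃ i, Isometric K' (listN i) from h.imp fun _ hi => hiso.trans hi
  simp only [reducedN, List.mem_cons, List.not_mem_nil, or_false] at hq
  rcases hq with rfl | rfl | rfl | rfl | rfl | rfl | rfl | rfl | rfl | rfl |
    rfl | rfl | rfl | rfl | rfl | rfl | rfl | rfl | rfl
  · exact ⟨2, isometric_of_mat hgram !![1, 0, 0; 0, -1, 0; 0, 0, 1]
      (by decide +kernel) (by norm_num)⟩
  · exact ⟨2, isometric_of_mat hgram 1 (by decide +kernel) (by norm_num)⟩
  · exact ⟨1, isometric_of_mat hgram 1 (by decide +kernel) (by norm_num)⟩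
  · exact ⟨3, isometric_of_mat hgram 1 (by decide +kernel) (by norm_num)⟩
  · exact ⟨8, isometric_of_mat hgram 1 (by decide +kernel) (by norm_num)⟩
  · exact ⟨10, isometric_of_mat hgram !![1, 0, 0; 0, 1, 0; 0, 0, -1]
      (by decide +kernel) (by norm_num)⟩
  · exact ⟨10, isometric_of_mat hgram !![1, 1, 0; 0, -1, 0; 0, 0, -1]
      (by decide +kernel) (by norm_num)⟩
  · exact ⟨0, isometric_of_mat hgram !![1, 0, 0; 0, -1, 0; 0, 0, 1]
      (by decide +kernel) (by norm_num)⟩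
  · exact ⟨0, isometric_of_mat hgram 1 (by decide +kernel) (by norm_num)⟩
  · exact ⟨11, isometric_of_mat hgram !![1, 0, 0; 0, -1, 0; 0, 0, 1]
      (by decide +kernel) (by norm_num)⟩
  · exact ⟨11, isometric_of_mat hgram 1 (by decide +kernel) (by norm_num)⟩
  · exact ⟨6, isometric_of_mat hgram 1 (by decide +kernel) (by norm_num)⟩
  · exact ⟨5, isometric_of_mat hgram !![1, 0, 0; 0, -1, 0; 0, 0, 1]
      (by decide +kernel) (by norm_num)⟩
  · exact ⟨9, isometric_of_mat hgram !![1, 1, 0; 0, -1, 0; 0, 0, 1]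
      (by decide +kernel) (by norm_num)⟩
  · exact ⟨9, isometric_of_mat hgram 1 (by decide +kernel) (by norm_num)⟩
  · exact ⟨9, isometric_of_mat hgram !![1, 0, 1; 0, 1, -1; 0, 0, 1]
      (by decide +kernel) (by norm_num)⟩
  · exact ⟨9, isometric_of_mat hgram !![1, 0, 0; 0, 1, 1; 0, 0, -1]
      (by decide +kernel) (by norm_num)⟩
  · exact ⟨7, isometric_of_mat hgram 1 (by decide +kernel) (by norm_num)⟩
  · exact ⟨4, isometric_of_mat hgram 1 (by decide +kernel) (by norm_num)⟩

/-- The members `M₁, …, M₆` of the genus of `M₁`. -/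
def listM : Fin 6 → TernaryLattice := ![M₁, M₂, M₃, M₄, M₅, M₆]

theorem exists_isometric_of_mem_gen_M {K : TernaryLattice} (hK : K ∈ gen M₁) :
    ∃ i, Isometric K (listM i) := by
  obtain ⟨q, hq, K', hiso, hgram⟩ := exists_mem_list_of_search (d := 1600) (by norm_num) search_M
    (by norm_num) genusCond_M (fun a b u hv ha hab hu hu' h =>
      lt_of_minor_bound (k := 1) (by norm_num) (by norm_num)
        (by simp [valM] at hv; omega) hab hu hu' h (by norm_num)) hK
  suffices h : ∃ i, Isometric K' (listM i) from h.imp fun _ hi => hiso.trans hi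
  simp only [reducedM, List.mem_cons, List.not_mem_nil, or_false] at hq
  rcases hq with rfl | rfl | rfl | rfl | rfl | rfl | rfl | rfl
  · exact ⟨0, isometric_of_mat hgram 1 (by decide +kernel) (by norm_num)⟩
  · exact ⟨3, isometric_of_mat hgram 1 (by decide +kernel) (by norm_num)⟩
  · exact ⟨2, isometric_of_mat hgram !![1, 0, 0; 0, -1, 0; 0, 0, 1]
      (by decide +kernel) (by norm_num)⟩
  · exact ⟨2, isometric_of_mat hgram 1 (by decide +kernel) (by norm_num)⟩
  · exact ⟨5, isometric_of_mat hgram 1 (by decide +kernel) (by norm_num)⟩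
  · exact ⟨5, isometric_of_mat hgram !![1, 0, 0; 0, 0, 1; 0, 1, 0]
      (by decide +kernel) (by norm_num)⟩
  · exact ⟨1, isometric_of_mat hgram 1 (by decide +kernel) (by norm_num)⟩
  · exact ⟨4, isometric_of_mat hgram 1 (by decide +kernel) (by norm_num)⟩

/-! ### The spinor kernel and spinor genera -/

section SpinorKernel
variable {F : Type*} [Field F] {A B : Matrix (Fin 3) (Fin 3) F}

lemma one_mem_spinorKernel : (1 : Matrix (Fin 3) (Fin 3) F) ∈ spinorKernel A :=
  ⟨[], by simp, by simp, by simp, by simp⟩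

lemma mul_mem_spinorKernel {σ τ : Matrix (Fin 3) (Fin 3) F} (hσ : σ ∈ spinorKernel A)
    (hτ : τ ∈ spinorKernel A) : σ * τ ∈ spinorKernel A := by
  obtain ⟨l, h1, h2, rfl, h4⟩ := hσ
  obtain ⟨m, k1, k2, rfl, k4⟩ := hτ
  refine ⟨l ++ m, ?_, ?_, by simp, ?_⟩
  · rw [List.length_append]
    exact h1.add k1
  · simp only [List.mem_append]
    rintro v (hv | hv)
    exacts [h2 v hv, k2 v hv]
  · rw [List.map_append, List.prod_append]
    exact h4.mul k4

lemma reflection_mul_self {v : Fin 3 → F} (hv : v ⬝ᵥ A *ᵥ v ≠ 0) :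
    reflection A v * reflection A v = 1 := by
  have h : vecMulVec v (A *ᵥ v) * vecMulVec v (A *ᵥ v) =
      (v ⬝ᵥ A *ᵥ v) • vecMulVec v (A *ᵥ v) := by
    rw [vecMulVec_mul_vecMulVec, dotProduct_comm, vecMulVec_smul]
  have h2 : (2 / (v ⬝ᵥ A *ᵥ v)) * ((2 / (v ⬝ᵥ A *ᵥ v)) * (v ⬝ᵥ A *ᵥ v)) =
      2 / (v ⬝ᵥ A *ᵥ v) + 2 / (v ⬝ᵥ A *ᵥ v) := by
    field_simp
    norm_num
  simp only [reflection, sub_mul, mul_sub, Matrix.smul_mul, Matrix.mul_smul, h, smul_smul, one_mul,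
    mul_one, h2, add_smul]
  abel

lemma prod_reverse_reflections {l : List (Fin 3 → F)} (hl : ∀ v ∈ l, v ⬝ᵥ A *ᵥ v ≠ 0) :
    (l.reverse.map (reflection A)).prod * (l.map (reflection A)).prod = 1 := by
  induction l with
  | nil => simp
  | cons v l ih =>
    have h3 := reflection_mul_self (hl v (by simp))
    have h5 := ih fun w hw => hl w (by simp [hw])
    simp only [List.reverse_cons, List.map_append, List.map_cons, List.map_nil, List.prod_append,
      List.prod_cons, List.prod_nil, mul_one]
    rw [mul_assoc, ← mul_assoc (reflection A v), h3, one_mul, h5]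

lemma exists_inv_mem_spinorKernel {σ : Matrix (Fin 3) (Fin 3) F} (hσ : σ ∈ spinorKernel A) :
    ∃ τ ∈ spinorKernel A, τ * σ = 1 := by
  obtain ⟨l, h1, h2, rfl, h4⟩ := hσ
  refine ⟨(l.reverse.map (reflection A)).prod, ⟨l.reverse, by simpa using h1, by simpa using h2,
    rfl, ?_⟩, prod_reverse_reflections h2⟩
  rw [List.map_reverse, List.prod_reverse]
  exact h4

lemma mul_reflection {T : Matrix (Fin 3) (Fin 3) F} (hT : Tᵀ * A * T = B) (v : Fin 3 → F) :
    T * reflection B v = reflection A (T *ᵥ v) * T := by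
  have h1 : v ⬝ᵥ B *ᵥ v = (T *ᵥ v) ⬝ᵥ A *ᵥ (T *ᵥ v) := by
    rw [← hT, ← mulVec_mulVec, ← mulVec_mulVec, dotProduct_mulVec v Tᵀ, vecMul_transpose]
  have h2 : T * vecMulVec v (B *ᵥ v) = vecMulVec (T *ᵥ v) (A *ᵥ (T *ᵥ v)) * T := by
    rw [mul_vecMulVec, vecMulVec_mul, ← hT, ← mulVec_mulVec, ← mulVec_mulVec, mulVec_transpose]
  rw [reflection, reflection, h1, mul_sub, sub_mul, mul_one, one_mul, Matrix.mul_smul,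
    Matrix.smul_mul, h2]

lemma conj_mem_spinorKernel {T S : Matrix (Fin 3) (Fin 3) F} (hT : Tᵀ * A * T = B)
    (hTS : T * S = 1) {σ : Matrix (Fin 3) (Fin 3) F} (hσ : σ ∈ spinorKernel B) :
    T * σ * S ∈ spinorKernel A := by
  obtain ⟨l, h1, h2, rfl, h4⟩ := hσ
  have hq : ∀ v, (T *ᵥ v) ⬝ᵥ A *ᵥ (T *ᵥ v) = v ⬝ᵥ B *ᵥ v := by
    intro v
    rw [← hT, ← mulVec_mulVec, ← mulVec_mulVec, dotProduct_mulVec v Tᵀ, vecMul_transpose]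
  refine ⟨l.map (T *ᵥ ·), by simpa using h1, ?_, ?_, ?_⟩
  · simp only [List.mem_map, forall_exists_index, and_imp, forall_apply_eq_imp_iff₂, hq]
    exact h2
  · have : T * (l.map (reflection B)).prod =
        ((l.map (T *ᵥ ·)).map (reflection A)).prod * T := by
      clear h1 h2 h4
      induction l with
      | nil => simp
      | cons v l ih =>
        simp only [List.map_cons, List.prod_cons]
        rw [← mul_assoc, mul_reflection hT, mul_assoc, ih, mul_assoc]
    rw [this, mul_assoc, hTS, mul_one]
  · simpa only [List.map_map, Function.comp_def, hq] using h4

lemma transpose_mul_mul_of_reflections (hA : A.IsSymm) {l : List (Fin 3 → F)}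
    (h2 : ∀ v ∈ l, v ⬝ᵥ A *ᵥ v ≠ 0) :
    ((l.map (reflection A)).prod)ᵀ * A * (l.map (reflection A)).prod = A := by
  induction l with
  | nil => simp
  | cons v l ih =>
    have hv := h2 v (by simp)
    have h1 : (reflection A v)ᵀ * A = A * reflection A v := by
      have h3 : (vecMulVec v (A *ᵥ v))ᵀ * A = A * vecMulVec v (A *ᵥ v) := by
        rw [transpose_vecMulVec, vecMulVec_mul, mul_vecMulVec, ← mulVec_transpose, hA]
      rw [reflection, transpose_sub, transpose_one, transpose_smul, sub_mul, mul_sub, one_mul,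
        mul_one, Matrix.smul_mul, Matrix.mul_smul, h3]
    have h3 : (reflection A v)ᵀ * A * reflection A v = A := by
      rw [h1, mul_assoc, reflection_mul_self hv, mul_one]
    rw [List.map_cons, List.prod_cons, transpose_mul]
    calc _ = ((l.map (reflection A)).prod)ᵀ * ((reflection A v)ᵀ * A * reflection A v) *
          (l.map (reflection A)).prod := by simp only [Matrix.mul_assoc]
      _ = A := by rw [h3, ih fun w hw => h2 w (by simp [hw])]

lemma transpose_mul_mul_of_mem_spinorKernel (hA : A.IsSymm) {σ : Matrix (Fin 3) (Fin 3) F}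
    (hσ : σ ∈ spinorKernel A) : σᵀ * A * σ = A := by
  obtain ⟨l, -, h2, rfl, -⟩ := hσ
  exact transpose_mul_mul_of_reflections hA h2

end SpinorKernel

lemma ratMat_conj_gram {L K : TernaryLattice} {T : Matrix (Fin 3) (Fin 3) ℚ}
    (h : Tᵀ * L.gram * T = K.gram) (p : ℕ) [Fact p.Prime] :
    (ratMat p T)ᵀ * localGram p L * ratMat p T = localGram p K := by
  rw [← ratMat_gram, ← ratMat_gram, ← h, ratMat_mul, ratMat_mul, ratMat_transpose]

lemma localGram_isSymm (L : TernaryLattice) (p : ℕ) [Fact p.Prime] : (localGram p L).IsSymm := by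
  rw [← ratMat_gram, IsSymm, ← ratMat_transpose, L.symm]

lemma ratMat_mul_inv (p : ℕ) [Fact p.Prime] (T : GL (Fin 3) ℚ) :
    ratMat p T.1 * ratMat p (T⁻¹).1 = 1 := by
  rw [← ratMat_mul, ← Units.val_mul, mul_inv_cancel, Units.val_one, ratMat_one]

lemma ratMat_inv_mul (p : ℕ) [Fact p.Prime] (T : GL (Fin 3) ℚ) :
    ratMat p (T⁻¹).1 * ratMat p T.1 = 1 := by
  rw [← ratMat_mul, ← Units.val_mul, inv_mul_cancel, Units.val_one, ratMat_one]

lemma mem_spn_iff {L K : TernaryLattice} : K ∈ spn L ↔ ∃ T : GL (Fin 3) ℚ,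
    T.1ᵀ * L.gram * T.1 = K.gram ∧ ∀ (p : ℕ) [Fact p.Prime],
      ∃ σ ∈ spinorKernel (localGram p L), ∃ U : GL (Fin 3) ℤ_[p],
        ratMat p T.1 = σ * localUnit p U := Iff.rfl

lemma spn_subset_gen (L : TernaryLattice) : spn L ⊆ gen L := by
  rintro K ⟨T, hT, h⟩ p _
  obtain ⟨σ, hσ, U, hU⟩ := h p
  refine ⟨U, ?_⟩
  rw [← ratMat_conj_gram hT p, ratMat, hU, transpose_mul]
  nth_rw 1 [← transpose_mul_mul_of_mem_spinorKernel (localGram_isSymm L p) hσ]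
  simp only [Matrix.mul_assoc]

lemma Isometric.mem_spn {L K : TernaryLattice} (h : Isometric L K) : K ∈ spn L := by
  obtain ⟨U, hU⟩ := h
  let T : GL (Fin 3) ℚ := Units.map (Int.castRingHom ℚ).mapMatrix.toMonoidHom U
  refine mem_spn_iff.mpr ⟨T, hU, fun p _ => ⟨1, one_mem_spinorKernel, intUnit p U, ?_⟩⟩
  rw [one_mul, localUnit_intUnit]
  rfl

lemma spn_trans {L K J : TernaryLattice} (h₁ : K ∈ spn L) (h₂ : J ∈ spn K) : J ∈ spn L := by
  rw [mem_spn_iff] at *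
  obtain ⟨T, hT, h₁⟩ := h₁
  obtain ⟨S, hS, h₂⟩ := h₂
  refine ⟨T * S, ?_, fun p _ => ?_⟩
  · rw [← hS, ← hT, Units.val_mul, transpose_mul]
    simp only [Matrix.mul_assoc]
  · obtain ⟨σ, hσ, U, hU⟩ := h₁ p
    obtain ⟨τ, hτ, V, hV⟩ := h₂ p
    refine ⟨ratMat p T.1 * τ * ratMat p (T⁻¹).1 * σ, mul_mem_spinorKernel
      (conj_mem_spinorKernel (ratMat_conj_gram hT p) (ratMat_mul_inv p T) hτ) hσ, U * V, ?_⟩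
    rw [Units.val_mul, ratMat_mul, hV, localUnit_mul]
    calc _ = ratMat p T.1 * τ * (ratMat p (T⁻¹).1 * ratMat p T.1) * localUnit p V := by
          rw [ratMat_inv_mul, mul_one, mul_assoc]
      _ = _ := by
          rw [hU]
          simp only [Matrix.mul_assoc]

lemma spn_symm {L K : TernaryLattice} (h : K ∈ spn L) : L ∈ spn K := by
  rw [mem_spn_iff] at *
  obtain ⟨T, hT, h⟩ := h
  have hT' : (T⁻¹).1ᵀ * K.gram * (T⁻¹).1 = L.gram := by
    have h1 : T.1 * (T⁻¹).1 = 1 := by rw [← Units.val_mul, mul_inv_cancel, Units.val_one]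
    rw [← hT]
    calc _ = (T.1 * (T⁻¹).1)ᵀ * L.gram * (T.1 * (T⁻¹).1) := by
          rw [transpose_mul]
          simp only [Matrix.mul_assoc]
      _ = _ := by simp only [h1, transpose_one, Matrix.one_mul, Matrix.mul_one]
  refine ⟨T⁻¹, hT', fun p _ => ?_⟩
  obtain ⟨σ, hσ, U, hU⟩ := h p
  obtain ⟨τ, hτ, hτσ⟩ := exists_inv_mem_spinorKernel hσ
  refine ⟨ratMat p (T⁻¹).1 * τ * ratMat p T.1, conj_mem_spinorKernel (ratMat_conj_gram hT' p)
    (ratMat_inv_mul p T) hτ, U⁻¹, ?_⟩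
  have h1 : τ * ratMat p T.1 * localUnit p U⁻¹ = 1 := by
    rw [hU, ← mul_assoc, hτσ, one_mul, localUnit_mul_inv]
  rw [mul_assoc, mul_assoc, ← mul_assoc τ, h1, mul_one]

lemma spn_eq_of_mem {L K : TernaryLattice} (h : K ∈ spn L) : spn K = spn L :=
  Set.ext fun _ => ⟨fun hJ => spn_trans h hJ, fun hJ => spn_trans (spn_symm h) hJ⟩

/-! ### Certificates for membership in a spinor genus -/

/-- Transfer of a matrix identity from integral to rational Gram matrices. -/
lemma conj_eq_of_int {L K : TernaryLattice} {A B X : Matrix (Fin 3) (Fin 3) ℤ} {k : ℤ}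
    (hA : L.gram = A.map (fun a : ℤ => (a : ℚ))) (hB : K.gram = B.map (fun a : ℤ => (a : ℚ)))
    (h : Xᵀ * A * X = k • B) :
    (X.map (fun a : ℤ => (a : ℚ)))ᵀ * L.gram * X.map (fun a : ℤ => (a : ℚ)) = (k : ℚ) • K.gram := by
  rw [hA, hB]
  have h1 := congrArg (fun M : Matrix (Fin 3) (Fin 3) ℤ => M.map (fun a : ℤ => (a : ℚ))) h
  simp only [map_mul_cast] at h1
  refine h1.trans ?_
  ext i j
  change ((k * B i j : ℤ) : ℚ) = (k : ℚ) * (B i j : ℚ)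
  push_cast
  rfl

/-- `Q(v)` times the reflection in `v`. -/
def intReflection (A : Matrix (Fin 3) (Fin 3) ℤ) (v : Fin 3 → ℤ) : Matrix (Fin 3) (Fin 3) ℤ :=
  (v ⬝ᵥ A *ᵥ v) • 1 - (2 : ℤ) • vecMulVec v (A *ᵥ v)

lemma cast_dotProduct_mulVec {F : Type*} [Field F] (A : Matrix (Fin 3) (Fin 3) ℤ)
    (v : Fin 3 → ℤ) : (fun i => (v i : F)) ⬝ᵥ A.map (fun a : ℤ => (a : F)) *ᵥ (fun i => (v i : F)) =
      ((v ⬝ᵥ A *ᵥ v : ℤ) : F) := by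
  simp [dotProduct, mulVec]

lemma intReflection_cast {F : Type*} [Field F] (A : Matrix (Fin 3) (Fin 3) ℤ) (v : Fin 3 → ℤ)
    (hv : ((v ⬝ᵥ A *ᵥ v : ℤ) : F) ≠ 0) :
    (intReflection A v).map (fun a : ℤ => (a : F)) = ((v ⬝ᵥ A *ᵥ v : ℤ) : F) •
      reflection (A.map (fun a : ℤ => (a : F))) (fun i => (v i : F)) := by
  rw [reflection, cast_dotProduct_mulVec, smul_sub, smul_smul, mul_div_cancel₀ _ hv]
  ext i j
  have h1 : (A.map (fun a : ℤ => (a : F)) *ᵥ fun i => (v i : F)) j = (((A *ᵥ v) j : ℤ) : F) := by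
    simp [mulVec, dotProduct]
  have h2 : intReflection A v i j =
      (v ⬝ᵥ A *ᵥ v) * (1 : Matrix (Fin 3) (Fin 3) ℤ) i j - 2 * (v i * (A *ᵥ v) j) := rfl
  have h3 : (((1 : Matrix (Fin 3) (Fin 3) ℤ) i j : ℤ) : F) =
      (1 : Matrix (Fin 3) (Fin 3) F) i j := by
    rw [one_apply, one_apply]
    split_ifs <;> simp
  rw [map_apply, h2, Matrix.sub_apply, Matrix.smul_apply, Matrix.smul_apply, vecMulVec_apply, h1,
    ← h3]
  push_cast
  rfl

/-- A rational isometry `q⁻¹ X` from `K` to `L` puts `K` in the spinor genus of `L` if at the only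
critical prime `q` it is the product of `τ_v τ_w`, of spinor norm `Q(v) Q(w) = r²`, and an element
`n⁻¹ Y` of `GL₃(ℤ_q)`. -/
lemma mem_spn_of_certificate {L K : TernaryLattice} {A B : Matrix (Fin 3) (Fin 3) ℤ}
    (hA : L.gram = A.map (fun a : ℤ => (a : ℚ))) (hB : K.gram = B.map (fun a : ℤ => (a : ℚ)))
    {q : ℕ} (hq : q.Prime) (X Y : Matrix (Fin 3) (Fin 3) ℤ) (v w : Fin 3 → ℤ) (r n : ℤ)
    (hX : Xᵀ * A * X = (q : ℤ) ^ 2 • B ∧ (X.det = (q : ℤ) ^ 3 ∨ X.det = -(q : ℤ) ^ 3))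
    (hr : (v ⬝ᵥ A *ᵥ v) * (w ⬝ᵥ A *ᵥ w) = r * r) (hr0 : r ≠ 0)
    (hn : ¬ (q : ℤ) ∣ n ∧ ¬ (q : ℤ) ∣ Y.det)
    (hXY : (n * (r * r)) • X = (q : ℤ) • (intReflection A v * intReflection A w * Y)) :
    K ∈ spn L := by
  have hq0 : (q : ℚ) ≠ 0 := by exact_mod_cast hq.ne_zero
  have hXdet : X.det ≠ 0 := by
    have : (q : ℤ) ^ 3 ≠ 0 := pow_ne_zero _ (by exact_mod_cast hq.ne_zero)
    rcases hX.2 with h | h <;> rw [h]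
    exacts [this, neg_ne_zero.mpr this]
  have hTdet : ((q : ℚ)⁻¹ • X.map (fun a : ℤ => (a : ℚ))).det ≠ 0 := by
    have : (X.map (fun a : ℤ => (a : ℚ))).det = ((X.det : ℤ) : ℚ) :=
      ((Int.castRingHom ℚ).map_det X).symm
    rw [det_smul, this]
    have : ((X.det : ℤ) : ℚ) ≠ 0 := by exact_mod_cast hXdet
    positivity
  refine mem_spn_iff.mpr ⟨GeneralLinearGroup.mkOfDetNeZero _ hTdet, ?_, fun p hp => ?_⟩
  · change ((q : ℚ)⁻¹ • X.map (fun a : ℤ => (a : ℚ)))ᵀ * L.gram *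
      ((q : ℚ)⁻¹ • X.map (fun a : ℤ => (a : ℚ))) = K.gram
    have h1 := conj_eq_of_int hA hB hX.1
    push_cast at h1
    rw [transpose_smul, Matrix.smul_mul, Matrix.smul_mul, Matrix.mul_smul, h1, smul_smul, smul_smul]
    have : (q : ℚ)⁻¹ * ((q : ℚ)⁻¹ * (q : ℚ) ^ 2) = 1 := by field_simp
    rw [mul_assoc, this, one_smul]
  change ∃ σ ∈ spinorKernel (localGram p L), ∃ U : GL (Fin 3) ℤ_[p],
    ratMat p (((q : ℤ) : ℚ)⁻¹ • X.map (fun a : ℤ => (a : ℚ))) = σ * localUnit p U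
  have hpp : Prime (p : ℤ) := Nat.prime_iff_prime_int.mp hp.out
  by_cases hpq : p = q
  · subst hpq
    obtain ⟨U, hU⟩ := exists_localUnit p Y n hn.1 hn.2
    have hgram : localGram p L = A.map (fun a : ℤ => (a : ℚ_[p])) := by
      ext i j
      simp [localGram, hA]
    have hrF : (r : ℚ_[p]) ≠ 0 := by exact_mod_cast hr0
    have hvw : (((v ⬝ᵥ A *ᵥ v : ℤ) : ℚ_[p])) * ((w ⬝ᵥ A *ᵥ w : ℤ) : ℚ_[p]) = r * r := by
      exact_mod_cast congrArg (fun a : ℤ => (a : ℚ_[p])) hr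
    have hvw0 := hvw ▸ mul_ne_zero hrF hrF
    have hv := left_ne_zero_of_mul hvw0
    have hw := right_ne_zero_of_mul hvw0
    refine ⟨reflection (localGram p L) (fun i => (v i : ℚ_[p])) *
      reflection (localGram p L) (fun i => (w i : ℚ_[p])),
      ⟨[fun i => (v i : ℚ_[p]), fun i => (w i : ℚ_[p])], by simp, ?_, by simp, ?_⟩, U, ?_⟩
    · simp only [List.mem_cons, List.not_mem_nil, or_false, forall_eq_or_imp, forall_eq, hgram,
        cast_dotProduct_mulVec]
      exact ⟨hv, hw⟩
    · refine ⟨(r : ℚ_[p]), ?_⟩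
      simp only [List.map_cons, List.map_nil, List.prod_cons, List.prod_nil, mul_one, hgram,
        cast_dotProduct_mulVec, hvw]
    · have hp0 : (p : ℚ_[p]) ≠ 0 := by exact_mod_cast hp.out.ne_zero
      have hn0 : (n : ℚ_[p]) ≠ 0 := by
        have : n ≠ 0 := by
          rintro rfl
          exact hn.1 (dvd_zero _)
        exact_mod_cast this
      have h1 := congrArg (Int.castRingHom ℚ_[p]).mapMatrix hXY
      have h2 : ∀ (c : ℤ) (Z : Matrix (Fin 3) (Fin 3) ℤ), (Int.castRingHom ℚ_[p]).mapMatrix (c • Z)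
          = (c : ℚ_[p]) • Z.map (fun a : ℤ => (a : ℚ_[p])) := by
        intro c Z
        ext i j
        change ((c * Z i j : ℤ) : ℚ_[p]) = (c : ℚ_[p]) * (Z i j : ℚ_[p])
        push_cast
        rfl
      have h3 : ∀ (c : ℤ) (Z : Matrix (Fin 3) (Fin 3) ℤ),
          ratMat p ((c : ℚ)⁻¹ • Z.map (fun a : ℤ => (a : ℚ))) =
            (c : ℚ_[p])⁻¹ • Z.map (fun a : ℤ => (a : ℚ_[p])) := by
        intro c Z
        ext i j
        simp [ratMat]
      have h4 : (intReflection A v * intReflection A w * Y).map (fun a : ℤ => (a : ℚ_[p])) =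
          (intReflection A v).map (fun a : ℤ => (a : ℚ_[p])) *
          (intReflection A w).map (fun a : ℤ => (a : ℚ_[p])) *
            Y.map (fun a : ℤ => (a : ℚ_[p])) := by
        change (Int.castRingHom ℚ_[p]).mapMatrix _ = _
        rw [map_mul, map_mul]
        rfl
      rw [h2, h2, h4, intReflection_cast A v hv, intReflection_cast A w hw, Matrix.smul_mul,
        Matrix.mul_smul, smul_smul, hvw, Matrix.smul_mul, smul_smul] at h1
      rw [hU, h3, h3, hgram, Matrix.mul_smul]
      have h5 : ((n : ℚ_[p]) * (r * r)) ≠ 0 := mul_ne_zero hn0 (mul_ne_zero hrF hrF)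
      push_cast at h1 ⊢
      have h6 := congrArg (fun Z => ((p : ℚ_[p])⁻¹ * ((n : ℚ_[p]) * (r * r))⁻¹) • Z) h1
      simp only [smul_smul] at h6
      convert h6 using 2
      · field_simp
      · field_simp
  · have hpq' : ¬ (p : ℤ) ∣ (q : ℤ) := by
      rw [Int.natCast_dvd_natCast, Nat.prime_dvd_prime_iff_eq hp.out hq]
      exact hpq
    have hXd : ¬ (p : ℤ) ∣ X.det := by
      rcases hX.2 with hd | hd <;> rw [hd]
      · exact fun h => hpq' (hpp.dvd_of_dvd_pow h)
      · exact fun h => hpq' (hpp.dvd_of_dvd_pow ((dvd_neg).mp h))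
    obtain ⟨U, hU⟩ := exists_localUnit p X q hpq' hXd
    exact ⟨1, one_mem_spinorKernel, U, by rw [one_mul, hU]⟩

/-! ### Spinor equivalences and representations between the listed lattices -/

lemma representablePair_of_mat {a b c s t u a' b' c' s' t' u' : ℤ} {h h'}
    (X : Matrix (Fin 3) (Fin 3) ℤ)
    (hX : Xᵀ * symMat a b c s t u * X = (15 : ℤ) • symMat a' b' c' s' t' u' ∧
      a * b * c + 2 * s * t * u - a * s ^ 2 - b * t ^ 2 - c * u ^ 2 =
        15 * (a' * b' * c' + 2 * s' * t' * u' - a' * s' ^ 2 - b' * t' ^ 2 - c' * u' ^ 2)) :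
    RepresentablePair 15 (sextuple a b c s t u h) (sextuple a' b' c' s' t' u' h') := by
  refine ⟨⟨X, ?_⟩, ?_⟩
  · exact_mod_cast conj_eq_of_int (sextuple_gram _ _ _ _ _ _ h) (sextuple_gram _ _ _ _ _ _ h') hX.1
  · rw [sextuple_disc, sextuple_disc, hX.2]
    push_cast
    ring

lemma N₂_mem_spn : N₂ ∈ spn N₁ :=
  mem_spn_of_certificate (q := 3) (sextuple_gram _ _ _ _ _ _ _) (sextuple_gram _ _ _ _ _ _ _)
    (by norm_num) !![1, 2, 0; -1, 1, 3; 0, 0, -9]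
    !![43, 76, 200; -27, 17, 879; -8, 14, -237] ![1, 3, 3] ![0, 1, -3] 1320 121
    (by decide +kernel) (by decide +kernel) (by decide +kernel) (by decide +kernel)
    (by decide +kernel)

lemma N₃_mem_spn : N₃ ∈ spn N₂ :=
  mem_spn_of_certificate (q := 3) (sextuple_gram _ _ _ _ _ _ _) (sextuple_gram _ _ _ _ _ _ _)
    (by norm_num) !![3, 3, 1; 0, -9, -3; 0, 0, -1]
    !![1450449, 1328849, 1715483; 9600, -4178547, -3301649; 4772, 95440, -431403]
    ![2, -3, 3] ![2, -3, -3] 10863 1456849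
    (by decide +kernel) (by decide +kernel) (by decide +kernel) (by decide +kernel)
    (by decide +kernel)

lemma N₄_mem_spn : N₄ ∈ spn N₃ :=
  mem_spn_of_certificate (q := 3) (sextuple_gram _ _ _ _ _ _ _) (sextuple_gram _ _ _ _ _ _ _)
    (by norm_num) !![3, 1, 0; 0, -1, 6; 0, -1, -3]
    !![31321, -8653, -71600; 716, -10895, 64722; -1432, -10971, -31161]
    ![1, 1, -2] ![1, -1, 2] 543 32761
    (by decide +kernel) (by decide +kernel) (by decide +kernel) (by decide +kernel)
    (by decide +kernel)

lemma N₅_mem_spn : N₅ ∈ spn N₄ :=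
  mem_spn_of_certificate (q := 3) (sextuple_gram _ _ _ _ _ _ _) (sextuple_gram _ _ _ _ _ _ _)
    (by norm_num) !![9, 0, 3; 0, 3, 1; 0, 0, -1]
    !![501843, 0, 167281; -3200, 138481, -59173; -3128, -28152, -56587]
    ![0, 1, -2] ![0, 1, 2] 1227 167281
    (by decide +kernel) (by decide +kernel) (by decide +kernel) (by decide +kernel)
    (by decide +kernel)

lemma N₆_mem_spn : N₆ ∈ spn N₅ :=
  mem_spn_of_certificate (q := 3) (sextuple_gram _ _ _ _ _ _ _) (sextuple_gram _ _ _ _ _ _ _)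
    (by norm_num) !![2, -1, -1; 0, 3, 0; -1, -1, -4]
    !![1342, 1037, 1639; -392, 1225, -3234; 501, -2123, -1612] ![0, 1, -2] ![1, 0, -2] 147 2401
    (by decide +kernel) (by decide +kernel) (by decide +kernel) (by decide +kernel)
    (by decide +kernel)

lemma N₈_mem_spn : N₈ ∈ spn N₇ :=
  mem_spn_of_certificate (q := 3) (sextuple_gram _ _ _ _ _ _ _) (sextuple_gram _ _ _ _ _ _ _)
    (by norm_num) !![2, 4, -3; -1, -2, -3; -1, 1, 0]
    !![176, 152, -489; -63, 274, 111; 107, 53, 128] ![1, -2, 2] ![1, -2, -2] 408 289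
    (by decide +kernel) (by decide +kernel) (by decide +kernel) (by decide +kernel)
    (by decide +kernel)

lemma N₉_mem_spn : N₉ ∈ spn N₈ :=
  mem_spn_of_certificate (q := 3) (sextuple_gram _ _ _ _ _ _ _) (sextuple_gram _ _ _ _ _ _ _)
    (by norm_num) !![1, -2, 3; 0, 0, -9; -1, -1, 0]
    !![55, -46, -279; -22, -52, 237; 33, 23, 200] ![0, 0, 1] ![2, -3, -1] 132 121
    (by decide +kernel) (by decide +kernel) (by decide +kernel) (by decide +kernel)
    (by decide +kernel)

lemma N₁₀_mem_spn : N₁₀ ∈ spn N₉ :=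
  mem_spn_of_certificate (q := 3) (sextuple_gram _ _ _ _ _ _ _) (sextuple_gram _ _ _ _ _ _ _)
    (by norm_num) !![0, 3, -6; 3, 1, 1; 0, -1, -1]
    !![12, 287, 38; 117, -15, -53; -4, -15, -53] ![0, 0, 1] ![3, -1, -1] 330 121
    (by decide +kernel) (by decide +kernel) (by decide +kernel) (by decide +kernel)
    (by decide +kernel)

lemma N₁₁_mem_spn : N₁₁ ∈ spn N₁₀ :=
  mem_spn_of_certificate (q := 3) (sextuple_gram _ _ _ _ _ _ _) (sextuple_gram _ _ _ _ _ _ _)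
    (by norm_num) !![1, -2, -6; 0, 0, 9; -1, -1, -3]
    !![-265, -710, -9196; 136, -752, 2703; -707, -115, 47] ![0, 3, -2] ![3, -3, 2] 387 1849
    (by decide +kernel) (by decide +kernel) (by decide +kernel) (by decide +kernel)
    (by decide +kernel)

lemma N₁₂_mem_spn : N₁₂ ∈ spn N₁₁ :=
  mem_spn_of_certificate (q := 3) (sextuple_gram _ _ _ _ _ _ _) (sextuple_gram _ _ _ _ _ _ _)
    (by norm_num) !![0, 1, 9; 3, 0, -3; 0, -1, 0]
    !![16, 144, 343; 89, -167, -81; -16, -23, 20] ![1, -1, 2] ![1, -2, -1] 660 121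
    (by decide +kernel) (by decide +kernel) (by decide +kernel) (by decide +kernel)
    (by decide +kernel)

lemma M₂_mem_spn : M₂ ∈ spn M₁ :=
  mem_spn_of_certificate (q := 5) (sextuple_gram _ _ _ _ _ _ _) (sextuple_gram _ _ _ _ _ _ _)
    (by norm_num) !![5, 0, -20; -1, 4, -1; -1, -1, -1]
    !![95, -64, -300; 33, -12, 45; 5, 35, -3] ![1, 2, 0] ![0, 1, 1] 90 81
    (by decide +kernel) (by decide +kernel) (by decide +kernel) (by decide +kernel)
    (by decide +kernel)

lemma M₃_mem_spn : M₃ ∈ spn M₂ :=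
  mem_spn_of_certificate (q := 5) (sextuple_gram _ _ _ _ _ _ _) (sextuple_gram _ _ _ _ _ _ _)
    (by norm_num) !![4, -2, -5; 0, -5, 0; -1, -2, -5]
    !![4, 10, -7; -2, -5, -10; -3, 6, 3] ![0, 1, -1] ![1, 0, 1] 30 9
    (by decide +kernel) (by decide +kernel) (by decide +kernel) (by decide +kernel)
    (by decide +kernel)

lemma M₆_mem_spn : M₆ ∈ spn M₄ :=
  mem_spn_of_certificate (q := 5) (sextuple_gram _ _ _ _ _ _ _) (sextuple_gram _ _ _ _ _ _ _)
    (by norm_num) !![0, 5, -10; 2, -8, -3; -1, -1, -1]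
    !![4, -15, -8; -6, 0, -15; 1, 3, -2] ![1, -1, 0] ![0, 2, -1] 30 9
    (by decide +kernel) (by decide +kernel) (by decide +kernel) (by decide +kernel)
    (by decide +kernel)

lemma M₅_mem_spn : M₅ ∈ spn M₆ :=
  mem_spn_of_certificate (q := 5) (sextuple_gram _ _ _ _ _ _ _) (sextuple_gram _ _ _ _ _ _ _)
    (by norm_num) !![4, 3, -9; -1, 3, 1; -3, -1, -2]
    !![56, -21, -63; 7, -21, 35; 15, 25, 26] ![1, 1, 1] ![1, 1, -2] 70 49
    (by decide +kernel) (by decide +kernel) (by decide +kernel) (by decide +kernel)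
    (by decide +kernel)

lemma N₇_mem_gen : N₇ ∈ gen N₁ :=
  mem_gen_of_isometries !![4, 8, 0; 3, -3, -9; -1, 1, -3]
    !![1, 7, 25; -9, -8, 6; -1, 4, -3] 6 11 (by norm_num) (by norm_num) (by norm_num)
    (by decide +kernel) (by decide +kernel)
    (conj_eq_of_int (sextuple_gram _ _ _ _ _ _ _) (sextuple_gram _ _ _ _ _ _ _) (by decide +kernel))
    (conj_eq_of_int (sextuple_gram _ _ _ _ _ _ _) (sextuple_gram _ _ _ _ _ _ _) (by decide +kernel))

lemma M₄_mem_gen : M₄ ∈ gen M₁ :=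
  mem_gen_of_isometries !![4, 0, 0; 0, -1, 0; 0, 0, -2]
    !![4, -5, 0; -1, -1, 0; 0, 0, -3] 2 3 (by norm_num) (by norm_num) (by norm_num)
    (by decide +kernel) (by decide +kernel)
    (conj_eq_of_int (sextuple_gram _ _ _ _ _ _ _) (sextuple_gram _ _ _ _ _ _ _) (by decide +kernel))
    (conj_eq_of_int (sextuple_gram _ _ _ _ _ _ _) (sextuple_gram _ _ _ _ _ _ _) (by decide +kernel))

lemma representablePair_N₁_M₁ : RepresentablePair 15 N₁ M₁ :=
  representablePair_of_mat !![0, -5, 0; 1, 0, 1; 0, 0, -3] (by decide +kernel)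

lemma representablePair_N₉_M₁ : RepresentablePair 15 N₉ M₁ :=
  representablePair_of_mat !![1, 0, -10; -1, 0, -5; 0, -1, 0] (by decide +kernel)

lemma representablePair_N₃_M₂ : RepresentablePair 15 N₃ M₂ :=
  representablePair_of_mat !![5, 0, 0; 0, -1, 2; 0, -1, -1] (by decide +kernel)

lemma representablePair_N₇_M₂ : RepresentablePair 15 N₇ M₂ :=
  representablePair_of_mat !![0, 1, -5; 0, -3, 0; 1, 0, 0] (by decide +kernel)

lemma representablePair_N₅_M₃ : RepresentablePair 15 N₅ M₃ :=
  representablePair_of_mat !![1, -1, 2; 1, -1, -3; -1, -2, -1] (by decide +kernel)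

lemma representablePair_N₁₁_M₃ : RepresentablePair 15 N₁₁ M₃ :=
  representablePair_of_mat !![2, 5, 2; 1, -5, -2; 0, 0, -1] (by decide +kernel)

lemma representablePair_N₂_M₄ : RepresentablePair 15 N₂ M₄ :=
  representablePair_of_mat !![1, -5, 0; -3, 0, 0; 0, 0, -1] (by decide +kernel)

lemma representablePair_N₈_M₄ : RepresentablePair 15 N₈ M₄ :=
  representablePair_of_mat !![1, 2, 0; 1, -1, 0; 0, 0, -5] (by decide +kernel)

lemma representablePair_N₆_M₅ : RepresentablePair 15 N₆ M₅ :=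
  representablePair_of_mat !![1, 0, -5; 2, -1, 0; -1, -1, 0] (by decide +kernel)

lemma representablePair_N₁₀_M₅ : RepresentablePair 15 N₁₀ M₅ :=
  representablePair_of_mat !![2, 3, 1; 1, -1, -2; -1, 1, -1] (by decide +kernel)

lemma representablePair_N₄_M₆ : RepresentablePair 15 N₄ M₆ :=
  representablePair_of_mat !![3, 0, 9; 1, 0, -2; 0, -1, 0] (by decide +kernel)

lemma representablePair_N₁₂_M₆ : RepresentablePair 15 N₁₂ M₆ :=
  representablePair_of_mat !![0, -5, 0; 0, 0, 3; 1, 0, 0] (by decide +kernel)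

/-! ### Rotations of the form `x² + y² + 5 z²` and quaternions -/

/-- The Gram matrix of the form `x² + y² + 5 z²`. -/
def diagGram (R : Type*) [CommRing R] : Matrix (Fin 3) (Fin 3) R := !![1, 0, 0; 0, 1, 0; 0, 0, 5]

/-- The norm of the quaternion `w + x i + y j + z k`, with `i² = j² = -5`, `k² = -1`, in the even
Clifford algebra of `x² + y² + 5 z²`. -/
def qnorm {R : Type*} [CommRing R] (w x y z : R) : R := w ^ 2 + 5 * x ^ 2 + 5 * y ^ 2 + z ^ 2

/-- Conjugation by the quaternion `α = w + x i + y j + z k`, multiplied by the norm of `α`: a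
similitude of the form `x² + y² + 5 z²`. -/
def rot {R : Type*} [CommRing R] (w x y z : R) : Matrix (Fin 3) (Fin 3) R :=
  !![w ^ 2 + 5 * x ^ 2 - 5 * y ^ 2 - z ^ 2, 2 * (5 * x * y - w * z), 10 * (x * z + w * y);
    2 * (5 * x * y + w * z), w ^ 2 - 5 * x ^ 2 + 5 * y ^ 2 - z ^ 2, 10 * (y * z - w * x);
    2 * (x * z - w * y), 2 * (y * z + w * x), w ^ 2 - 5 * x ^ 2 - 5 * y ^ 2 + z ^ 2]

section Quaternion
variable {R : Type*} [CommRing R]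

lemma qnorm_mul (w x y z w' x' y' z' : R) :
    qnorm w x y z * qnorm w' x' y' z' =
      qnorm (w * w' - 5 * x * x' - 5 * y * y' - z * z') (w * x' + x * w' + y * z' - z * y')
        (w * y' + y * w' + z * x' - x * z') (w * z' + z * w' + 5 * (x * y' - y * x')) := by
  simp only [qnorm]
  ring

lemma rot_mul (w x y z w' x' y' z' : R) :
    rot w x y z * rot w' x' y' z' =
      rot (w * w' - 5 * x * x' - 5 * y * y' - z * z') (w * x' + x * w' + y * z' - z * y')
        (w * y' + y * w' + z * x' - x * z') (w * z' + z * w' + 5 * (x * y' - y * x')) := by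
  ext i j
  fin_cases i <;> fin_cases j <;> simp [rot, mul_apply, Fin.sum_univ_three] <;> ring

lemma det_rot (w x y z : R) : (rot w x y z).det = qnorm w x y z ^ 3 := by
  simp [rot, det_fin_three, qnorm]
  ring

lemma rot_smul (c w x y z : R) : rot (c * w) (c * x) (c * y) (c * z) = c ^ 2 • rot w x y z := by
  ext i j
  fin_cases i <;> fin_cases j <;> simp [rot] <;> ring

lemma qnorm_smul (c w x y z : R) :
    qnorm (c * w) (c * x) (c * y) (c * z) = c ^ 2 * qnorm w x y z := by
  simp only [qnorm]
  ring

lemma rot_map {S : Type*} [CommRing S] (f : R →+* S) (w x y z : R) :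
    f.mapMatrix (rot w x y z) = rot (f w) (f x) (f y) (f z) := by
  ext i j
  fin_cases i <;> fin_cases j <;> simp [rot, map_ofNat]

lemma qnorm_map {S : Type*} [CommRing S] (f : R →+* S) (w x y z : R) :
    f (qnorm w x y z) = qnorm (f w) (f x) (f y) (f z) := by
  simp [qnorm, map_ofNat]

end Quaternion

section Field
variable {F : Type*} [Field F]

lemma dotProduct_diagGram (v w : Fin 3 → F) :
    v ⬝ᵥ diagGram F *ᵥ w = v 0 * w 0 + v 1 * w 1 + 5 * v 2 * w 2 := by
  simp [diagGram, dotProduct, mulVec, Fin.sum_univ_three]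
  ring

/-- Up to sign, the reflection in `v` is conjugation by the pure quaternion attached to `v`. -/
lemma rot_eq_smul_reflection (v : Fin 3 → F) (hv : v ⬝ᵥ diagGram F *ᵥ v ≠ 0) :
    rot 0 (v 0) (v 1) (5 * v 2) =
      (-(5 * (v ⬝ᵥ diagGram F *ᵥ v))) • reflection (diagGram F) v := by
  rw [reflection, smul_sub, smul_smul]
  have h1 : -(5 * (v ⬝ᵥ diagGram F *ᵥ v)) * (2 / (v ⬝ᵥ diagGram F *ᵥ v)) = -10 := by
    field_simp
    norm_num
  rw [h1, dotProduct_diagGram]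
  ext i j
  fin_cases i <;> fin_cases j <;>
    simp [rot, diagGram, dotProduct, Fin.sum_univ_three] <;> ring

lemma qnorm_pure (v : Fin 3 → F) :
    qnorm 0 (v 0) (v 1) (5 * v 2) = 5 * (v ⬝ᵥ diagGram F *ᵥ v) := by
  rw [dotProduct_diagGram, qnorm]
  ring

/-- A product of reflections comes from a quaternion, whose norm is the spinor norm up to the
factor `5` for each reflection. -/
lemma exists_rot_of_reflections (l : List (Fin 3 → F))
    (hl : ∀ v ∈ l, v ⬝ᵥ diagGram F *ᵥ v ≠ 0) :
    ∃ w x y z : F, qnorm w x y z = 5 ^ l.length * (l.map fun v => v ⬝ᵥ diagGram F *ᵥ v).prod ∧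
      rot w x y z = ((-1) ^ l.length * qnorm w x y z) • (l.map (reflection (diagGram F))).prod := by
  induction l with
  | nil =>
    refine ⟨1, 0, 0, 0, by simp [qnorm], ?_⟩
    ext i j
    fin_cases i <;> fin_cases j <;> simp [rot, qnorm]
  | cons v l ih =>
    obtain ⟨w, x, y, z, h1, h2⟩ := ih fun u hu => hl u (by simp [hu])
    have hv := hl v (by simp)
    refine ⟨_, _, _, _, (qnorm_mul 0 (v 0) (v 1) (5 * v 2) w x y z).symm.trans ?_,
      (rot_mul 0 (v 0) (v 1) (5 * v 2) w x y z).symm.trans ?_⟩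
    · rw [qnorm_pure, h1]
      simp only [List.length_cons, List.map_cons, List.prod_cons]
      ring
    · rw [← qnorm_mul, rot_eq_smul_reflection v hv, h2, qnorm_pure, Matrix.smul_mul,
        Matrix.mul_smul, smul_smul, List.length_cons, List.map_cons, List.prod_cons]
      congr 1
      ring

/-- The spinor kernel consists of the rotations given by quaternions of norm `1`. -/
lemma exists_rot_of_mem_spinorKernel [CharZero F] {σ : Matrix (Fin 3) (Fin 3) F}
    (hσ : σ ∈ spinorKernel (diagGram F)) :
    ∃ w x y z : F, qnorm w x y z = 1 ∧ σ = rot w x y z := by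
  obtain ⟨l, ⟨k, hk⟩, hl, rfl, r, hr⟩ := hσ
  obtain ⟨w, x, y, z, h1, h2⟩ := exists_rot_of_reflections l hl
  have hq : qnorm w x y z = (5 ^ k * r) ^ 2 := by
    rw [h1, hr, hk]
    ring
  have hr0 : (5 : F) ^ k * r ≠ 0 := by
    have h3 : (l.map fun v => v ⬝ᵥ diagGram F *ᵥ v).prod ≠ 0 := by
      refine List.prod_ne_zero fun h0 => ?_
      obtain ⟨v, hv, hv0⟩ := List.mem_map.mp h0
      exact hl v hv hv0
    refine mul_ne_zero (pow_ne_zero _ (by norm_num)) fun h0 => h3 ?_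
    rw [hr, h0, mul_zero]
  refine ⟨(5 ^ k * r)⁻¹ * w, (5 ^ k * r)⁻¹ * x, (5 ^ k * r)⁻¹ * y, (5 ^ k * r)⁻¹ * z, ?_, ?_⟩
  · rw [qnorm_smul, hq, ← mul_pow, inv_mul_cancel₀ hr0, one_pow]
  · have he : ((-1 : F)) ^ l.length = 1 := Even.neg_one_pow ⟨k, hk⟩
    rw [rot_smul, h2, he, one_mul, smul_smul, hq, ← mul_pow, inv_mul_cancel₀ hr0, one_pow, one_smul]

end Field

lemma diagGram_pos {v : Fin 3 → ℚ} (hv : v ≠ 0) : 0 < v ⬝ᵥ diagGram ℚ *ᵥ v := by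
  rw [dotProduct_diagGram]
  by_contra! h
  apply hv
  have h0 : v 0 = 0 := by nlinarith [sq_nonneg (v 0), sq_nonneg (v 1), sq_nonneg (v 2)]
  have h1 : v 1 = 0 := by nlinarith [sq_nonneg (v 0), sq_nonneg (v 1), sq_nonneg (v 2)]
  have h2 : v 2 = 0 := by nlinarith [sq_nonneg (v 0), sq_nonneg (v 1), sq_nonneg (v 2)]
  ext i
  fin_cases i <;> assumption

lemma reflection_mulVec {F : Type*} [Field F] (A : Matrix (Fin 3) (Fin 3) F) (v x : Fin 3 → F) :
    reflection A v *ᵥ x = x - (2 / (v ⬝ᵥ A *ᵥ v) * ((A *ᵥ v) ⬝ᵥ x)) • v := by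
  rw [reflection, sub_mulVec, one_mulVec, smul_mulVec, vecMulVec_mulVec, op_smul_eq_smul, smul_smul]

/-- Some product of at most one reflection moves `f` to a vector `e` of the same norm and fixes the
vectors that have the same inner product with `e` and `f`. -/
lemma exists_reflections_map {f e : Fin 3 → ℚ}
    (h : f ⬝ᵥ diagGram ℚ *ᵥ f = e ⬝ᵥ diagGram ℚ *ᵥ e) :
    ∃ l : List (Fin 3 → ℚ), (∀ v ∈ l, v ⬝ᵥ diagGram ℚ *ᵥ v ≠ 0) ∧
      (l.map (reflection (diagGram ℚ))).prod *ᵥ f = e ∧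
      ∀ x, x ⬝ᵥ diagGram ℚ *ᵥ f = x ⬝ᵥ diagGram ℚ *ᵥ e →
        (l.map (reflection (diagGram ℚ))).prod *ᵥ x = x := by
  by_cases hfe : f = e
  · exact ⟨[], by simp, by simpa using hfe, by simp⟩
  have hv := (diagGram_pos (sub_ne_zero.mpr hfe)).ne'
  refine ⟨[f - e], by simpa using hv, ?_, fun x hx => ?_⟩
  · have h1 : 2 / ((f - e) ⬝ᵥ diagGram ℚ *ᵥ (f - e)) * ((diagGram ℚ *ᵥ (f - e)) ⬝ᵥ f) = 1 := by
      rw [dotProduct_comm _ f, div_mul_eq_mul_div, div_eq_one_iff_eq hv]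
      simp only [dotProduct_diagGram, Pi.sub_apply] at h ⊢
      linarith
    simp only [List.map_cons, List.map_nil, List.prod_cons, List.prod_nil, mul_one]
    rw [reflection_mulVec, h1, one_smul, sub_sub_cancel]
  · have h1 : (diagGram ℚ *ᵥ (f - e)) ⬝ᵥ x = 0 := by
      rw [dotProduct_comm]
      simp only [dotProduct_diagGram, Pi.sub_apply] at hx ⊢
      linarith
    simp only [List.map_cons, List.map_nil, List.prod_cons, List.prod_nil, mul_one]
    rw [reflection_mulVec, h1, mul_zero, zero_smul, sub_zero]

lemma diagGram_isSymm (R : Type*) [CommRing R] : (diagGram R).IsSymm := by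
  ext i j
  fin_cases i <;> fin_cases j <;> rfl

/-- A form of the Cartan–Dieudonné theorem: every isometry is a product of reflections, since
reflections can move the images of the three basis vectors back one after the other. -/
lemma exists_reflections_of_isometry {ρ : Matrix (Fin 3) (Fin 3) ℚ}
    (h : ρᵀ * diagGram ℚ * ρ = diagGram ℚ) :
    ∃ l : List (Fin 3 → ℚ), (∀ v ∈ l, v ⬝ᵥ diagGram ℚ *ᵥ v ≠ 0) ∧
      ρ = (l.map (reflection (diagGram ℚ))).prod := by
  have hinner : ∀ {τ : Matrix (Fin 3) (Fin 3) ℚ}, τᵀ * diagGram ℚ * τ = diagGram ℚ →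
      ∀ x y, (τ *ᵥ x) ⬝ᵥ diagGram ℚ *ᵥ (τ *ᵥ y) = x ⬝ᵥ diagGram ℚ *ᵥ y := by
    intro τ hτ x y
    nth_rw 2 [← hτ]
    rw [← mulVec_mulVec, ← mulVec_mulVec, dotProduct_mulVec x τᵀ, vecMul_transpose]
  have hmul : ∀ {τ : Matrix (Fin 3) (Fin 3) ℚ} {l : List (Fin 3 → ℚ)},
      τᵀ * diagGram ℚ * τ = diagGram ℚ → (∀ v ∈ l, v ⬝ᵥ diagGram ℚ *ᵥ v ≠ 0) →
      ((l.map (reflection (diagGram ℚ))).prod * τ)ᵀ * diagGram ℚ *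
        ((l.map (reflection (diagGram ℚ))).prod * τ) = diagGram ℚ := by
    intro τ l hτ hl
    have h1 := transpose_mul_mul_of_reflections (diagGram_isSymm ℚ) hl
    calc _ = τᵀ * (((l.map (reflection (diagGram ℚ))).prod)ᵀ * diagGram ℚ *
          (l.map (reflection (diagGram ℚ))).prod) * τ := by
          rw [transpose_mul]
          simp only [Matrix.mul_assoc]
      _ = _ := by rw [h1, hτ]
  set e : Fin 3 → Fin 3 → ℚ := fun i => Pi.single i 1 with he
  obtain ⟨l₁, hl₁, m₁, -⟩ := exists_reflections_map (hinner h (e 0) (e 0))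
  have i₁ := hmul h hl₁
  rw [mulVec_mulVec] at m₁
  obtain ⟨l₂, hl₂, m₂, f₂⟩ := exists_reflections_map (hinner i₁ (e 1) (e 1))
  have i₂ := hmul i₁ hl₂
  have c₂ := f₂ (e 0) (by
    conv_lhs => rw [← m₁]
    exact hinner i₁ _ _)
  rw [← m₁, mulVec_mulVec, m₁] at c₂
  rw [mulVec_mulVec] at m₂
  obtain ⟨l₃, hl₃, m₃, f₃⟩ := exists_reflections_map (hinner i₂ (e 2) (e 2))
  have c₃ := f₃ (e 0) (by
    conv_lhs => rw [← c₂]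
    exact hinner i₂ _ _)
  have d₃ := f₃ (e 1) (by
    conv_lhs => rw [← m₂]
    exact hinner i₂ _ _)
  rw [← c₂, mulVec_mulVec, c₂] at c₃
  rw [← m₂, mulVec_mulVec, m₂] at d₃
  rw [mulVec_mulVec] at m₃
  have hl : ∀ v ∈ l₃ ++ l₂ ++ l₁, v ⬝ᵥ diagGram ℚ *ᵥ v ≠ 0 := by
    simp only [List.mem_append]
    rintro v ((hv | hv) | hv)
    exacts [hl₃ v hv, hl₂ v hv, hl₁ v hv]
  have hone : ((l₃ ++ l₂ ++ l₁).map (reflection (diagGram ℚ))).prod * ρ = 1 := by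
    rw [List.map_append, List.map_append, List.prod_append, List.prod_append, mul_assoc, mul_assoc]
    refine Matrix.ext_of_mulVec_single fun i => ?_
    rw [one_mulVec]
    fin_cases i
    exacts [c₃, d₃, m₃]
  refine ⟨(l₃ ++ l₂ ++ l₁).reverse, fun v hv => hl v (List.mem_reverse.mp hv), ?_⟩
  rw [← one_mul ρ, ← prod_reverse_reflections hl, mul_assoc, hone, mul_one]

lemma exists_rot_of_isometry {ρ : Matrix (Fin 3) (Fin 3) ℚ}
    (h : ρᵀ * diagGram ℚ * ρ = diagGram ℚ) (hdet : ρ.det = 1) :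
    ∃ w x y z : ℚ, qnorm w x y z ≠ 0 ∧ rot w x y z = qnorm w x y z • ρ := by
  obtain ⟨l, hl, rfl⟩ := exists_reflections_of_isometry h
  obtain ⟨w, x, y, z, h1, h2⟩ := exists_rot_of_reflections l hl
  have hq : qnorm w x y z ≠ 0 := by
    rw [h1]
    refine mul_ne_zero (by positivity) (List.prod_ne_zero fun h0 => ?_)
    obtain ⟨v, hv, hv0⟩ := List.mem_map.mp h0
    exact hl v hv hv0
  refine ⟨w, x, y, z, hq, ?_⟩
  rcases neg_one_pow_eq_or ℚ l.length with he | he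
  · rwa [he, one_mul] at h2
  · -- an odd number of reflections has determinant `-1`
    have h3 := congrArg det h2
    rw [det_rot, det_smul, hdet, he, mul_one, Fintype.card_fin] at h3
    have h4 : qnorm w x y z ^ 3 = 0 := by linarith
    exact absurd (pow_eq_zero_iff (by norm_num) |>.mp h4) hq

/-! ### Local quaternions attached to a spinor equivalence -/

/-- Every quaternion of nonzero norm over `ℚ_p` is a multiple of one with coordinates in `ℤ_p`,
one of them equal to `1`. -/
lemma exists_primitive (p : ℕ) [Fact p.Prime] (w x y z : ℚ_[p]) (h : qnorm w x y z ≠ 0) :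
    ∃ (c : ℚ_[p]) (w' x' y' z' : ℤ_[p]), c ≠ 0 ∧ (w' = 1 ∨ x' = 1 ∨ y' = 1 ∨ z' = 1) ∧
      w = c * w' ∧ x = c * x' ∧ y = c * y' ∧ z = c * z' := by
  obtain ⟨i, hi⟩ := Finite.exists_max fun j => ‖(![w, x, y, z] : Fin 4 → ℚ_[p]) j‖
  set v : Fin 4 → ℚ_[p] := ![w, x, y, z] with hv
  have hi0 : v i ≠ 0 := by
    intro h0
    have h1 : ∀ j, v j = 0 := fun j => by simpa [h0] using hi j
    have e0 : w = 0 := h1 0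
    have e1 : x = 0 := h1 1
    have e2 : y = 0 := h1 2
    have e3 : z = 0 := h1 3
    exact h (by simp [qnorm, e0, e1, e2, e3])
  have hn : ∀ j, ‖v j / v i‖ ≤ 1 := by
    intro j
    rw [norm_div]
    exact div_le_one_of_le₀ (hi j) (norm_nonneg _)
  let u : Fin 4 → ℤ_[p] := fun j => ⟨v j / v i, hn j⟩
  refine ⟨v i, u 0, u 1, u 2, u 3, hi0, ?_, ?_⟩
  · have : u i = 1 :=
      PadicInt.ext ((div_self hi0).trans PadicInt.coe_one.symm)
    fin_cases i
    exacts [Or.inl this, Or.inr (Or.inl this), Or.inr (Or.inr (Or.inl this)),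
      Or.inr (Or.inr (Or.inr this))]
  · exact ⟨(mul_div_cancel₀ _ hi0).symm, (mul_div_cancel₀ _ hi0).symm,
      (mul_div_cancel₀ _ hi0).symm, (mul_div_cancel₀ _ hi0).symm⟩

lemma exists_int_quaternion {ρ : Matrix (Fin 3) (Fin 3) ℚ} (h : ∃ w x y z : ℚ,
      qnorm w x y z ≠ 0 ∧ rot w x y z = qnorm w x y z • ρ) :
    ∃ w x y z : ℤ, qnorm w x y z ≠ 0 ∧
      rot (w : ℚ) x y z = ((qnorm w x y z : ℤ) : ℚ) • ρ := by
  obtain ⟨w, x, y, z, hq, h⟩ := h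
  set d : ℚ := w.den * x.den * y.den * z.den with hd
  have hd0 : d ≠ 0 := by simp [hd]
  have ew : ((w.num * x.den * y.den * z.den : ℤ) : ℚ) = d * w := by
    push_cast
    rw [← Rat.mul_den_eq_num w, hd]
    ring
  have ex : ((w.den * x.num * y.den * z.den : ℤ) : ℚ) = d * x := by
    push_cast
    rw [← Rat.mul_den_eq_num x, hd]
    ring
  have ey : ((w.den * x.den * y.num * z.den : ℤ) : ℚ) = d * y := by
    push_cast
    rw [← Rat.mul_den_eq_num y, hd]
    ring
  have ez : ((w.den * x.den * y.den * z.num : ℤ) : ℚ) = d * z := by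
    push_cast
    rw [← Rat.mul_den_eq_num z, hd]
    ring
  have hcast : ∀ w x y z : ℤ, ((qnorm w x y z : ℤ) : ℚ) = qnorm (w : ℚ) x y z := fun w x y z =>
    qnorm_map (Int.castRingHom ℚ) w x y z
  refine ⟨w.num * x.den * y.den * z.den, w.den * x.num * y.den * z.den,
    w.den * x.den * y.num * z.den, w.den * x.den * y.den * z.num, fun h0 => ?_, ?_⟩
  · have h1 := congrArg (fun a : ℤ => (a : ℚ)) h0
    simp only [hcast, ew, ex, ey, ez, qnorm_smul, Int.cast_zero] at h1
    exact mul_ne_zero (pow_ne_zero 2 hd0) hq h1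
  · rw [hcast, ew, ex, ey, ez, rot_smul, h, qnorm_smul, smul_smul]

/-- Let `L` and `K` be embedded in the quadratic space `κ (x² + y² + 5 z²)` by the matrices `P` and
`R`. If `K` lies in the spinor genus of `L`, there is a positive integer `c`, the norm of a rational
quaternion, which at every prime `p` is up to squares the norm of a quaternion inducing a map from
`R ℤ_p³` onto `P ℤ_p³`. -/
theorem exists_norm_of_mem_spn {L K : TernaryLattice} {κ : ℚ} (hκ : κ ≠ 0)
    {P P' R R' : Matrix (Fin 3) (Fin 3) ℚ} (hP : κ • (Pᵀ * diagGram ℚ * P) = L.gram)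
    (hR : κ • (Rᵀ * diagGram ℚ * R) = K.gram) (hPP' : P * P' = 1) (hRR' : R * R' = 1)
    (h : K ∈ spn L) :
    ∃ c : ℕ, c ≠ 0 ∧ ∀ (p : ℕ) [Fact p.Prime], ∃ (a : ℚ_[p]) (w x y z : ℤ_[p])
      (U : Matrix (Fin 3) (Fin 3) ℤ_[p]), (w = 1 ∨ x = 1 ∨ y = 1 ∨ z = 1) ∧
      (c : ℚ_[p]) = a ^ 2 * (qnorm w x y z : ℤ_[p]) ∧
      (PadicInt.Coe.ringHom (p := p)).mapMatrix (rot w x y z) =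
        ((qnorm w x y z : ℤ_[p]) : ℚ_[p]) •
          (ratMat p P * (PadicInt.Coe.ringHom (p := p)).mapMatrix U * ratMat p R') := by
  obtain ⟨T, hT, hloc⟩ := mem_spn_iff.mp h
  have hP'P : P' * P = 1 := mul_eq_one_comm.mp hPP'
  have hR'R : R' * R = 1 := mul_eq_one_comm.mp hRR'
  -- the global isometry of the ambient space
  have hiso : (P * T.1 * R')ᵀ * diagGram ℚ * (P * T.1 * R') = diagGram ℚ := by
    have h1 : T.1ᵀ * (Pᵀ * diagGram ℚ * P) * T.1 = Rᵀ * diagGram ℚ * R := by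
      rw [← hP, ← hR, Matrix.mul_smul, Matrix.smul_mul] at hT
      exact smul_right_injective _ hκ hT
    calc _ = R'ᵀ * (T.1ᵀ * (Pᵀ * diagGram ℚ * P) * T.1) * R' := by
          simp only [transpose_mul, Matrix.mul_assoc]
      _ = (R * R')ᵀ * diagGram ℚ * (R * R') := by
          rw [h1]
          simp only [transpose_mul, Matrix.mul_assoc]
      _ = _ := by rw [hRR']; simp
  obtain ⟨ε, hε, hdet⟩ : ∃ ε : ℤ, ε * ε = 1 ∧ ((ε : ℚ) • (P * T.1 * R')).det = 1 := by
    have h1 := congrArg det hiso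
    rw [det_mul, det_mul, det_transpose] at h1
    have h2 : (diagGram ℚ).det = 5 := by simp [diagGram, det_fin_three]
    rw [h2] at h1
    have h3 : ((P * T.1 * R').det - 1) * ((P * T.1 * R').det + 1) = 0 := by linarith
    rcases mul_eq_zero.mp h3 with h4 | h4
    · exact ⟨1, by norm_num, by rw [Int.cast_one, one_smul]; linarith⟩
    · refine ⟨-1, by norm_num, ?_⟩
      rw [det_smul, Fintype.card_fin, eq_neg_of_add_eq_zero_left h4]
      norm_num
  have hεq : (ε : ℚ) * ε = 1 := by exact_mod_cast hε
  have hiso' : ((ε : ℚ) • (P * T.1 * R'))ᵀ * diagGram ℚ * ((ε : ℚ) • (P * T.1 * R')) =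
      diagGram ℚ := by
    rw [transpose_smul, Matrix.smul_mul, Matrix.smul_mul, Matrix.mul_smul, hiso, smul_smul, hεq,
      one_smul]
  obtain ⟨w, x, y, z, hq, hrot⟩ := exists_int_quaternion (exists_rot_of_isometry hiso' hdet)
  have hqpos : 0 < qnorm w x y z := lt_of_le_of_ne (by rw [qnorm]; positivity) hq.symm
  refine ⟨(qnorm w x y z).toNat, by omega, fun p _ => ?_⟩
  obtain ⟨σ, hσ, U, hU⟩ := hloc p
  obtain ⟨τ, hτ, hτσ⟩ := exists_inv_mem_spinorKernel hσ
  have hκp : ((κ : ℚ) : ℚ_[p]) ≠ 0 := by exact_mod_cast hκ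
  -- transport of the local rotation to the ambient space
  have hτ' : ratMat p P * τ * ratMat p P' ∈ spinorKernel (diagGram ℚ_[p]) := by
    have h1 : (ratMat p P)ᵀ * (diagGram ℚ_[p]) * ratMat p P =
        ((κ : ℚ) : ℚ_[p])⁻¹ • localGram p L := by
      have h2 : ratMat p (diagGram ℚ) = diagGram ℚ_[p] := by
        ext i j
        fin_cases i <;> fin_cases j <;> simp [ratMat, diagGram]
      rw [← ratMat_gram, ← hP, ← h2, ← ratMat_transpose, ← ratMat_mul, ← ratMat_mul]
      ext i j
      simp [ratMat, hκp]
    refine conj_mem_spinorKernel h1 (by rw [← ratMat_mul, hPP', ratMat_one]) ?_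
    obtain ⟨l, l1, l2, rfl, l4⟩ := hτ
    have hq : ∀ v : Fin 3 → ℚ_[p], v ⬝ᵥ ((((κ : ℚ) : ℚ_[p])⁻¹ • localGram p L) *ᵥ v) =
        ((κ : ℚ) : ℚ_[p])⁻¹ * (v ⬝ᵥ localGram p L *ᵥ v) := by
      intro v
      rw [smul_mulVec, dotProduct_smul, smul_eq_mul]
    refine ⟨l, l1, fun v hv => ?_, ?_, ?_⟩
    · rw [hq]
      exact mul_ne_zero (inv_ne_zero hκp) (l2 v hv)
    · congr 1
      refine List.map_congr_left fun v hv => ?_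
      rw [reflection, reflection, hq, smul_mulVec, vecMulVec_smul, smul_smul]
      congr 2
      have := l2 v hv
      field_simp
    · obtain ⟨k, hk⟩ := l1
      obtain ⟨r, hr⟩ := l4
      refine ⟨(((κ : ℚ) : ℚ_[p])⁻¹) ^ k * r, ?_⟩
      simp only [hq]
      rw [List.prod_map_mul, hr, List.map_const', List.prod_replicate, hk]
      ring
  obtain ⟨w₁, x₁, y₁, z₁, hn₁, hr₁⟩ := exists_rot_of_mem_spinorKernel hτ'
  have hprod : ratMat p P * τ * ratMat p P' * ratMat p ((ε : ℚ) • (P * T.1 * R')) =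
      ratMat p P * ((ε : ℚ_[p]) • localUnit p U) * ratMat p R' := by
    have h1 : ratMat p ((ε : ℚ) • (P * T.1 * R')) =
        (ε : ℚ_[p]) • (ratMat p P * ratMat p T.1 * ratMat p R') := by
      rw [← ratMat_mul, ← ratMat_mul]
      ext i j
      simp [ratMat]
    have h2 : ratMat p P' * ratMat p P = 1 := by rw [← ratMat_mul, hP'P, ratMat_one]
    rw [h1, hU, Matrix.mul_smul, Matrix.mul_smul, Matrix.smul_mul]
    congr 1
    calc _ = ratMat p P * τ * (ratMat p P' * ratMat p P) * σ * localUnit p U * ratMat p R' := by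
          simp only [Matrix.mul_assoc]
      _ = ratMat p P * (τ * σ) * localUnit p U * ratMat p R' := by
          rw [h2]
          simp only [Matrix.mul_assoc, Matrix.one_mul]
      _ = _ := by rw [hτσ, Matrix.mul_one]
  have hrot' : rot (w : ℚ_[p]) x y z =
      ((qnorm w x y z : ℤ) : ℚ_[p]) • ratMat p ((ε : ℚ) • (P * T.1 * R')) := by
    have h1 := congrArg (Rat.castHom ℚ_[p]).mapMatrix hrot
    rw [rot_map] at h1
    simp only [map_intCast] at h1
    rw [h1]
    ext i j
    simp [ratMat]
  have hqc : ((qnorm w x y z : ℤ) : ℚ_[p]) = qnorm (w : ℚ_[p]) x y z :=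
    qnorm_map (Int.castRingHom ℚ_[p]) w x y z
  have hq' : qnorm (w : ℚ_[p]) x y z ≠ 0 := by
    rw [← hqc]
    exact_mod_cast hq
  have hrotmul := rot_mul w₁ x₁ y₁ z₁ (w : ℚ_[p]) x y z
  have hqmul := qnorm_mul w₁ x₁ y₁ z₁ (w : ℚ_[p]) x y z
  rw [hn₁, one_mul] at hqmul
  rw [← hr₁, hrot', Matrix.mul_smul, hprod, hqc, hqmul] at hrotmul
  have hq'' := hq'
  rw [hqmul] at hq''
  have hc : (((qnorm w x y z).toNat : ℕ) : ℚ_[p]) = qnorm (w : ℚ_[p]) x y z := by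
    rw [← hqc]
    have : (((qnorm w x y z).toNat : ℕ) : ℤ) = qnorm w x y z := Int.toNat_of_nonneg hqpos.le
    exact_mod_cast congrArg (fun a : ℤ => (a : ℚ_[p])) this
  rw [hc, hqmul]
  obtain ⟨a, w', x', y', z', ha, hprim, ew, ex, ey, ez⟩ := exists_primitive p _ _ _ _ hq''
  rw [ew, ex, ey, ez, rot_smul, qnorm_smul, mul_smul] at hrotmul
  rw [ew, ex, ey, ez, qnorm_smul]
  have hqz : ((qnorm w' x' y' z' : ℤ_[p]) : ℚ_[p]) = qnorm (w' : ℚ_[p]) x' y' z' :=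
    qnorm_map (PadicInt.Coe.ringHom (p := p)) w' x' y' z'
  refine ⟨a, w', x', y', z', (ε : ℤ_[p]) • U.1, hprim, by rw [hqz], ?_⟩
  rw [rot_map, hqz]
  refine (smul_right_injective _ (pow_ne_zero 2 ha) hrotmul).symm.trans ?_
  congr 3

/-! ### Norms of primitive quaternions modulo squares -/

section PadicSquares

variable {p : ℕ} [Fact p.Prime]

lemma exists_eq_mul_of_not_isUnit {a : ℤ_[p]} (h : ¬ IsUnit a) : ∃ b, a = p * b := by
  rw [PadicInt.not_isUnit_iff, PadicInt.norm_lt_one_iff_dvd] at h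
  exact h

lemma toZMod_ne_zero {a : ℤ_[p]} (h : IsUnit a) : PadicInt.toZMod a ≠ 0 :=
  (h.map PadicInt.toZMod).ne_zero

lemma isUnit_of_toZMod_ne_zero {a : ℤ_[p]} (h : PadicInt.toZMod a ≠ 0) : IsUnit a := by
  by_contra hn
  obtain ⟨b, rfl⟩ := exists_eq_mul_of_not_isUnit hn
  simp at h

/-- If `c = a² pᵉ n` with a unit `n`, then `e` has the parity of the exponent of `p` in `c`, and
`n` is, up to the square of a unit, the part of `c` prime to `p`. -/
lemma factorization_of_eq_sq_mul {c : ℕ} (hc : c ≠ 0) {a : ℚ_[p]} {e : ℕ} {n : ℤ_[p]}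
    (hn : IsUnit n) (h : (c : ℚ_[p]) = a ^ 2 * ((p ^ e * n : ℤ_[p]) : ℚ_[p])) :
    c.factorization p % 2 = e % 2 ∧
      ∃ μ : ℤ_[p], IsUnit μ ∧ ((ordCompl[p] c : ℕ) : ℤ_[p]) = μ ^ 2 * n := by
  have hp : p.Prime := Fact.out
  have hp0 : (p : ℚ_[p]) ≠ 0 := by exact_mod_cast hp.ne_zero
  have hc0 : (c : ℚ_[p]) ≠ 0 := by exact_mod_cast hc
  have ha : a ≠ 0 := by
    rintro rfl
    apply hc0
    rw [h]
    ring
  have hn0 : (n : ℚ_[p]) ≠ 0 := fun h0 => hn.ne_zero (PadicInt.ext h0)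
  have hnv : (n : ℚ_[p]).valuation = 0 := by
    have h1 : ‖(n : ℚ_[p])‖ = 1 := PadicInt.isUnit_iff.mp hn
    have h2 := Padic.norm_eq_zpow_neg_valuation hn0
    rw [h1] at h2
    have h3 := (zpow_eq_one_iff_right₀ (by positivity) (by exact_mod_cast hp.ne_one)).mp h2.symm
    omega
  push_cast at h
  have hval : (c.factorization p : ℤ) = 2 * a.valuation + e := by
    have h1 := congrArg Padic.valuation h
    rw [Padic.valuation_mul (pow_ne_zero _ ha) (mul_ne_zero (pow_ne_zero _ hp0) hn0),
      Padic.valuation_mul (pow_ne_zero _ hp0) hn0, Padic.valuation_pow, Padic.valuation_pow, hnv,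
      Padic.valuation_natCast] at h1
    rw [Nat.factorization_def _ hp, h1]
    simp
  refine ⟨by omega, ?_⟩
  have hμ : ‖a * (p : ℚ_[p]) ^ (-a.valuation)‖ = 1 := by
    rw [norm_mul, Padic.norm_p_zpow, Padic.norm_eq_zpow_neg_valuation ha, ← zpow_add₀
      (by exact_mod_cast hp.ne_zero)]
    simp
  obtain ⟨μ, hμa⟩ : ∃ μ : ℤ_[p], (μ : ℚ_[p]) = a * (p : ℚ_[p]) ^ (-a.valuation) :=
    ⟨⟨_, hμ.le⟩, rfl⟩
  refine ⟨μ, PadicInt.isUnit_iff.mpr (by rw [PadicInt.norm_def, hμa, hμ]), ?_⟩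
  apply PadicInt.ext
  have h2 : (c : ℚ_[p]) = p ^ c.factorization p * (ordCompl[p] c : ℕ) := by
    exact_mod_cast (Nat.ordProj_mul_ordCompl_eq_self c p).symm
  have h3 : (p : ℚ_[p]) ^ c.factorization p = p ^ e * (p ^ a.valuation) ^ 2 := by
    rw [← zpow_natCast, hval, zpow_add₀ hp0, zpow_natCast, mul_comm, mul_comm 2, _root_.zpow_mul]
    norm_cast
  push_cast
  have h4 : (p : ℚ_[p]) ^ a.valuation ≠ 0 := zpow_ne_zero _ hp0
  rw [h2, h3] at h
  rw [hμa, _root_.zpow_neg]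
  apply mul_left_cancel₀ (mul_ne_zero (pow_ne_zero e hp0) (pow_ne_zero 2 h4))
  rw [h]
  field_simp

lemma isUnit_three_add (k : ℤ_[2]) : IsUnit (3 + 4 * k) := by
  apply isUnit_of_toZMod_ne_zero
  rw [map_add, map_mul, map_ofNat, map_ofNat]
  generalize PadicInt.toZMod k = r
  revert r
  decide

lemma sq_of_isUnit_zmod_four (a : ZMod 4) (h : IsUnit a) : a ^ 2 = 1 := by
  revert a; decide

lemma sq_of_isUnit_zmod_sixteen (a : ZMod 16) (h : IsUnit a) : a ^ 2 = 1 ∨ a ^ 2 = 9 := by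
  revert a; decide

/-- The squares of units of `ℤ_2` are `1` modulo `4`, so the residue `3` of the norm
survives in `c`. -/
lemma ordCompl_two_of_eq_sq_mul {c : ℕ} (hc : c ≠ 0) {a : ℚ_[2]} {e : ℕ} {k : ℤ_[2]}
    (h : (c : ℚ_[2]) = a ^ 2 * ((2 ^ e * (3 + 4 * k) : ℤ_[2]) : ℚ_[2])) :
    c.factorization 2 % 2 = e % 2 ∧ ((ordCompl[2] c : ℕ) : ZMod 4) = 3 := by
  obtain ⟨h1, μ, hμ, h2⟩ := factorization_of_eq_sq_mul hc (isUnit_three_add k) h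
  refine ⟨h1, ?_⟩
  let f : ℤ_[2] →+* ZMod 4 := PadicInt.toZModPow 2
  have h3 := congrArg f h2
  rw [map_natCast] at h3
  rw [h3, map_mul, map_pow, map_add, map_mul, map_ofNat, map_ofNat,
    sq_of_isUnit_zmod_four _ (hμ.map f), show (4 : ZMod 4) = 0 from rfl]
  ring

instance fact_prime_five : Fact (Nat.Prime 5) := ⟨by norm_num⟩

/-- The squares of units of `ℤ_5` are `±1` modulo `5`. -/
lemma ordCompl_five_of_eq_sq_mul {c : ℕ} (hc : c ≠ 0) {a : ℚ_[5]} {e : ℕ} {n : ℤ_[5]}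
    (hn : PadicInt.toZMod n = 1 ∨ PadicInt.toZMod n = 4)
    (h : (c : ℚ_[5]) = a ^ 2 * ((5 ^ e * n : ℤ_[5]) : ℚ_[5])) :
    ((ordCompl[5] c : ℕ) : ZMod 5) = 1 ∨ ((ordCompl[5] c : ℕ) : ZMod 5) = 4 := by
  have hu : IsUnit n := by
    apply isUnit_of_toZMod_ne_zero
    rcases hn with hn | hn <;> rw [hn] <;> decide
  obtain ⟨-, μ, hμ, h2⟩ := factorization_of_eq_sq_mul hc hu h
  have h3 := congrArg PadicInt.toZMod h2
  rw [map_natCast, map_mul, map_pow] at h3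
  rw [h3]
  have h4 := toZMod_ne_zero hμ
  revert hn h4
  generalize PadicInt.toZMod μ = r
  generalize PadicInt.toZMod n = s
  revert r s
  decide

/-- A primitive quaternion whose associated rotation has its diagonal in `k⁻¹ ℤ_p` has unit norm
if `p` does not divide `10 k`. -/
lemma isUnit_qnorm {k : ℕ} (hk : ¬ p ∣ k) (h10 : ¬ p ∣ 10) {w x y z a b d : ℤ_[p]}
    (hprim : w = 1 ∨ x = 1 ∨ y = 1 ∨ z = 1)
    (h₁ : k * (w ^ 2 + 5 * x ^ 2 - 5 * y ^ 2 - z ^ 2) = qnorm w x y z * a)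
    (h₂ : k * (w ^ 2 - 5 * x ^ 2 + 5 * y ^ 2 - z ^ 2) = qnorm w x y z * b)
    (h₃ : k * (w ^ 2 - 5 * x ^ 2 - 5 * y ^ 2 + z ^ 2) = qnorm w x y z * d) :
    IsUnit (qnorm w x y z) := by
  apply isUnit_of_toZMod_ne_zero
  intro h0
  have hk' : (k : ZMod p) ≠ 0 := by rwa [Ne, ZMod.natCast_eq_zero_iff]
  have h10' : (10 : ZMod p) ≠ 0 := by
    have := (ZMod.natCast_eq_zero_iff 10 p).not.mpr h10
    exact_mod_cast this
  have e1 := congrArg PadicInt.toZMod h₁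
  have e2 := congrArg PadicInt.toZMod h₂
  have e3 := congrArg PadicInt.toZMod h₃
  rw [map_mul, map_mul, h0, zero_mul, map_natCast, mul_eq_zero, or_iff_right hk'] at e1 e2 e3
  rw [qnorm] at h0
  simp only [map_add, map_sub, map_mul, map_pow, map_ofNat] at e1 e2 e3 h0
  have h2 : (2 : ZMod p) ≠ 0 := fun h => h10' (by linear_combination 5 * h)
  have h5 : (5 : ZMod p) ≠ 0 := fun h => h10' (by linear_combination 2 * h)
  have h4 : (4 : ZMod p) ≠ 0 := by
    rw [show (4 : ZMod p) = 2 * 2 by norm_num]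
    exact mul_ne_zero h2 h2
  have h20 : (20 : ZMod p) ≠ 0 := by
    rw [show (20 : ZMod p) = 4 * 5 by norm_num]
    exact mul_ne_zero h4 h5
  rcases hprim with rfl | rfl | rfl | rfl <;> rw [map_one] at e1 e2 e3 h0
  · exact h4 (by linear_combination h0 + e1 + e2 + e3)
  · exact h20 (by linear_combination h0 + e1 - e2 - e3)
  · exact h20 (by linear_combination h0 - e1 + e2 - e3)
  · exact h4 (by linear_combination h0 - e1 - e2 + e3)

end PadicSquares

/-- If every prime power exactly dividing `m` has its residue in `H`, so has `m`. -/
lemma natCast_mem_of_factorization {n : ℕ} (H : Submonoid (ZMod n)) {m : ℕ} (hm : m ≠ 0)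
    (h : ∀ p : ℕ, p.Prime → p ∣ m → ((p : ZMod n) ^ m.factorization p) ∈ H) :
    (m : ZMod n) ∈ H := by
  rw [← Nat.prod_factorization_pow_eq_self hm, Finsupp.prod, Nat.cast_prod]
  refine Submonoid.prod_mem _ fun p hp => ?_
  rw [Nat.cast_pow]
  exact h p (Nat.prime_of_mem_primeFactors hp) (Nat.dvd_of_mem_primeFactors hp)

/-! ### The two spinor genera of `M₁` -/

/-- `M₁` lies on the space `⟨1, 1, 5⟩` scaled by `5`. -/
lemma M₁_gram : (5 : ℚ) • ((!![0, 2, 0; 0, 0, 4; 1/5, 0, 0] : Matrix (Fin 3) (Fin 3) ℚ)ᵀ *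
    diagGram ℚ * !![0, 2, 0; 0, 0, 4; 1/5, 0, 0]) = M₁.gram := by
  ext i j
  fin_cases i <;> fin_cases j <;>
    simp [M₁, sextuple, diagGram, mul_apply, Fin.sum_univ_three] <;> norm_num

/-- `M₄` lies on the space `⟨1, 1, 5⟩` scaled by `5`. -/
lemma M₄_gram : (5 : ℚ) • ((!![0, 1, 0; 0, 0, 4; 2/5, 0, 0] : Matrix (Fin 3) (Fin 3) ℚ)ᵀ *
    diagGram ℚ * !![0, 1, 0; 0, 0, 4; 2/5, 0, 0]) = M₄.gram := by
  ext i j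
  fin_cases i <;> fin_cases j <;>
    simp [M₄, sextuple, diagGram, mul_apply, Fin.sum_univ_three] <;> norm_num

/-- The shape of the local quaternions that would place `M₄` in the spinor genus of `M₁`. -/
lemma exists_norm_of_M₄_mem_spn (h : M₄ ∈ spn M₁) :
    ∃ c : ℕ, c ≠ 0 ∧ ∀ (p : ℕ) [Fact p.Prime], ∃ (a : ℚ_[p]) (w x y z b₁ b₂ b₃ b₄ b₅ : ℤ_[p]),
      (w = 1 ∨ x = 1 ∨ y = 1 ∨ z = 1) ∧ (c : ℚ_[p]) = a ^ 2 * (qnorm w x y z : ℤ_[p]) ∧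
      w ^ 2 + 5 * x ^ 2 - 5 * y ^ 2 - z ^ 2 = 2 * qnorm w x y z * b₁ ∧
      5 * x * y + w * z = 2 * qnorm w x y z * b₂ ∧
      w ^ 2 - 5 * x ^ 2 + 5 * y ^ 2 - z ^ 2 = qnorm w x y z * b₃ ∧
      y * z - w * x = qnorm w x y z * b₄ ∧
      2 * (w ^ 2 - 5 * x ^ 2 - 5 * y ^ 2 + z ^ 2) = qnorm w x y z * b₅ := by
  obtain ⟨c, hc, hloc⟩ := exists_norm_of_mem_spn (by norm_num) M₁_gram M₄_gram
    (P' := !![0, 0, 5; 1/2, 0, 0; 0, 1/4, 0]) (R' := !![0, 0, 5/2; 1, 0, 0; 0, 1/4, 0])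
    (by ext i j; fin_cases i <;> fin_cases j <;> simp [mul_apply, Fin.sum_univ_three])
    (by ext i j; fin_cases i <;> fin_cases j <;> simp [mul_apply, Fin.sum_univ_three]) h
  refine ⟨c, hc, fun p _ => ?_⟩
  obtain ⟨a, w, x, y, z, U, hprim, hca, hrot⟩ := hloc p
  refine ⟨a, w, x, y, z, U 1 1, U 2 1, U 2 2, U 2 0, U 0 0, hprim, hca, ?_⟩
  have e11 := congrFun₂ hrot 0 0
  have e21 := congrFun₂ hrot 1 0
  have e22 := congrFun₂ hrot 1 1
  have e23 := congrFun₂ hrot 1 2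
  have e33 := congrFun₂ hrot 2 2
  have hcoe : ∀ r : ℤ_[p], (r : ℚ_[p]) = PadicInt.Coe.ringHom r := fun _ => rfl
  simp [rot, ratMat, mul_apply, Fin.sum_univ_three, hcoe, map_ofNat] at e11 e21 e22 e23 e33
  refine ⟨?_, ?_, ?_, ?_, ?_⟩ <;> apply PadicInt.ext <;>
    simp only [hcoe, map_add, map_sub, map_mul, map_pow, map_ofNat]
  · linear_combination e11
  · linear_combination e21 / 2
  · linear_combination e22
  · linear_combination e23 / 10
  · linear_combination 2 * e33

/-- At `2`, the quaternions of `exists_norm_of_M₄_mem_spn` have norm `≡ 6` modulo `8`. -/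
lemma qnorm_zmod_eight (w x y z b₁ b₂ b₄ : ZMod 8) (hprim : w = 1 ∨ x = 1 ∨ y = 1 ∨ z = 1)
    (h : 4 * qnorm w x y z = 0)
    (h₁ : w ^ 2 + 5 * x ^ 2 - 5 * y ^ 2 - z ^ 2 = 2 * qnorm w x y z * b₁)
    (h₂ : 5 * x * y + w * z = 2 * qnorm w x y z * b₂)
    (h₄ : y * z - w * x = qnorm w x y z * b₄) : qnorm w x y z = 6 := by
  have aux : ∀ N b : ZMod 8, 4 * N = 0 → (2 * N * b = 0 ∨ 2 * N * b = 2 * N) ∧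
      (N * b = 0 ∨ N * b = N ∨ N * b = 2 * N ∨ N * b = 3 * N) := by decide
  have h₁' := (aux _ b₁ h).1
  have h₂' := (aux _ b₂ h).1
  have h₄' := (aux _ b₄ h).2
  rw [← h₁] at h₁'
  rw [← h₂] at h₂'
  rw [← h₄] at h₄'
  clear h₁ h₂ h₄ aux b₁ b₂ b₄
  revert w x y z
  unfold qnorm
  set_option synthInstance.maxSize 1000 in
  decide +kernel

theorem M₄_notMem_spn : M₄ ∉ spn M₁ := by
  intro h
  obtain ⟨c, hc, hloc⟩ := exists_norm_of_M₄_mem_spn h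
  -- away from `2` and `5` the exponents in `c` are even
  have heven : ∀ p : ℕ, p.Prime → ¬ p ∣ 10 → c.factorization p % 2 = 0 := by
    intro p hp h10
    have : Fact p.Prime := ⟨hp⟩
    obtain ⟨a, w, x, y, z, b₁, b₂, b₃, b₄, b₅, hprim, hca, h₁, h₂, h₃, h₄, h₅⟩ := hloc p
    have hk : ¬ p ∣ 2 := fun h => h10 (h.trans (by norm_num))
    have hu : IsUnit (qnorm w x y z) := isUnit_qnorm (k := 2) hk h10 (a := 4 * b₁) (b := 2 * b₃)
      (d := b₅) hprim (by push_cast; linear_combination 2 * h₁)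
      (by push_cast; linear_combination 2 * h₃) (by push_cast; linear_combination h₅)
    exact (factorization_of_eq_sq_mul hc hu (e := 0) (by rw [hca, pow_zero, one_mul])).1
  -- at `2`, the norm is `2 (3 + 4 k)`
  have htwo : ((ordCompl[2] c : ℕ) : ZMod 4) = 3 := by
    obtain ⟨a, w, x, y, z, b₁, b₂, b₃, b₄, b₅, hprim, hca, h₁, h₂, h₃, h₄, h₅⟩ := hloc 2
    let f : ℤ_[2] →+* ZMod 8 := PadicInt.toZModPow 3
    obtain ⟨m, hm⟩ : ∃ m, qnorm w x y z = 2 * m :=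
      ⟨qnorm w x y z * b₁ + 5 * y ^ 2 + z ^ 2, by rw [qnorm] at h₁ ⊢; linear_combination h₁⟩
    have hf : f (qnorm w x y z) = 6 := by
      have e1 := congrArg f h₁
      have e2 := congrArg f h₂
      have e4 := congrArg f h₄
      have e0 : 4 * f (qnorm w x y z) = 0 := by
        rw [hm, map_mul, map_ofNat, ← mul_assoc, show (4 * 2 : ZMod 8) = 0 from rfl, zero_mul]
      simp only [map_add, map_sub, map_mul, map_pow, map_ofNat] at e1 e2 e4
      rw [qnorm_map] at e0 e1 e2 e4 ⊢
      refine qnorm_zmod_eight _ _ _ _ (f b₁) (f b₂) (f b₄) ?_ e0 e1 e2 e4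
      rcases hprim with h | h | h | h <;> simp [h]
    obtain ⟨k, hk⟩ : ∃ k : ℤ_[2], qnorm w x y z - 6 = 8 * k := by
      have h0 : qnorm w x y z - 6 ∈ RingHom.ker (PadicInt.toZModPow (p := 2) 3) := by
        rw [RingHom.mem_ker, map_sub, map_ofNat]
        exact sub_eq_zero.mpr hf
      rw [PadicInt.ker_toZModPow, Ideal.mem_span_singleton] at h0
      obtain ⟨k, hk⟩ := h0
      exact ⟨k, by rw [hk]; norm_num⟩
    refine (ordCompl_two_of_eq_sq_mul hc (a := a) (e := 1) (k := k) ?_).2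
    rw [hca]
    congr 2
    linear_combination hk
  -- the part of `c` prime to `2` is a square times a power of `5`
  have hone : ((ordCompl[2] c : ℕ) : ZMod 4) ∈ (⊥ : Submonoid (ZMod 4)) := by
    refine natCast_mem_of_factorization _ (Nat.ordCompl_pos 2 hc).ne' fun p hp hpd => ?_
    have hp2 : p ≠ 2 := by
      rintro rfl
      exact Nat.not_dvd_ordCompl Nat.prime_two hc hpd
    rw [Submonoid.mem_bot]
    by_cases h5 : p = 5
    · subst h5
      exact one_pow _
    · have h10 : ¬ p ∣ 10 := fun h => by
        rcases (Nat.Prime.dvd_mul hp).mp (show p ∣ 2 * 5 from h) with h | h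
        · exact hp2 ((Nat.prime_dvd_prime_iff_eq hp Nat.prime_two).mp h)
        · exact h5 ((Nat.prime_dvd_prime_iff_eq hp (by norm_num)).mp h)
      have h0 : (ordCompl[2] c).factorization p = c.factorization p := by
        rw [Nat.factorization_ordCompl, Finsupp.erase_ne hp2]
      obtain ⟨t, ht⟩ := Nat.dvd_of_mod_eq_zero (heven p hp h10)
      have hu : IsUnit (p : ZMod 4) := by
        rw [ZMod.isUnit_iff_coprime]
        exact Nat.Coprime.pow_right 2 ((Nat.coprime_primes hp Nat.prime_two).mpr hp2)
      rw [h0, ht, pow_mul, sq_of_isUnit_zmod_four _ hu, one_pow]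
  rw [htwo, Submonoid.mem_bot] at hone
  exact absurd hone (by decide)

/-! ### The two spinor genera of `N₁` -/

/-- `N₃` lies on the space `⟨1, 1, 5⟩` scaled by `3`. -/
lemma N₃_gram : (3 : ℚ) • ((!![1, 0, 0; 0, 0, 20/3; 0, 2, 2/3] : Matrix (Fin 3) (Fin 3) ℚ)ᵀ *
    diagGram ℚ * !![1, 0, 0; 0, 0, 20/3; 0, 2, 2/3]) = N₃.gram := by
  ext i j
  fin_cases i <;> fin_cases j <;>
    simp [N₃, sextuple, diagGram, mul_apply, Fin.sum_univ_three] <;> norm_num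

/-- `N₇` lies on the space `⟨1, 1, 5⟩` scaled by `3`. -/
lemma N₇_gram : (3 : ℚ) • ((!![2, 2/3, 0; 0, 0, 5; 0, 4/3, 0] : Matrix (Fin 3) (Fin 3) ℚ)ᵀ *
    diagGram ℚ * !![2, 2/3, 0; 0, 0, 5; 0, 4/3, 0]) = N₇.gram := by
  ext i j
  fin_cases i <;> fin_cases j <;>
    simp [N₇, sextuple, diagGram, mul_apply, Fin.sum_univ_three] <;> norm_num

/-- The shape of the local quaternions that would place `N₇` in the spinor genus of `N₃`. -/
lemma exists_norm_of_N₇_mem_spn (h : N₇ ∈ spn N₃) :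
    ∃ c : ℕ, c ≠ 0 ∧ ∀ (p : ℕ) [Fact p.Prime], ∃ (a : ℚ_[p]) (w x y z b₁ b₂ b₃ b₄ b₅ : ℤ_[p]),
      (w = 1 ∨ x = 1 ∨ y = 1 ∨ z = 1) ∧ (c : ℚ_[p]) = a ^ 2 * (qnorm w x y z : ℤ_[p]) ∧
      2 * (w ^ 2 + 5 * x ^ 2 - 5 * y ^ 2 - z ^ 2) = qnorm w x y z * b₁ ∧
      3 * (5 * x * y + w * z) = 5 * qnorm w x y z * b₂ ∧
      3 * (w ^ 2 - 5 * x ^ 2 + 5 * y ^ 2 - z ^ 2) = 4 * qnorm w x y z * b₃ ∧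
      15 * (y * z + w * x) = qnorm w x y z * b₄ ∧
      12 * (w ^ 2 - 5 * x ^ 2 - 5 * y ^ 2 + z ^ 2) = qnorm w x y z * b₅ := by
  obtain ⟨c, hc, hloc⟩ := exists_norm_of_mem_spn (by norm_num) N₃_gram N₇_gram
    (P' := !![1, 0, 0; 0, -1/20, 1/2; 0, 3/20, 0])
    (R' := !![1/2, 0, -1/4; 0, 0, 3/4; 0, 1/5, 0])
    (by ext i j; fin_cases i <;> fin_cases j <;>
          simp [mul_apply, Fin.sum_univ_three] <;> norm_num)
    (by ext i j; fin_cases i <;> fin_cases j <;>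
          simp [mul_apply, Fin.sum_univ_three] <;> norm_num) h
  refine ⟨c, hc, fun p _ => ?_⟩
  obtain ⟨a, w, x, y, z, U, hprim, hca, hrot⟩ := hloc p
  refine ⟨a, w, x, y, z, U 0 0, U 2 0, U 2 2, 3 * U 1 2 + U 2 2,
    -6 * U 1 0 - 2 * U 2 0 + 18 * U 1 1 + 6 * U 2 1, hprim, hca, ?_⟩
  have e11 := congrFun₂ hrot 0 0
  have e21 := congrFun₂ hrot 1 0
  have e22 := congrFun₂ hrot 1 1
  have e32 := congrFun₂ hrot 2 1
  have e33 := congrFun₂ hrot 2 2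
  have hcoe : ∀ r : ℤ_[p], (r : ℚ_[p]) = PadicInt.Coe.ringHom r := fun _ => rfl
  simp [rot, ratMat, mul_apply, Fin.sum_univ_three, hcoe, map_ofNat] at e11 e21 e22 e32 e33
  refine ⟨?_, ?_, ?_, ?_, ?_⟩ <;> apply PadicInt.ext <;>
    simp only [hcoe, map_add, map_sub, map_mul, map_pow, map_neg, map_ofNat]
  · linear_combination 2 * e11
  · linear_combination 3 / 2 * e21
  · linear_combination 3 * e22
  · linear_combination 15 / 2 * e32
  · linear_combination 12 * e33

/-- At `2`, the quaternions of `exists_norm_of_N₇_mem_spn` have odd coordinates only. -/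
lemma coordinates_zmod_four (w x y z b₃ : ZMod 4) (hprim : w = 1 ∨ x = 1 ∨ y = 1 ∨ z = 1)
    (h : 2 * qnorm w x y z = 0) (h₂ : 2 * (5 * x * y + w * z) = 0)
    (h₃ : 3 * (w ^ 2 - 5 * x ^ 2 + 5 * y ^ 2 - z ^ 2) = 4 * qnorm w x y z * b₃)
    (h₄ : 2 * (y * z + w * x) = 0) :
    2 * w ≠ 0 ∧ 2 * x ≠ 0 ∧ 2 * y ≠ 0 ∧ 2 * z ≠ 0 := by
  rw [show (4 : ZMod 4) = 0 from rfl, zero_mul, zero_mul] at h₃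
  clear b₃
  revert w x y z
  unfold qnorm
  set_option synthInstance.maxSize 1000 in
  decide +kernel

lemma isUnit_of_two_mul_toZModPow_ne_zero {a : ℤ_[2]}
    (h : 2 * (PadicInt.toZModPow 2 : ℤ_[2] →+* ZMod 4) a ≠ 0) : IsUnit a := by
  by_contra hn
  obtain ⟨b, rfl⟩ := exists_eq_mul_of_not_isUnit hn
  apply h
  rw [map_mul, map_natCast, ← mul_assoc, show (2 * (2 : ℕ) : ZMod 4) = 0 from rfl, zero_mul]

/-- At `2`, the quaternions of `exists_norm_of_N₇_mem_spn` have norm `4 (3 + 4 k)`. -/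
lemma exists_qnorm_eq_two {w x y z b₂ b₃ b₄ : ℤ_[2]} (hprim : w = 1 ∨ x = 1 ∨ y = 1 ∨ z = 1)
    (h₂ : 3 * (5 * x * y + w * z) = 5 * qnorm w x y z * b₂)
    (h₃ : 3 * (w ^ 2 - 5 * x ^ 2 + 5 * y ^ 2 - z ^ 2) = 4 * qnorm w x y z * b₃)
    (h₄ : 15 * (y * z + w * x) = qnorm w x y z * b₄) :
    ∃ k, qnorm w x y z = 2 ^ 2 * (3 + 4 * k) := by
  let f : ℤ_[2] →+* ZMod 4 := PadicInt.toZModPow 2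
  let f' : ℤ_[2] →+* ZMod 16 := PadicInt.toZModPow 4
  obtain ⟨m, hm⟩ : ∃ m, qnorm w x y z = 2 * m :=
    ⟨2 * qnorm w x y z * b₃ + 15 * x ^ 2 + 3 * z ^ 2 - qnorm w x y z, by
      rw [qnorm] at h₃ ⊢
      linear_combination h₃⟩
  have h4 : (4 : ZMod 4) = 0 := rfl
  have e0 : 2 * f (qnorm w x y z) = 0 := by
    rw [hm, map_mul, map_ofNat, ← mul_assoc, show (2 * 2 : ZMod 4) = 0 from rfl, zero_mul]
  have e2 := congrArg f h₂
  have e3 := congrArg f h₃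
  have e4 := congrArg f h₄
  simp only [map_add, map_sub, map_mul, map_pow, map_ofNat] at e2 e3 e4
  have e2' : 2 * (5 * f x * f y + f w * f z) = 0 := by
    linear_combination (-2) * e2 - 5 * f b₂ * e0 + 2 * (5 * f x * f y + f w * f z) * h4
  have e4' : 2 * (f y * f z + f w * f x) = 0 := by
    linear_combination (-2) * e4 - f b₄ * e0 + 8 * (f y * f z + f w * f x) * h4
  rw [qnorm_map] at e0 e3
  obtain ⟨hw, hx, hy, hz⟩ := coordinates_zmod_four (f w) (f x) (f y) (f z) (f b₃)
    (by rcases hprim with h | h | h | h <;> simp [h]) e0 e2' e3 e4'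
  have sq : ∀ a : ℤ_[2], 2 * f a ≠ 0 → f' a ^ 2 = 1 ∨ f' a ^ 2 = 9 := fun a ha =>
    sq_of_isUnit_zmod_sixteen _ ((isUnit_of_two_mul_toZModPow_ne_zero ha).map f')
  obtain ⟨n, hn⟩ : ∃ n, f' (qnorm w x y z) = 4 * n := by
    rw [qnorm_map, qnorm]
    rcases sq w hw with e | e <;> rcases sq x hx with e' | e' <;> rcases sq y hy with e'' | e'' <;>
      rcases sq z hz with e''' | e''' <;> rw [e, e', e'', e'''] <;> decide
  have hf : f' (qnorm w x y z) = 12 := by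
    have e3 := congrArg f' h₃
    simp only [map_add, map_sub, map_mul, map_pow, map_ofNat] at e3
    rw [hn, ← mul_assoc, show (4 * 4 : ZMod 16) = 0 from rfl, zero_mul, zero_mul] at e3
    rw [qnorm_map, qnorm]
    clear hn
    rcases sq w hw with e | e <;> rcases sq x hx with e' | e' <;> rcases sq y hy with e'' | e'' <;>
      rcases sq z hz with e''' | e''' <;> rw [e, e', e'', e'''] at e3 ⊢ <;>
      first | rfl | exact absurd e3 (by decide)
  have h0 : qnorm w x y z - 12 ∈ RingHom.ker (PadicInt.toZModPow (p := 2) 4) := by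
    rw [RingHom.mem_ker, map_sub, map_ofNat]
    exact sub_eq_zero.mpr hf
  rw [PadicInt.ker_toZModPow, Ideal.mem_span_singleton] at h0
  obtain ⟨k, hk⟩ := h0
  refine ⟨k, ?_⟩
  push_cast at hk
  linear_combination hk

/-- At `5`, the quaternions of `exists_norm_of_N₇_mem_spn` have norm `5ᵉ n` with `n ≡ ±1`. -/
lemma exists_qnorm_eq_five {w x y z b₂ : ℤ_[5]} (hprim : w = 1 ∨ x = 1 ∨ y = 1 ∨ z = 1)
    (h₂ : 3 * (5 * x * y + w * z) = 5 * qnorm w x y z * b₂) :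
    ∃ e n, (PadicInt.toZMod n = 1 ∨ PadicInt.toZMod n = 4) ∧ qnorm w x y z = 5 ^ e * n := by
  have h5 : (5 : ZMod 5) = 0 := rfl
  have aux : ∀ a b : ZMod 5, 3 * (a * b) = 0 → a ^ 2 + b ^ 2 = 0 → a = 0 ∧ b = 0 := by decide
  have aux' : ∀ a b : ZMod 5, 3 * (a * b) = 0 → a ^ 2 + b ^ 2 ≠ 0 →
      a ^ 2 + b ^ 2 = 1 ∨ a ^ 2 + b ^ 2 = 4 := by decide
  have hdvd : ∀ a : ℤ_[5], PadicInt.toZMod a = 0 → ∃ b, a = 5 * b := by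
    intro a ha
    refine exists_eq_mul_of_not_isUnit (p := 5) fun hu => toZMod_ne_zero hu ha
  have hN : PadicInt.toZMod (qnorm w x y z) =
      PadicInt.toZMod w ^ 2 + PadicInt.toZMod z ^ 2 := by
    simp only [qnorm, map_add, map_mul, map_pow, map_ofNat, h5]
    ring
  have e2 : 3 * (PadicInt.toZMod w * PadicInt.toZMod z) = 0 := by
    have e2 := congrArg PadicInt.toZMod h₂
    simp only [map_add, map_mul, map_ofNat, h5, zero_mul, zero_add] at e2
    exact e2
  by_cases h0 : PadicInt.toZMod (qnorm w x y z) = 0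
  · obtain ⟨hw, hz⟩ := aux _ _ e2 (hN ▸ h0)
    obtain ⟨w, rfl⟩ := hdvd w hw
    obtain ⟨z, rfl⟩ := hdvd z hz
    refine ⟨1, 5 * w ^ 2 + x ^ 2 + y ^ 2 + 5 * z ^ 2, ?_, by rw [qnorm]; ring⟩
    have h₂' : 3 * (x * y + 5 * w * z) = qnorm (5 * w) x y (5 * z) * b₂ := by
      apply mul_left_cancel₀ (show (5 : ℤ_[5]) ≠ 0 by norm_num)
      linear_combination h₂
    have e3 := congrArg PadicInt.toZMod h₂'
    rw [map_mul, map_mul _ (qnorm _ _ _ _), h0, zero_mul] at e3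
    simp only [map_add, map_mul, map_pow, map_ofNat, h5, zero_mul, zero_add, add_zero] at e3 ⊢
    refine aux' _ _ e3 fun h => ?_
    obtain ⟨hx, hy⟩ := aux _ _ e3 h
    have h1 := map_one (PadicInt.toZMod (p := 5))
    rcases hprim with h | h | h | h
    · rw [← h, map_mul, map_ofNat, h5, zero_mul] at h1
      exact absurd h1 (by decide)
    · rw [← h, hx] at h1
      exact absurd h1 (by decide)
    · rw [← h, hy] at h1
      exact absurd h1 (by decide)
    · rw [← h, map_mul, map_ofNat, h5, zero_mul] at h1
      exact absurd h1 (by decide)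
  · refine ⟨0, _, ?_, (by rw [pow_zero, one_mul])⟩
    rw [hN] at h0 ⊢
    exact aux' _ _ e2 h0

/-- The residues modulo `20` of norms of ideals of `ℚ(√-5)` prime to `10`. -/
def normResidues : Submonoid (ZMod 20) where
  carrier := {1, 3, 7, 9}
  one_mem' := by simp
  mul_mem' := by
    intro a b ha hb
    revert a b
    simp only [Set.mem_insert_iff, Set.mem_singleton_iff]
    decide

lemma mem_normResidues {a : ZMod 20} : a ∈ normResidues ↔ a = 1 ∨ a = 3 ∨ a = 7 ∨ a = 9 :=
  Iff.rfl

lemma sq_mem_normResidues (a : ZMod 20) (h : IsUnit a) : a ^ 2 ∈ normResidues := by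
  rw [mem_normResidues]
  revert a
  decide

theorem N₇_notMem_spn : N₇ ∉ spn N₃ := by
  intro h
  obtain ⟨c, hc, hloc⟩ := exists_norm_of_N₇_mem_spn h
  -- away from `30` the exponents in `c` are even
  have heven : ∀ p : ℕ, p.Prime → ¬ p ∣ 30 → c.factorization p % 2 = 0 := by
    intro p hp h30
    have : Fact p.Prime := ⟨hp⟩
    obtain ⟨a, w, x, y, z, b₁, b₂, b₃, b₄, b₅, hprim, hca, h₁, h₂, h₃, h₄, h₅⟩ := hloc p
    have hk : ¬ p ∣ 12 := fun h => h30 <| by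
      have h1 : p ∣ 2 * 2 * 3 := h
      rcases hp.dvd_mul.mp h1 with h2 | h2
      · rcases hp.dvd_mul.mp h2 with h3 | h3 <;> exact h3.trans (by norm_num)
      · exact h2.trans (by norm_num)
    have hu : IsUnit (qnorm w x y z) := isUnit_qnorm (k := 12) hk
      (fun h => h30 (h.trans (by norm_num))) (a := 6 * b₁) (b := 16 * b₃) (d := b₅) hprim
      (by push_cast; linear_combination 6 * h₁) (by push_cast; linear_combination 4 * h₃)
      (by push_cast; linear_combination h₅)
    exact (factorization_of_eq_sq_mul hc hu (e := 0) (by rw [hca, pow_zero, one_mul])).1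
  have htwo : c.factorization 2 % 2 = 0 ∧ ((ordCompl[2] c : ℕ) : ZMod 4) = 3 := by
    obtain ⟨a, w, x, y, z, b₁, b₂, b₃, b₄, b₅, hprim, hca, h₁, h₂, h₃, h₄, h₅⟩ := hloc 2
    obtain ⟨k, hk⟩ := exists_qnorm_eq_two hprim h₂ h₃ h₄
    exact ordCompl_two_of_eq_sq_mul hc (e := 2) (by rw [hca, hk])
  have hfive : ((ordCompl[5] c : ℕ) : ZMod 5) = 1 ∨ ((ordCompl[5] c : ℕ) : ZMod 5) = 4 := by
    obtain ⟨a, w, x, y, z, b₁, b₂, b₃, b₄, b₅, hprim, hca, h₁, h₂, h₃, h₄, h₅⟩ := hloc 5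
    obtain ⟨e, n, hn, hk⟩ := exists_qnorm_eq_five hprim h₂
    exact ordCompl_five_of_eq_sq_mul hc hn (by rw [hca, hk])
  -- the part `r` of `c` prime to `10`
  have hc2 : ordCompl[2] c ≠ 0 := (Nat.ordCompl_pos 2 hc).ne'
  obtain ⟨r, hr⟩ : ∃ r, r = ordCompl[5] (ordCompl[2] c) := ⟨_, rfl⟩
  have hr0 : r ≠ 0 := by rw [hr]; exact (Nat.ordCompl_pos 5 hc2).ne'
  have hfac : ∀ p, p ≠ 2 → p ≠ 5 → r.factorization p = c.factorization p := by
    intro p h2 h5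
    rw [hr, Nat.factorization_ordCompl, Finsupp.erase_ne h5, Nat.factorization_ordCompl,
      Finsupp.erase_ne h2]
  have hc2r : ordCompl[2] c = 5 ^ (ordCompl[2] c).factorization 5 * r := by
    rw [hr, Nat.ordProj_mul_ordCompl_eq_self]
  have hf5 : (ordCompl[2] c).factorization 5 = c.factorization 5 := by
    rw [Nat.factorization_ordCompl, Finsupp.erase_ne (by norm_num)]
  have hc5r : ordCompl[5] c = 2 ^ c.factorization 2 * r := by
    apply Nat.eq_of_mul_eq_mul_left (show 0 < 5 ^ c.factorization 5 by positivity)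
    rw [Nat.ordProj_mul_ordCompl_eq_self, ← mul_assoc, mul_comm (5 ^ _), mul_assoc, ← hf5, ← hc2r,
      Nat.ordProj_mul_ordCompl_eq_self]
  have hr4 : (r : ZMod 4) = 3 := by
    rw [← htwo.2, hc2r, Nat.cast_mul, Nat.cast_pow, show ((5 : ℕ) : ZMod 4) = 1 from rfl, one_pow,
      one_mul]
  have hr5 : (r : ZMod 5) = 1 ∨ (r : ZMod 5) = 4 := by
    obtain ⟨t, ht⟩ := Nat.dvd_of_mod_eq_zero htwo.1
    rw [hc5r, Nat.cast_mul, Nat.cast_pow, ht, pow_mul,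
      show ((2 : ℕ) : ZMod 5) ^ 2 = -1 from rfl] at hfive
    rcases neg_one_pow_eq_or (ZMod 5) t with h1 | h1 <;> rw [h1] at hfive <;>
      revert hfive <;> generalize (r : ZMod 5) = s <;> revert s <;> decide
  -- `r` is a square times a power of `3`
  have hr20 : (r : ZMod 20) ∈ normResidues := by
    refine natCast_mem_of_factorization _ hr0 fun p hp hpd => ?_
    have hp5 : p ≠ 5 := by
      rintro rfl
      exact Nat.not_dvd_ordCompl hp hc2 (hr ▸ hpd)
    have hp2 : p ≠ 2 := by
      rintro rfl
      exact Nat.not_dvd_ordCompl hp hc (hpd.trans (hr ▸ Nat.ordCompl_dvd _ 5))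
    by_cases h3 : p = 3
    · subst h3
      exact pow_mem (by rw [mem_normResidues]; decide) _
    · have h30 : ¬ p ∣ 30 := fun h => by
        have h1 : p ∣ 2 * 3 * 5 := h
        rcases hp.dvd_mul.mp h1 with h2 | h2
        · rcases hp.dvd_mul.mp h2 with h4 | h4
          · exact hp2 ((Nat.prime_dvd_prime_iff_eq hp Nat.prime_two).mp h4)
          · exact h3 ((Nat.prime_dvd_prime_iff_eq hp Nat.prime_three).mp h4)
        · exact hp5 ((Nat.prime_dvd_prime_iff_eq hp Nat.prime_five).mp h2)
      obtain ⟨t, ht⟩ := Nat.dvd_of_mod_eq_zero (heven p hp h30)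
      have hu : IsUnit (p : ZMod 20) := by
        rw [ZMod.isUnit_iff_coprime]
        have h2 := (Nat.coprime_primes hp Nat.prime_two).mpr hp2
        exact (h2.mul_right h2).mul_right ((Nat.coprime_primes hp Nat.prime_five).mpr hp5)
      rw [hfac p hp2 hp5, ht, pow_mul]
      exact pow_mem (sq_mem_normResidues _ hu) t
  -- none of `1, 3, 7, 9` is `3` modulo `4` and `±1` modulo `5`
  have hcast4 := map_natCast (ZMod.castHom (show 4 ∣ 20 by norm_num) (ZMod 4)) r
  have hcast5 := map_natCast (ZMod.castHom (show 5 ∣ 20 by norm_num) (ZMod 5)) r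
  rw [hr4] at hcast4
  rw [← hcast5] at hr5
  rcases mem_normResidues.mp hr20 with h | h | h | h <;> rw [h] at hcast4 hr5 <;>
    revert hcast4 hr5 <;> decide

/-! ### Integers represented by the lattices -/

/-- The quadratic map of `L` takes the value `k`. -/
def Represents (L : TernaryLattice) (k : ℤ) : Prop :=
  ∃ v : Fin 3 → ℤ, (fun i => (v i : ℚ)) ⬝ᵥ L.gram *ᵥ (fun i => (v i : ℚ)) = (k : ℚ)

lemma Isometric.represents {L K : TernaryLattice} (h : Isometric L K) {k : ℤ}
    (hk : Represents K k) : Represents L k := by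
  obtain ⟨U, hU⟩ := h
  obtain ⟨v, hv⟩ := hk
  refine ⟨(U : Matrix (Fin 3) (Fin 3) ℤ) *ᵥ v, ?_⟩
  have h1 : (fun i => (((U : Matrix (Fin 3) (Fin 3) ℤ) *ᵥ v) i : ℚ)) =
      (U : Matrix (Fin 3) (Fin 3) ℤ).map (fun a : ℤ => (a : ℚ)) *ᵥ fun i => (v i : ℚ) := by
    ext i
    simp [mulVec, dotProduct]
  rw [← hv, ← hU, h1, ← mulVec_mulVec, ← mulVec_mulVec, dotProduct_mulVec _ _ᵀ, vecMul_transpose]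

/-- The value of the form with coefficients `q` at `(x, y, z)`. -/
def formEval (q : Fin 6 → ℤ) (x y z : ℤ) : ℤ :=
  q 0 * x ^ 2 + q 1 * y ^ 2 + q 2 * z ^ 2 + 2 * q 3 * y * z + 2 * q 4 * x * z + 2 * q 5 * x * y

/-- Whether the form with coefficients `q` takes the value `k` in the box
`|x| ≤ 5`, `|y| ≤ 3`, `|z| ≤ 1`. -/
def representsInBox (q : Fin 6 → ℤ) (k : ℤ) : Bool :=
  decide (∃ (x : Fin 11) (y : Fin 7) (z : Fin 3),
    formEval q ((x : ℕ) - 5) ((y : ℕ) - 3) ((z : ℕ) - 1) = k)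

/-- The first coordinate of a vector is bounded by its norm and the determinant: complete
squares. -/
lemma mul_sq_le_of_form {a b c s t u x y z : ℤ} (hb : 0 < b) (hm : 0 < b * c - s ^ 2) :
    (a * b * c + 2 * s * t * u - a * s ^ 2 - b * t ^ 2 - c * u ^ 2) * x ^ 2 ≤
      (b * c - s ^ 2) * (a * x ^ 2 + b * y ^ 2 + c * z ^ 2 + 2 * s * y * z + 2 * t * x * z
        + 2 * u * x * y) := by
  have h : b * ((b * c - s ^ 2) * (a * x ^ 2 + b * y ^ 2 + c * z ^ 2 + 2 * s * y * z
      + 2 * t * x * z + 2 * u * x * y)) =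
      b * ((a * b * c + 2 * s * t * u - a * s ^ 2 - b * t ^ 2 - c * u ^ 2) * x ^ 2) +
      ((b * c - s ^ 2) * (b * y + u * x + s * z) ^ 2 +
        ((b * c - s ^ 2) * z + (b * t - s * u) * x) ^ 2) := by ring
  have h' : 0 ≤ (b * c - s ^ 2) * (b * y + u * x + s * z) ^ 2 +
      ((b * c - s ^ 2) * z + (b * t - s * u) * x) ^ 2 := by positivity
  exact le_of_mul_le_mul_left (by linarith) hb

/-- The condition that the vectors of norm `k` lie in the box of `representsInBox`. -/
def BoxBound (q : Fin 6 → ℤ) (k : ℤ) : Prop :=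
  0 < q 0 ∧ 0 < q 1 ∧ 0 < q 2 ∧
  0 < q 1 * q 2 - q 3 ^ 2 ∧ 0 < q 2 * q 0 - q 4 ^ 2 ∧ 0 < q 0 * q 1 - q 5 ^ 2 ∧
  (q 1 * q 2 - q 3 ^ 2) * k < (q 0 * q 1 * q 2 + 2 * q 3 * q 4 * q 5 - q 0 * q 3 ^ 2
    - q 1 * q 4 ^ 2 - q 2 * q 5 ^ 2) * 6 ^ 2 ∧
  (q 2 * q 0 - q 4 ^ 2) * k < (q 0 * q 1 * q 2 + 2 * q 3 * q 4 * q 5 - q 0 * q 3 ^ 2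
    - q 1 * q 4 ^ 2 - q 2 * q 5 ^ 2) * 4 ^ 2 ∧
  (q 0 * q 1 - q 5 ^ 2) * k < (q 0 * q 1 * q 2 + 2 * q 3 * q 4 * q 5 - q 0 * q 3 ^ 2
    - q 1 * q 4 ^ 2 - q 2 * q 5 ^ 2) * 2 ^ 2

instance (q : Fin 6 → ℤ) (k : ℤ) : Decidable (BoxBound q k) := by
  unfold BoxBound
  infer_instance

lemma abs_lt_of_mul_sq_le {d m k x B : ℤ} (hB : 0 ≤ B)
    (h : d * x ^ 2 ≤ m * k) (hk : m * k < d * B ^ 2) (hd : 0 < d) : |x| < B := by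
  rw [← sq_lt_sq₀ (abs_nonneg x) hB, sq_abs]
  exact lt_of_mul_lt_mul_left (h.trans_lt hk) hd.le

lemma represents_iff {K : TernaryLattice} {q : Fin 6 → ℤ} {k : ℤ}
    (hK : K.gram = (symMat (q 0) (q 1) (q 2) (q 3) (q 4) (q 5)).map (fun a : ℤ => (a : ℚ)))
    (hq : BoxBound q k) : Represents K k ↔ representsInBox q k = true := by
  have hval : ∀ v : Fin 3 → ℤ, (fun i => (v i : ℚ)) ⬝ᵥ K.gram *ᵥ (fun i => (v i : ℚ)) =
      (formEval q (v 0) (v 1) (v 2) : ℤ) := by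
    intro v
    rw [hK]
    simp [symMat, formEval, dotProduct, mulVec, Fin.sum_univ_three]
    ring
  rw [representsInBox, decide_eq_true_iff]
  constructor
  · rintro ⟨v, hv⟩
    rw [hval] at hv
    have hv' : formEval q (v 0) (v 1) (v 2) = k := by exact_mod_cast hv
    obtain ⟨a0, b0, c0, m0, m1, m2, h0, h1, h2⟩ := hq
    have hd : 0 < q 0 * q 1 * q 2 + 2 * q 3 * q 4 * q 5 - q 0 * q 3 ^ 2 - q 1 * q 4 ^ 2
        - q 2 * q 5 ^ 2 := by
      have := disc_pos K
      rw [disc_eq_of_gram hK] at this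
      exact_mod_cast this
    have e0 := mul_sq_le_of_form (a := q 0) (t := q 4) (u := q 5) (x := v 0) (y := v 1)
      (z := v 2) b0 m0
    have e1 := mul_sq_le_of_form (a := q 1) (t := q 5) (u := q 3) (x := v 1) (y := v 2)
      (z := v 0) c0 m1
    have e2 := mul_sq_le_of_form (a := q 2) (t := q 3) (u := q 4) (x := v 2) (y := v 0)
      (z := v 1) a0 m2
    rw [formEval] at hv'
    have x0 : |v 0| < 6 := abs_lt_of_mul_sq_le (by norm_num) (by rw [← hv']; linarith) h0 hd
    have x1 : |v 1| < 4 := abs_lt_of_mul_sq_le (by norm_num) (by rw [← hv']; linarith) h1 hd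
    have x2 : |v 2| < 2 := abs_lt_of_mul_sq_le (by norm_num) (by rw [← hv']; linarith) h2 hd
    rw [abs_lt] at x0 x1 x2
    have t0 : (((v 0 + 5).toNat : ℕ) : ℤ) - 5 = v 0 := by omega
    have t1 : (((v 1 + 3).toNat : ℕ) : ℤ) - 3 = v 1 := by omega
    have t2 : (((v 2 + 1).toNat : ℕ) : ℤ) - 1 = v 2 := by omega
    refine ⟨⟨(v 0 + 5).toNat, by omega⟩, ⟨(v 1 + 3).toNat, by omega⟩,
      ⟨(v 2 + 1).toNat, by omega⟩, ?_⟩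
    rw [t0, t1, t2, formEval]
    exact hv'
  · rintro ⟨x, y, z, h⟩
    exact ⟨![(x : ℕ) - 5, (y : ℕ) - 3, (z : ℕ) - 1], by rw [hval]; exact_mod_cast h⟩

/-- Lattices told apart by which of the values in `ks` they represent are not isometric. -/
lemma eq_of_isometric {n : ℕ} {L : Fin n → TernaryLattice} {q : Fin n → Fin 6 → ℤ}
    (hL : ∀ i, (L i).gram =
      (symMat (q i 0) (q i 1) (q i 2) (q i 3) (q i 4) (q i 5)).map (fun a : ℤ => (a : ℚ)))
    {ks : List ℤ} (hks : ∀ i, ∀ k ∈ ks, BoxBound (q i) k) {table : Fin n → List Bool}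
    (htable : ∀ i, ks.map (representsInBox (q i)) = table i)
    (hinj : Function.Injective table) {i j : Fin n} (h : Isometric (L i) (L j)) : i = j := by
  apply hinj
  rw [← htable, ← htable]
  refine List.map_congr_left fun k hk => ?_
  rw [Bool.eq_iff_iff, ← represents_iff (hL i) (hks i k hk), ← represents_iff (hL j) (hks j k hk)]
  exact ⟨h.symm.represents, h.represents⟩

/-- The coefficients of `N₁, …, N₁₂`. -/
def coeffN : Fin 12 → Fin 6 → ℤ :=
  ![![12, 15, 135, 5, 0, 0], ![3, 7, 1200, 0, 0, 1], ![3, 60, 140, 20, 0, 0],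
    ![3, 27, 300, 0, 0, 1], ![27, 27, 40, 10, 10, 3], ![12, 28, 83, 12, 4, -4],
    ![12, 28, 75, 0, 0, 4], ![15, 35, 48, 0, 0, 5], ![7, 12, 300, 0, 0, 2],
    ![12, 43, 60, 20, 0, 6], ![8, 12, 303, 4, -2, 4], ![12, 35, 60, 10, 0, 0]]

/-- The coefficients of `M₁, …, M₆`. -/
def coeffM : Fin 6 → Fin 6 → ℤ :=
  ![![1, 20, 80, 0, 0, 0], ![5, 16, 20, 0, 0, 0], ![4, 20, 25, 10, 0, 0], ![4, 5, 80, 0, 0, 0],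
    ![9, 9, 20, 0, 0, 1], ![4, 20, 21, 0, 2, 0]]

lemma listN_gram (i : Fin 12) : (listN i).gram = (symMat (coeffN i 0) (coeffN i 1) (coeffN i 2)
    (coeffN i 3) (coeffN i 4) (coeffN i 5)).map (fun a : ℤ => (a : ℚ)) := by
  fin_cases i <;> exact sextuple_gram _ _ _ _ _ _ (by norm_num)

lemma listM_gram (i : Fin 6) : (listM i).gram = (symMat (coeffM i 0) (coeffM i 1) (coeffM i 2)
    (coeffM i 3) (coeffM i 4) (coeffM i 5)).map (fun a : ℤ => (a : ℚ)) := by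
  fin_cases i <;> exact sextuple_gram _ _ _ _ _ _ (by norm_num)

theorem eq_of_isometric_listN {i j : Fin 12} (h : Isometric (listN i) (listN j)) : i = j :=
  eq_of_isometric listN_gram (ks := [3, 15, 28, 40, 75]) (by decide +kernel)
    (table := ![[false, true, false, false, false], [true, true, true, true, true],
      [true, false, false, false, true], [true, false, true, false, true],
      [false, false, false, true, false], [false, false, true, false, false],
      [false, false, true, false, true], [false, true, false, true, true],
      [false, true, true, false, false], [false, false, false, false, false],
      [false, false, true, true, false], [false, false, false, false, true]])
    (by decide +kernel) (by decide) h

theorem eq_of_isometric_listM {i j : Fin 6} (h : Isometric (listM i) (listM j)) : i = j :=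
  eq_of_isometric listM_gram (ks := [4, 9, 25]) (by decide +kernel)
    (table := ![[true, true, true], [false, false, true], [true, false, true],
      [true, true, false], [false, true, false], [true, false, false]])
    (by decide +kernel) (by decide) h

/-! ### Classes, spinor genera and the genus-correspondence -/

lemma spn_N (i : Fin 12) : spn (listN i) = if i < 6 then spn N₁ else spn N₇ := by
  have h2 := spn_eq_of_mem N₂_mem_spn
  have h3 := (spn_eq_of_mem N₃_mem_spn).trans h2
  have h4 := (spn_eq_of_mem N₄_mem_spn).trans h3
  have h5 := (spn_eq_of_mem N₅_mem_spn).trans h4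
  have h6 := (spn_eq_of_mem N₆_mem_spn).trans h5
  have h8 := spn_eq_of_mem N₈_mem_spn
  have h9 := (spn_eq_of_mem N₉_mem_spn).trans h8
  have h10 := (spn_eq_of_mem N₁₀_mem_spn).trans h9
  have h11 := (spn_eq_of_mem N₁₁_mem_spn).trans h10
  have h12 := (spn_eq_of_mem N₁₂_mem_spn).trans h11
  fin_cases i
  exacts [rfl, h2, h3, h4, h5, h6, rfl, h8, h9, h10, h11, h12]

lemma spn_M (i : Fin 6) : spn (listM i) = if i < 3 then spn M₁ else spn M₄ := by
  have h2 := spn_eq_of_mem M₂_mem_spn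
  have h3 := (spn_eq_of_mem M₃_mem_spn).trans h2
  have h6 := spn_eq_of_mem M₆_mem_spn
  have h5 := (spn_eq_of_mem M₅_mem_spn).trans h6
  fin_cases i
  exacts [rfl, h2, h3, rfl, h5, h6]

lemma mem_spn_self (L : TernaryLattice) : L ∈ spn L :=
  Isometric.mem_spn (isometric_refl L)

lemma spn_N₁_ne : spn N₁ ≠ spn N₇ := by
  intro h
  have h3 : spn N₃ = spn N₁ := spn_N 2
  exact N₇_notMem_spn (h3 ▸ h ▸ mem_spn_self N₇)

lemma spn_M₁_ne : spn M₁ ≠ spn M₄ := fun h => M₄_notMem_spn (h ▸ mem_spn_self M₄)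

lemma listN_mem_gen (i : Fin 12) : listN i ∈ gen N₁ := by
  have h1 : listN i ∈ spn (listN i) := mem_spn_self _
  rw [spn_N] at h1
  split_ifs at h1
  · exact spn_subset_gen _ h1
  · exact gen_trans N₇_mem_gen (spn_subset_gen _ h1)

lemma listM_mem_gen (i : Fin 6) : listM i ∈ gen M₁ := by
  have h1 : listM i ∈ spn (listM i) := mem_spn_self _
  rw [spn_M] at h1
  split_ifs at h1
  · exact spn_subset_gen _ h1
  · exact gen_trans M₄_mem_gen (spn_subset_gen _ h1)

/-- The classes of the lattices in a set of which `L i`, `i ∈ s`, are representatives. -/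
lemma cls_image_eq {ι : Type*} {S : Set TernaryLattice} {L : ι → TernaryLattice} {s : Set ι}
    (h₁ : ∀ i ∈ s, L i ∈ S) (h₂ : ∀ K ∈ S, ∃ i ∈ s, Isometric K (L i)) :
    cls '' S = (fun i => cls (L i)) '' s := by
  ext C
  constructor
  · rintro ⟨K, hK, rfl⟩
    obtain ⟨i, hi, h⟩ := h₂ K hK
    exact ⟨i, hi, (cls_eq_iff.mpr h).symm⟩
  · rintro ⟨i, hi, rfl⟩
    exact ⟨L i, h₁ i hi, rfl⟩

lemma cls_gen_N : cls '' gen N₁ = (fun i => cls (listN i)) '' Set.univ :=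
  cls_image_eq (fun i _ => listN_mem_gen i) fun _ hK =>
    (exists_isometric_of_mem_gen_N hK).imp fun _ h => ⟨trivial, h⟩

lemma cls_gen_M : cls '' gen M₁ = (fun i => cls (listM i)) '' Set.univ :=
  cls_image_eq (fun i _ => listM_mem_gen i) fun _ hK =>
    (exists_isometric_of_mem_gen_M hK).imp fun _ h => ⟨trivial, h⟩

lemma cls_spn_N₁ : cls '' spn N₁ = (fun i => cls (listN i)) '' {i | i < 6} := by
  refine cls_image_eq (fun i hi => ?_) fun K hK => ?_
  · have h := spn_N i
    rw [if_pos (show i < 6 from hi)] at h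
    exact h ▸ mem_spn_self _
  · obtain ⟨i, hi⟩ := exists_isometric_of_mem_gen_N (spn_subset_gen _ hK)
    refine ⟨i, ?_, hi⟩
    by_contra (hn : ¬ i < 6)
    have h := spn_N i
    rw [if_neg hn, spn_eq_of_mem (Isometric.mem_spn hi), spn_eq_of_mem hK] at h
    exact spn_N₁_ne h

lemma cls_spn_N₇ : cls '' spn N₇ = (fun i => cls (listN i)) '' {i | ¬ i < 6} := by
  refine cls_image_eq (fun i hi => ?_) fun K hK => ?_
  · have h := spn_N i
    rw [if_neg (show ¬ i < 6 from hi)] at h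
    exact h ▸ mem_spn_self _
  · obtain ⟨i, hi⟩ := exists_isometric_of_mem_gen_N (gen_trans N₇_mem_gen (spn_subset_gen _ hK))
    refine ⟨i, fun hn => ?_, hi⟩
    have h := spn_N i
    rw [if_pos hn, spn_eq_of_mem (Isometric.mem_spn hi), spn_eq_of_mem hK] at h
    exact spn_N₁_ne h.symm

lemma cls_spn_M₁ : cls '' spn M₁ = (fun i => cls (listM i)) '' {i | i < 3} := by
  refine cls_image_eq (fun i hi => ?_) fun K hK => ?_
  · have h := spn_M i
    rw [if_pos (show i < 3 from hi)] at h
    exact h ▸ mem_spn_self _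
  · obtain ⟨i, hi⟩ := exists_isometric_of_mem_gen_M (spn_subset_gen _ hK)
    refine ⟨i, ?_, hi⟩
    by_contra (hn : ¬ i < 3)
    have h := spn_M i
    rw [if_neg hn, spn_eq_of_mem (Isometric.mem_spn hi), spn_eq_of_mem hK] at h
    exact spn_M₁_ne h

lemma cls_spn_M₄ : cls '' spn M₄ = (fun i => cls (listM i)) '' {i | ¬ i < 3} := by
  refine cls_image_eq (fun i hi => ?_) fun K hK => ?_
  · have h := spn_M i
    rw [if_neg (show ¬ i < 3 from hi)] at h
    exact h ▸ mem_spn_self _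
  · obtain ⟨i, hi⟩ := exists_isometric_of_mem_gen_M (gen_trans M₄_mem_gen (spn_subset_gen _ hK))
    refine ⟨i, fun hn => ?_, hi⟩
    have h := spn_M i
    rw [if_pos hn, spn_eq_of_mem (Isometric.mem_spn hi), spn_eq_of_mem hK] at h
    exact spn_M₁_ne h.symm

lemma ncard_cls_gen_N : (cls '' gen N₁).ncard = 12 := by
  rw [cls_gen_N, Set.ncard_image_of_injective _ fun i j h =>
    eq_of_isometric_listN (cls_eq_iff.mp h), Set.ncard_univ, Nat.card_fin]

lemma ncard_cls_gen_M : (cls '' gen M₁).ncard = 6 := by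
  rw [cls_gen_M, Set.ncard_image_of_injective _ fun i j h =>
    eq_of_isometric_listM (cls_eq_iff.mp h), Set.ncard_univ, Nat.card_fin]

theorem g_N₁ : g N₁ = 2 := by
  rw [g, show spn '' gen N₁ = {spn N₁, spn N₇} from ?_, Set.ncard_pair spn_N₁_ne]
  ext S
  constructor
  · rintro ⟨K, hK, rfl⟩
    obtain ⟨i, hi⟩ := exists_isometric_of_mem_gen_N hK
    rw [← spn_eq_of_mem (Isometric.mem_spn hi), spn_N]
    split_ifs
    · exact Or.inl rfl
    · exact Or.inr rfl
  · rintro (rfl | rfl)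
    · exact ⟨N₁, listN_mem_gen 0, rfl⟩
    · exact ⟨N₇, N₇_mem_gen, rfl⟩

theorem g_M₁ : g M₁ = 2 := by
  rw [g, show spn '' gen M₁ = {spn M₁, spn M₄} from ?_, Set.ncard_pair spn_M₁_ne]
  ext S
  constructor
  · rintro ⟨K, hK, rfl⟩
    obtain ⟨i, hi⟩ := exists_isometric_of_mem_gen_M hK
    rw [← spn_eq_of_mem (Isometric.mem_spn hi), spn_M]
    split_ifs
    · exact Or.inl rfl
    · exact Or.inr rfl
  · rintro (rfl | rfl)
    · exact ⟨M₁, listM_mem_gen 0, rfl⟩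
    · exact ⟨M₄, M₄_mem_gen, rfl⟩

theorem isGenusCorrespondence_corrS : IsGenusCorrespondence 15 N₁ M₁ corrS := by
  refine ⟨?_, fun N' hN' => ?_, fun M' hM' => ?_⟩
  · rintro c (rfl | rfl | rfl | rfl | rfl | rfl | rfl | rfl | rfl | rfl | rfl | rfl)
    · exact ⟨_, listN_mem_gen 0, _, listM_mem_gen 0, rfl, representablePair_N₁_M₁⟩
    · exact ⟨_, listN_mem_gen 8, _, listM_mem_gen 0, rfl, representablePair_N₉_M₁⟩
    · exact ⟨_, listN_mem_gen 2, _, listM_mem_gen 1, rfl, representablePair_N₃_M₂⟩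
    · exact ⟨_, listN_mem_gen 6, _, listM_mem_gen 1, rfl, representablePair_N₇_M₂⟩
    · exact ⟨_, listN_mem_gen 4, _, listM_mem_gen 2, rfl, representablePair_N₅_M₃⟩
    · exact ⟨_, listN_mem_gen 10, _, listM_mem_gen 2, rfl, representablePair_N₁₁_M₃⟩
    · exact ⟨_, listN_mem_gen 1, _, listM_mem_gen 3, rfl, representablePair_N₂_M₄⟩
    · exact ⟨_, listN_mem_gen 7, _, listM_mem_gen 3, rfl, representablePair_N₈_M₄⟩
    · exact ⟨_, listN_mem_gen 5, _, listM_mem_gen 4, rfl, representablePair_N₆_M₅⟩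
    · exact ⟨_, listN_mem_gen 9, _, listM_mem_gen 4, rfl, representablePair_N₁₀_M₅⟩
    · exact ⟨_, listN_mem_gen 3, _, listM_mem_gen 5, rfl, representablePair_N₄_M₆⟩
    · exact ⟨_, listN_mem_gen 11, _, listM_mem_gen 5, rfl, representablePair_N₁₂_M₆⟩
  · obtain ⟨i, hi⟩ := exists_isometric_of_mem_gen_N hN'
    rw [cls_eq_iff.mpr hi]
    -- the position in the list of the partner of the `i`-th class
    refine ⟨listM (![0, 3, 1, 5, 2, 4, 1, 3, 0, 4, 2, 5] i), listM_mem_gen _, ?_⟩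
    fin_cases i <;> simp [corrS, listN, listM]
  · obtain ⟨i, hi⟩ := exists_isometric_of_mem_gen_M hM'
    rw [cls_eq_iff.mpr hi]
    refine ⟨listN (![0, 2, 4, 1, 5, 3] i), listN_mem_gen _, ?_⟩
    fin_cases i <;> simp [corrS, listN, listM]

/-- The class of `M₁` is paired with those of `N₁` and `N₉`, which lie in different spinor
genera. -/
theorem not_respectsSpinorGenus_corrS : ¬ RespectsSpinorGenus corrS := by
  intro h
  have h1 := (h N₁ M₁ N₉ M₁ (by simp [corrS]) (by simp [corrS])).mpr (mem_spn_self M₁)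
  have h2 : spn N₉ = spn N₇ := spn_N 8
  exact spn_N₁_ne ((spn_eq_of_mem h1).trans h2)

theorem not_jagyConjecture : ¬ JagyConjecture := fun h =>
  not_respectsSpinorGenus_corrS <| h 15 N₁ M₁ (by decide +kernel) representablePair_N₁_M₁
    (g_N₁.trans g_M₁.symm) corrS isGenusCorrespondence_corrS

end TernaryLattice

theorem mainTheorem4 :
    -- `n = 15` is square-free, `g(N₁) = g(M₁) = 2`, `dN₁ = 15 dM₁`, and `M₁^15 → N₁`
    Squarefree (15 : ℕ) ∧ g N₁ = 2 ∧ g M₁ = 2 ∧ N₁.disc = 15 * M₁.disc ∧ ScaledRepresented 15 M₁ N₁ ∧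
    -- the genus of `N₁`: 12 classes
    cls '' gen N₁ = {cls N₁, cls N₂, cls N₃, cls N₄, cls N₅, cls N₆,
      cls N₇, cls N₈, cls N₉, cls N₁₀, cls N₁₁, cls N₁₂} ∧
    (cls '' gen N₁).ncard = 12 ∧
    -- its spinor genera
    cls '' spn N₁ = {cls N₁, cls N₂, cls N₃, cls N₄, cls N₅, cls N₆} ∧
    cls '' spn N₇ = {cls N₇, cls N₈, cls N₉, cls N₁₀, cls N₁₁, cls N₁₂} ∧
    -- the genus of `M₁`: 6 classes
    cls '' gen M₁ = {cls M₁, cls M₂, cls M₃, cls M₄, cls M₅, cls M₆} ∧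
    (cls '' gen M₁).ncard = 6 ∧
    -- its spinor genera
    cls '' spn M₁ = {cls M₁, cls M₂, cls M₃} ∧
    cls '' spn M₄ = {cls M₄, cls M₅, cls M₆} ∧
    -- `𝔖` is a genus-correspondence that does not respect spinor genus
    IsGenusCorrespondence 15 N₁ M₁ corrS ∧ ¬ RespectsSpinorGenus corrS ∧
    -- hence Jagy's conjecture fails
    ¬ JagyConjecture := by
  refine ⟨by decide +kernel, g_N₁, g_M₁, representablePair_N₁_M₁.2, representablePair_N₁_M₁.1, ?_,
    ncard_cls_gen_N, ?_, ?_, ?_, ncard_cls_gen_M, ?_, ?_, isGenusCorrespondence_corrS,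
    not_respectsSpinorGenus_corrS, not_jagyConjecture⟩
  · rw [cls_gen_N, show (Set.univ : Set (Fin 12)) = {0, 1, 2, 3, 4, 5, 6, 7, 8, 9, 10, 11} by
      ext i; revert i; simp; decide]
    simp only [Set.image_insert_eq, Set.image_singleton]
    rfl
  · rw [cls_spn_N₁, show {i : Fin 12 | i < 6} = {0, 1, 2, 3, 4, 5} by
      ext i; revert i; simp; decide]
    simp only [Set.image_insert_eq, Set.image_singleton]
    rfl
  · rw [cls_spn_N₇, show {i : Fin 12 | ¬ i < 6} = {6, 7, 8, 9, 10, 11} by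
      ext i; revert i; simp; decide]
    simp only [Set.image_insert_eq, Set.image_singleton]
    rfl
  · rw [cls_gen_M, show (Set.univ : Set (Fin 6)) = {0, 1, 2, 3, 4, 5} by
      ext i; revert i; simp; decide]
    simp only [Set.image_insert_eq, Set.image_singleton]
    rfl
  · rw [cls_spn_M₁, show {i : Fin 6 | i < 3} = {0, 1, 2} by ext i; revert i; simp; decide]
    simp only [Set.image_insert_eq, Set.image_singleton]
    rfl
  · rw [cls_spn_M₄, show {i : Fin 6 | ¬ i < 3} = {3, 4, 5} by ext i; revert i; simp; decide]
    simp only [Set.image_insert_eq, Set.image_singleton]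
    rfl
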